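/- **Theorem (quantitative mode stability on the real axis).** For real parameters with $M>0$ and $a^2+Q^2<M^2$ put $r_\pm=M\pm\sqrt{M^2-a^2-Q^2}$ and $\Delta(r)=r^2-2Mr+a^2+Q^2=(r-r_+)(r-r_-)$, and let $r^*$ be a coordinate on $(r_+,\infty)$ with $\frac{dr^*}{dr}=\frac{r^2+a^2}{\Delta}$ (determined up to an additive constant, with range $\mathbb R$); primes on functions of $r^*$ denote $d/dr^*$. For $\omega\in\mathbb R$ and $m,\ell\in\mathbb Z$ with $\ell\ge|m|$ let $\lambda_{m\ell}=\lambda_{m\ell}^{(a\omega)}$, $\ell=|m|,|m|+1,\dots$, be the eigenvalues, in increasing order, of the problem $$\frac1{\sin\theta}\frac{d}{d\theta}\Big(\sin\theta\,\frac{dS}{d\theta}\Big)-\Big(\frac{m^2}{\sin^2\theta}-a^2\omega^2\cos^2\theta\Big)S+\lambda S=0\quad\text{on }(0,\pi),$$ where $S\not\equiv0$ and $e^{im\phi}S(\theta)$ extends smoothly to $\mathbb S^2$. The radial Carter ODE is $$u''+(\omega^2-V)u=0,\qquad V=\frac{2am\omega(r^2+a^2-\Delta)-a^2m^2+\Delta(\lambda_{m\ell}+a^2\omega^2)}{(r^2+a^2)^2}+\frac{\Delta(2r^2+\Delta-2Mr)}{(r^2+a^2)^3}-\frac{3\Delta^2r^2}{(r^2+a^2)^4}.$$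 Let $\xi=\frac{i(am-(2Mr_+-Q^2)\omega)}{r_+-r_-}$. For $\omega\neq0$, let $u_{hor}$ be a solution such that $(r-r_+)^{-\xi}u_{hor}$, as a function of $r$, extends smoothly to $r=r_+$, with $\big|\big((r-r_+)^{-\xi}u_{hor}\big)(r_+)\big|^2=1$. Let $u_{out}$ be a solution for which there are constants $C_0,C_1,\dots\in\mathbb C$ such that, for every $N$, $u_{out}=e^{i\omega r^*}\sum_{k=0}^N C_kr^{-k}+O(r^{-N-1})$ as $r\to\infty$, with $\lim_{r\to\infty}|u_{out}e^{-i\omega r^*}|^2=1$. These functions are unique up to constant factors of modulus one. Let $W(\omega,m,\ell)=u_{hor}u_{out}'-u_{hor}'u_{out}$, which does not depend on $r^*$; $|W|$ does not depend on the choices made. Then there is a function $G$ of four real variables such that the following holds for all such $a,Q,M$. Let $\mathcal F\subset\{(\omega,m,\ell)\in\mathbb R\times\mathbb Z\times\mathbb Z:\ \ell\ge|m|\}$ be any set with $\omega\ne0$ on $\mathcal F$ and $$C_{\mathcal F}:=\sup_{(\omega,m,\ell)\in\mathcal F}\big(|\omega|+|\omega|^{-1}+|m|+|\lambda_{m\ell}|\big)<\infty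 .$$ Then $W(\omega,m,\ell)\neq0$ for all $(\omega,m,\ell)\in\mathcal F$, and $$\sup_{(\omega,m,\ell)\in\mathcal F}|W^{-1}|\le G(C_{\mathcal F},a,Q,M).$$ -/

import Mathlib

open scoped Manifold

namespace KerrNewman

noncomputable section

/-- Subextremal Kerr–Newman black hole parameters: mass `M > 0` and `a² + Q² < M²`. -/
def Subextremal (a Q M : ℝ) : Prop := 0 < M ∧ a ^ 2 + Q ^ 2 < M ^ 2

/-- The outer root `r₊` of `Δ` (event horizon). -/
def rPlus (a Q M : ℝ) : ℝ := M + √(M ^ 2 - a ^ 2 - Q ^ 2)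

/-- The inner root `r₋` of `Δ`. -/
def rMinus (a Q M : ℝ) : ℝ := M - √(M ^ 2 - a ^ 2 - Q ^ 2)

/-- `Δ(r) = r² - 2Mr + a² + Q²`. -/
def Delta (a Q M r : ℝ) : ℝ := r ^ 2 - 2 * M * r + a ^ 2 + Q ^ 2

/-- `rs` is a tortoise coordinate `r ↦ r*` on `(r₊, ∞)`: `dr*/dr = (r² + a²) / Δ`. This fixes `rs`
on `(r₊, ∞)` up to an additive constant. -/
def IsTortoise (a Q M : ℝ) (rs : ℝ → ℝ) : Prop :=
  ∀ r : ℝ, rPlus a Q M < r → HasDerivAt rs ((r ^ 2 + a ^ 2) / Delta a Q M r) r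

/-! ### The angular Sturm–Liouville problem -/

/-- The point of the unit sphere `𝕊² ⊆ ℝ³` with polar angle `θ` and azimuth `φ`. -/
def spherePoint (θ φ : ℝ) : Metric.sphere (0 : EuclideanSpace ℝ (Fin 3)) 1 :=
  ⟨!₂[Real.sin θ * Real.cos φ, Real.sin θ * Real.sin φ, Real.cos θ], by
    rw [mem_sphere_zero_iff_norm, EuclideanSpace.norm_eq, Real.sqrt_eq_one]
    simp only [Fin.sum_univ_three, Real.norm_eq_abs, sq_abs]
    simp only [Matrix.cons_val_zero, Matrix.cons_val_one, Matrix.cons_val]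
    nlinarith [Real.sin_sq_add_cos_sq θ, Real.sin_sq_add_cos_sq φ]⟩

/-- `S` is an oblate spheroidal eigenfunction with azimuthal number `m`, frequency `ω` and
eigenvalue `lam`: it does not vanish identically on `(0, π)`, `e^{imφ} S(θ)` extends smoothly to the
sphere, and
`(1 / sin θ) (sin θ S')' - (m² / sin² θ - a² ω² cos² θ) S + lam S = 0` on `(0, π)`. -/
structure IsAngularEigenfunction (a ω : ℝ) (m : ℤ) (lam : ℝ) (S : ℝ → ℂ) : Prop where
  ne_zero : ∃ θ ∈ Set.Ioo 0 Real.pi, S θ ≠ 0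
  smooth : ∃ f : Metric.sphere (0 : EuclideanSpace ℝ (Fin 3)) 1 → ℂ,
    ContMDiff (𝓡 2) 𝓘(ℝ, ℂ) ((⊤ : ℕ∞) : WithTop ℕ∞) f ∧
      ∀ θ ∈ Set.Ioo 0 Real.pi, ∀ φ : ℝ,
        f (spherePoint θ φ) = Complex.exp (Complex.I * m * φ) * S θ
  ode : ∀ θ ∈ Set.Ioo 0 Real.pi,
    ((1 / Real.sin θ : ℝ) : ℂ) * deriv (fun t => (Real.sin t : ℂ) * deriv S t) θ
      - (((m : ℝ) ^ 2 / Real.sin θ ^ 2 - a ^ 2 * ω ^ 2 * Real.cos θ ^ 2 : ℝ) : ℂ) * S θ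
      + (lam : ℂ) * S θ = 0

/-- The (real) eigenvalues of the angular problem with parameters `aω` and `m`. -/
def angularSpectrum (a ω : ℝ) (m : ℤ) : Set ℝ :=
  {lam | ∃ S : ℝ → ℂ, IsAngularEigenfunction a ω m lam S}

/-- The eigenvalue `λ_{mℓ}^{(aω)}`, `ℓ ≥ |m|`. For fixed `aω` and `m` the eigenvalues are simple,
bounded below and discrete, and they are listed in increasing order by `ℓ = |m|, |m| + 1, …`; so
`λ_{mℓ}` is the least eigenvalue having at least `ℓ - |m|` eigenvalues below it. -/
def angularEigenvalue (a ω : ℝ) (m ℓ : ℤ) : ℝ :=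
  sInf {lam | lam ∈ angularSpectrum a ω m ∧
    (((ℓ - |m|).toNat : ℕ) : ℕ∞) ≤ {μ | μ ∈ angularSpectrum a ω m ∧ μ < lam}.encard}

/-! ### The radial Carter ODE -/

/-- The potential `V(r)` for which `u = (r² + a²)^{1/2} R` satisfies `u'' + (ω² - V) u = 0`
(prime `= d/dr*`) when `R` solves the separated radial equation
`(Δ R')' + (-ω² (a² - (r² + a²)² / Δ) + a² m² / Δ - 2 a m ω (2Mr - Q²) / Δ - lam) R = 0`. -/
def potential (a Q M ω : ℝ) (m : ℤ) (lam r : ℝ) : ℝ :=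
  (2 * a * m * ω * (r ^ 2 + a ^ 2 - Delta a Q M r) - a ^ 2 * (m : ℝ) ^ 2
      + Delta a Q M r * (lam + a ^ 2 * ω ^ 2)) / (r ^ 2 + a ^ 2) ^ 2
    + Delta a Q M r * (2 * r ^ 2 + Delta a Q M r - 2 * M * r) / (r ^ 2 + a ^ 2) ^ 3
    - 3 * Delta a Q M r ^ 2 * r ^ 2 / (r ^ 2 + a ^ 2) ^ 4

/-- `u`, a function of `r* ∈ ℝ`, solves `u'' + (ω² - V) u = 0`. As `r` runs over `(r₊, ∞)`, `rs r`
runs over all of `ℝ`. -/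
def IsCarterSolution (a Q M ω : ℝ) (m : ℤ) (lam : ℝ) (rs : ℝ → ℝ) (u : ℝ → ℂ) : Prop :=
  ContDiff ℝ 2 u ∧
    ∀ r : ℝ, rPlus a Q M < r →
      deriv (deriv u) (rs r) + ((ω ^ 2 - potential a Q M ω m lam r : ℝ) : ℂ) * u (rs r) = 0

/-- The horizon exponent `ξ = i (am - (2Mr₊ - Q²) ω) / (r₊ - r₋)`. -/
def xi (a Q M ω : ℝ) (m : ℤ) : ℂ :=
  Complex.I * (((a * m - (2 * M * rPlus a Q M - Q ^ 2) * ω)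
    / (rPlus a Q M - rMinus a Q M) : ℝ) : ℂ)

/-- `u` is a function `u_hor`: a solution with `u ~ (r - r₊)^ξ` as `r* → -∞`, in the sense that
`(r - r₊)^{-ξ} u` is smooth up to `r = r₊`, and with `|((r - r₊)^{-ξ} u)(-∞)|² = 1`. -/
structure IsHor (a Q M ω : ℝ) (m : ℤ) (lam : ℝ) (rs : ℝ → ℝ) (u : ℝ → ℂ) : Prop where
  solution : IsCarterSolution a Q M ω m lam rs u
  asymp : ∃ h : ℝ → ℂ, ContDiffOn ℝ ((⊤ : ℕ∞) : WithTop ℕ∞) h (Set.Ici (rPlus a Q M)) ∧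
    ∀ r : ℝ, rPlus a Q M < r →
      h r = ((r - rPlus a Q M : ℝ) : ℂ) ^ (-xi a Q M ω m) * u (rs r)
  normalized : Filter.Tendsto
    (fun r : ℝ => ‖((r - rPlus a Q M : ℝ) : ℂ) ^ (-xi a Q M ω m) * u (rs r)‖ ^ 2)
    (nhdsWithin (rPlus a Q M) (Set.Ioi (rPlus a Q M))) (nhds 1)

/-- `u` is a function `u_out`: a solution with `u ~ e^{iωr*}` as `r* → ∞`, in the sense of a full
asymptotic expansion `u = e^{iωr*} ∑_{k ≤ N} C_k r^{-k} + O(r^{-N-1})`, and with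
`|(u e^{-iωr*})(∞)|² = 1`. -/
structure IsOut (a Q M ω : ℝ) (m : ℤ) (lam : ℝ) (rs : ℝ → ℝ) (u : ℝ → ℂ) : Prop where
  solution : IsCarterSolution a Q M ω m lam rs u
  asymp : ∃ C : ℕ → ℂ, ∀ N : ℕ,
    (fun r : ℝ => u (rs r) - Complex.exp (Complex.I * ω * rs r) *
        ∑ k ∈ Finset.range (N + 1), C k * ((r : ℂ) ^ k)⁻¹)
      =O[Filter.atTop] (fun r : ℝ => (r ^ (N + 1))⁻¹)
  normalized : Filter.Tendsto
    (fun r : ℝ => ‖u (rs r) * Complex.exp (-(Complex.I * ω * rs r))‖ ^ 2)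
    Filter.atTop (nhds 1)

/-- The Wronskian `W = u_hor u_out' - u_hor' u_out`, evaluated at `r* = x`. -/
def wronskian (uHor uOut : ℝ → ℂ) (x : ℝ) : ℂ :=
  uHor x * deriv uOut x - deriv uHor x * uOut x

/-! ### Frequency ranges -/

/-- Real frequency triples `(ω, m, ℓ)` with `ω ≠ 0` and `ℓ ≥ |m|`. -/
def admissibleFreq : Set (ℝ × ℤ × ℤ) := {p | p.1 ≠ 0 ∧ |p.2.1| ≤ p.2.2}

/-- `|ω| + |ω|⁻¹ + |m| + |λ_{mℓ}|`. -/
def freqSize (a : ℝ) (p : ℝ × ℤ × ℤ) : ℝ :=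
  |p.1| + |p.1|⁻¹ + |(p.2.1 : ℝ)| + |angularEigenvalue a p.1 p.2.1 p.2.2|

/-- `C_F = sup_F (|ω| + |ω|⁻¹ + |m| + |λ_{mℓ}|)`. -/
def freqBound (a : ℝ) (F : Set (ℝ × ℤ × ℤ)) : ℝ := sSup (freqSize a '' F)

end

end KerrNewman

namespace KerrNewman

open Set Filter Topology MeasureTheory

noncomputable section

/-! Put x = r - r₊, δ = r₊ - r₋, κ = ω(r₊² + a²) - am and c = 2κ/δ. Dividing u_hor by √(r² + a²) and
multiplying by unimodular factors turns the Carter equation into a confluent Heun equation for a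
profile f regular at x = 0 (`ModeProfile`). At infinity the outgoing part of f behaves like
x^(-1+4iMω), with derivative O(x⁻²), and the incoming part like e^(-2iωx)/x. So the limsup of x|f'|
measures the incoming part, and comparison with u_out bounds it by |W| (`profile_at_top`). What must
be shown is that a regular profile of controlled size, with |f| of fixed positive size at the
horizon, cannot have an arbitrarily small incoming part.

The energy identity for u itself does not give this: its horizon flux has the sign of κ, which may
be opposite to that of ω (superradiance). The remedy, as in Whiting's argument, is an integral
transform, here F(z) = ∫ e^(2iωx) x^(-ic) f(x) (x+δ+z)^(-1+ic) dx. Green's identity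
(`ModeProfile.green`) shows that F solves a second-order equation on z ≥ 0 with error at most W
(`ModeProfile.norm_transform_ode`). Its current equals -2Mωδ|F(0)|² at z = 0 and ω(z+δ)(z-2M)|F(z)|²
plus a decaying term for large z. The two signs are opposite whatever am is, so F(0) is small when W
is (`exists_moment_zero_small`).

To return from F(0) to f, note that F(0) is the zeroth of the moments of f against x^n (x+δ)^(-s-n),
s = 1 - 4iMω. Green's identity gives these a three-term recurrence with error W, so every moment is
small. They are polynomial moments in x/(x+δ) ∈ [0,1], and by Weierstrass approximation the pairing
of f with a bump near the horizon is small too. But f is nearly a constant of fixed modulus there,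
which bounds W from below (`exists_incoming_lower_bound`).

Uniformity holds because each constant depends only on bounds for the parameters. Near the horizon f
is controlled by integrating its equation (`near_horizon`), away from it by an energy estimate using
V = O(r⁻²) (`CarterSystem.energy_le`). The angular eigenvalue enters only as a bounded real number.
-/

/-! ### Elementary unimodular phases -/

/-- The unimodular function `x ↦ x^{ic}` on `(0, ∞)`. -/
def logPhase (c x : ℝ) : ℂ := Complex.exp (Complex.I * ((c * Real.log x : ℝ) : ℂ))

/-- The unimodular function `x ↦ e^{ikx}`. -/
def linPhase (k x : ℝ) : ℂ := Complex.exp (Complex.I * ((k * x : ℝ) : ℂ))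

lemma norm_logPhase (c x : ℝ) : ‖logPhase c x‖ = 1 := Complex.norm_exp_I_mul_ofReal _

lemma norm_linPhase (k x : ℝ) : ‖linPhase k x‖ = 1 := Complex.norm_exp_I_mul_ofReal _

lemma logPhase_mul (c d x : ℝ) : logPhase c x * logPhase d x = logPhase (c + d) x := by
  rw [logPhase, logPhase, logPhase, ← Complex.exp_add]
  congr 1; push_cast; ring

lemma logPhase_zero (x : ℝ) : logPhase 0 x = 1 := by simp [logPhase]

lemma hasDerivAt_logPhase (c : ℝ) {x : ℝ} (hx : x ≠ 0) :
    HasDerivAt (logPhase c) (Complex.I * c / x * logPhase c x) x := by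
  have h := (((Real.hasDerivAt_log hx).const_mul c).ofReal_comp.const_mul Complex.I).cexp
  refine h.congr_deriv ?_
  simp only [logPhase]; push_cast; ring

lemma hasDerivAt_logPhase_add (c b : ℝ) {x : ℝ} (hx : x + b ≠ 0) :
    HasDerivAt (fun y => logPhase c (y + b))
      (Complex.I * c / ((x + b : ℝ) : ℂ) * logPhase c (x + b)) x :=
  HasDerivAt.comp_add_const x b (hasDerivAt_logPhase c hx)

lemma hasDerivAt_linPhase (k x : ℝ) :
    HasDerivAt (linPhase k) (Complex.I * k * linPhase k x) x := by
  have h := (((hasDerivAt_id x).const_mul k).ofReal_comp.const_mul Complex.I).cexp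
  refine h.congr_deriv ?_
  simp only [linPhase, id, mul_one]; ring

lemma hasDerivAt_ofReal (x : ℝ) : HasDerivAt (fun y : ℝ => (y : ℂ)) 1 x := by
  simpa using (hasDerivAt_id x).ofReal_comp

lemma hasDerivAt_ofReal_add (x b : ℝ) : HasDerivAt (fun y : ℝ => ((y + b : ℝ) : ℂ)) 1 x := by
  simpa using ((hasDerivAt_id x).add_const b).ofReal_comp

/-! ### The profile equation and Green's identity -/

/-- A solution profile of the confluent Heun form of the radial equation that is regular at `x = 0`,
is `O(1 / x)` at infinity, and whose incoming part at infinity has size at most `W`. -/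
structure ModeProfile (δ M ω c b : ℝ) (f f' : ℝ → ℂ) (B W : ℝ) : Prop where
  deriv : ∀ x, 0 < x → HasDerivAt f (f' x) x
  ode : ∀ x, 0 < x → HasDerivAt (fun y : ℝ => (y : ℂ) * ((y + δ : ℝ) : ℂ) * f' y)
    (-(2 * Complex.I * (ω * x * (x + δ) - 2 * M * ω * x - c * δ / 2) * f' x)
      - (2 * Complex.I * ω * x + 8 * M * ω ^ 2 * x + b + Complex.I * ω * (δ - 2 * M)) * f x) x
  bound : ∀ x, 0 < x → ‖f x‖ ≤ B / (x + δ)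
  at_zero : Tendsto (fun x : ℝ => (x : ℂ) * f' x) (𝓝[>] 0) (𝓝 0)
  at_top : ∀ e, 0 < e → ∀ᶠ x in atTop, x * ‖f' x‖ ≤ W + e

/-- The unimodular weight that puts the profile equation in self-adjoint form. -/
def profileWeight (δ M ω c x : ℝ) : ℂ :=
  linPhase (2 * ω) x * logPhase (-c) x * logPhase (c - 4 * M * ω) (x + δ)

lemma norm_profileWeight (δ M ω c x : ℝ) : ‖profileWeight δ M ω c x‖ = 1 := by
  simp [profileWeight, norm_linPhase, norm_logPhase]

/-- Partial fractions: the logarithmic derivative is i(2ω - c/x + (c - 4Mω)/(x+δ)), one term for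
each phase factor. -/
lemma hasDerivAt_profileWeight {δ : ℝ} (hδ : 0 < δ) (M ω c : ℝ) {x : ℝ} (hx : 0 < x) :
    HasDerivAt (profileWeight δ M ω c)
      (2 * Complex.I * (ω * x * (x + δ) - 2 * M * ω * x - c * δ / 2) / (x * ((x + δ : ℝ) : ℂ))
        * profileWeight δ M ω c x) x := by
  have hxp : x + δ ≠ 0 := by positivity
  have h := ((hasDerivAt_linPhase (2 * ω) x).mul (hasDerivAt_logPhase (-c) hx.ne')).mul
    (hasDerivAt_logPhase_add (c - 4 * M * ω) δ hxp)
  have h1 : (x : ℂ) ≠ 0 := by exact_mod_cast hx.ne'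
  have h2 : (x : ℂ) + δ ≠ 0 := by exact_mod_cast hxp
  refine h.congr_deriv ?_
  simp only [profileWeight, Pi.mul_apply]
  push_cast
  field_simp
  ring

lemma continuousOn_logPhase_add (c b : ℝ) {s : Set ℝ} (hs : ∀ x ∈ s, x + b ≠ 0) :
    ContinuousOn (fun x => logPhase c (x + b)) s := fun x hx =>
  (hasDerivAt_logPhase_add c b (hs x hx)).continuousAt.continuousWithinAt

lemma continuous_linPhase (k : ℝ) : Continuous (linPhase k) :=
  continuous_iff_continuousAt.2 fun x => (hasDerivAt_linPhase k x).continuousAt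

lemma continuousOn_profileWeight {δ : ℝ} (hδ : 0 < δ) (M ω c : ℝ) :
    ContinuousOn (profileWeight δ M ω c) (Ioi 0) := fun _ hx =>
  (hasDerivAt_profileWeight hδ M ω c hx).continuousAt.continuousWithinAt

lemma ModeProfile.continuousOn {δ M ω c b : ℝ} {f f' : ℝ → ℂ} {B W : ℝ}
    (h : ModeProfile δ M ω c b f f' B W) : ContinuousOn f (Ioi 0) := fun x hx =>
  (h.deriv x hx).continuousAt.continuousWithinAt

lemma ModeProfile.bound_nonneg {δ M ω c b : ℝ} {f f' : ℝ → ℂ} {B W : ℝ} (hδ : 0 < δ)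
    (h : ModeProfile δ M ω c b f f' B W) : 0 ≤ B := by
  have h1 := (norm_nonneg _).trans (h.bound 1 one_pos)
  by_contra! hB
  exact absurd h1 (not_le.2 (div_neg_of_neg_of_pos hB (by positivity)))

lemma integrableOn_inv_sq {δ : ℝ} (hδ : 0 < δ) (C : ℝ) :
    IntegrableOn (fun x : ℝ => C / (x + δ) ^ 2) (Ioi 0) := by
  have h := (integrableOn_add_rpow_Ioi_of_lt (a := -2) (c := 0) (m := δ) (by norm_num)
    (by linarith)).const_mul C
  refine IntegrableOn.congr_fun h (fun x hx => ?_) measurableSet_Ioi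
  have : 0 < x + δ := add_pos hx hδ
  rw [Real.rpow_neg this.le, div_eq_mul_inv]
  norm_num

/-- A continuous function dominated by `C / (x + δ)²` is integrable on `(0, ∞)`. -/
lemma integrableOn_of_le_inv_sq {δ : ℝ} (hδ : 0 < δ) {C : ℝ} {g : ℝ → ℂ}
    (hg : ContinuousOn g (Ioi 0)) (hC : ∀ x, 0 < x → ‖g x‖ ≤ C / (x + δ) ^ 2) :
    IntegrableOn g (Ioi 0) :=
  (integrableOn_inv_sq hδ C).mono' (hg.aestronglyMeasurable measurableSet_Ioi)
    ((ae_restrict_iff' measurableSet_Ioi).2 (Eventually.of_forall fun x hx => hC x hx))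

/-- Green's identity for a profile against a test function `K`: the pairing of the profile with the
operator applied to `K` is controlled by the incoming part of the profile. -/
lemma ModeProfile.green {δ M ω c b : ℝ} {f f' : ℝ → ℂ} {B W : ℝ} (hδ : 0 < δ)
    (h : ModeProfile δ M ω c b f f' B W) {K K' K'' LK : ℝ → ℂ} {C C' : ℝ}
    (hK : ∀ x, 0 < x → HasDerivAt K (K' x) x)
    (hK' : ∀ x, 0 < x → HasDerivAt (fun y : ℝ => (y : ℂ) * ((y + δ : ℝ) : ℂ) * K' y) (K'' x) x)
    (hLK : ∀ x, 0 < x → LK x =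
      K'' x + 2 * Complex.I * (ω * x * (x + δ) - 2 * M * ω * x - c * δ / 2) * K' x
      + (2 * Complex.I * ω * x + 8 * M * ω ^ 2 * x + b + Complex.I * ω * (δ - 2 * M)) * K x)
    (hKb : ∀ x, 0 < x → ‖K x‖ ≤ 1 / (x + δ))
    (hKb' : ∀ x, 0 < x → ‖K' x‖ ≤ C / (x + δ) ^ 2)
    (hLKc : ContinuousOn LK (Ioi 0)) (hLKb : ∀ x, 0 < x → ‖LK x‖ ≤ C' / (x + δ)) :
    ‖∫ x in Ioi 0, profileWeight δ M ω c x * f x * LK x‖ ≤ W := by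
  have hB := h.bound_nonneg hδ
  have hC : 0 ≤ C := by
    have h1 := (norm_nonneg _).trans (hKb' 1 one_pos)
    by_contra! hB
    exact absurd h1 (not_le.2 (div_neg_of_neg_of_pos hB (by positivity)))
  set w := profileWeight δ M ω c with hw
  -- The weighted Wronskian of K and f. Self-adjointness leaves only -w f LK in its derivative, so
  -- the integral is a difference of boundary values.
  let β : ℝ → ℂ := fun x => w x * (K x * ((x : ℂ) * ((x + δ : ℝ) : ℂ) * f' x)
    - f x * ((x : ℂ) * ((x + δ : ℝ) : ℂ) * K' x))
  have hβ : ∀ x ∈ Ioi (0 : ℝ), HasDerivAt β (-(w x * f x * LK x)) x := by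
    intro x hx
    have hx' : 0 < x := hx
    have h1 : (x : ℂ) ≠ 0 := by exact_mod_cast hx'.ne'
    have h2 : (x : ℂ) + δ ≠ 0 := by exact_mod_cast (by positivity : x + δ ≠ 0)
    have hd := (hasDerivAt_profileWeight hδ M ω c hx').mul
      (((hK x hx).mul (h.ode x hx)).sub ((h.deriv x hx).mul (hK' x hx)))
    refine hd.congr_deriv ?_
    rw [hLK x hx, ← hw]
    simp only [Pi.mul_apply, Pi.sub_apply]
    push_cast
    field_simp
    ring
  have hnorm : ∀ x, 0 < x → ‖β x‖ ≤ x * ‖f' x‖ + B * C / (x + δ) := by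
    intro x hx
    have hp : 0 < x + δ := by positivity
    have e1 : ‖((x + δ : ℝ) : ℂ)‖ = x + δ := by rw [Complex.norm_real, Real.norm_of_nonneg hp.le]
    have e2 : ‖(x : ℂ)‖ = x := by rw [Complex.norm_real, Real.norm_of_nonneg hx.le]
    calc ‖β x‖ = ‖K x * ((x : ℂ) * ((x + δ : ℝ) : ℂ) * f' x)
          - f x * ((x : ℂ) * ((x + δ : ℝ) : ℂ) * K' x)‖ := by
            simp only [β]; rw [norm_mul, hw, norm_profileWeight, one_mul]
      _ ≤ ‖K x‖ * (x * (x + δ) * ‖f' x‖) + ‖f x‖ * (x * (x + δ) * ‖K' x‖) := by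
            refine (norm_sub_le _ _).trans_eq ?_
            simp only [norm_mul, e1, e2]
      _ ≤ 1 / (x + δ) * (x * (x + δ) * ‖f' x‖)
          + B / (x + δ) * ((x + δ) * (x + δ) * (C / (x + δ) ^ 2)) := by
            gcongr
            · exact hKb x hx
            · exact h.bound x hx
            · linarith
            · exact hKb' x hx
      _ = _ := by field_simp
  have hint : IntegrableOn (fun x => -(w x * f x * LK x)) (Ioi 0) := by
    refine integrableOn_of_le_inv_sq hδ (C := B * C')
      (((continuousOn_profileWeight hδ M ω c).mul h.continuousOn).mul hLKc).neg (fun x hx => ?_)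
    have hp : 0 < x + δ := by positivity
    rw [norm_neg, norm_mul, norm_mul, hw, norm_profileWeight, one_mul]
    calc ‖f x‖ * ‖LK x‖ ≤ B / (x + δ) * (C' / (x + δ)) :=
          mul_le_mul (h.bound x hx) (hLKb x hx) (norm_nonneg _) (by positivity)
      _ = _ := by field_simp
  have hlim := tendsto_limUnder_of_hasDerivAt_of_integrableOn_Ioi hβ hint
  -- No boundary term at the horizon: x f' tends to 0 and the other term carries a factor x.
  have hzero : ContinuousWithinAt β (Ici 0) 0 := by
    rw [← continuousWithinAt_Ioi_iff_Ici]
    have h0 : β 0 = 0 := by simp [β]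
    unfold ContinuousWithinAt
    rw [h0]
    have hz : Tendsto (fun x : ℝ => ‖(x : ℂ) * f' x‖ + x * (B * C / δ ^ 2)) (𝓝[>] 0) (𝓝 0) := by
      have h1 := h.at_zero.norm
      have h2 : Tendsto (fun x : ℝ => x * (B * C / δ ^ 2)) (𝓝[>] 0) (𝓝 (0 * (B * C / δ ^ 2))) :=
        (tendsto_nhdsWithin_of_tendsto_nhds tendsto_id).mul_const _
      simpa using h1.add h2
    refine squeeze_zero_norm' ?_ hz
    filter_upwards [self_mem_nhdsWithin] with x hx
    have hx' : 0 < x := hx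
    have hp : 0 < x + δ := by positivity
    have e1 : ‖((x + δ : ℝ) : ℂ)‖ = x + δ := by rw [Complex.norm_real, Real.norm_of_nonneg hp.le]
    have e2 : ‖(x : ℂ)‖ = x := by rw [Complex.norm_real, Real.norm_of_nonneg hx'.le]
    calc ‖β x‖ = ‖K x * ((x : ℂ) * ((x + δ : ℝ) : ℂ) * f' x)
          - f x * ((x : ℂ) * ((x + δ : ℝ) : ℂ) * K' x)‖ := by
            simp only [β]; rw [norm_mul, hw, norm_profileWeight, one_mul]
      _ ≤ ‖K x‖ * (x * (x + δ) * ‖f' x‖) + ‖f x‖ * (x * (x + δ) * ‖K' x‖) := by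
            refine (norm_sub_le _ _).trans_eq ?_
            simp only [norm_mul, e1, e2]
      _ ≤ 1 / (x + δ) * (x * (x + δ) * ‖f' x‖)
          + B / (x + δ) * (x * (x + δ) * (C / (x + δ) ^ 2)) := by
            gcongr
            · exact hKb x hx
            · exact h.bound x hx
            · exact hKb' x hx
      _ = x * ‖f' x‖ + x * (B * C / (x + δ) ^ 2) := by field_simp
      _ ≤ x * ‖f' x‖ + x * (B * C / δ ^ 2) := by
            gcongr; linarith
      _ = _ := by rw [norm_mul, e2]
  have hI := integral_Ioi_of_hasDerivAt_of_tendsto hzero hβ hint hlim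
  have h0 : β 0 = 0 := by simp [β]
  rw [h0, sub_zero, integral_neg] at hI
  rw [← norm_neg, hI]
  -- At infinity the term with K' decays like 1/x, and |K| ≤ 1/(x+δ) reduces the other one to x|f'|.
  refine le_of_forall_pos_le_add fun e he => le_of_tendsto hlim.norm ?_
  have hdec : Tendsto (fun x : ℝ => B * C / (x + δ)) atTop (𝓝 0) :=
    tendsto_const_nhds.div_atTop (tendsto_atTop_add_const_right _ _ tendsto_id)
  filter_upwards [h.at_top (e / 2) (by positivity), eventually_gt_atTop 0,
    hdec.eventually (gt_mem_nhds (show (0 : ℝ) < e / 2 by positivity))] with x h1 h2 h3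
  linarith [hnorm x h2]

/-! ### Moments of a profile and their recurrence -/

lemma norm_ofReal_of_pos {x : ℝ} (hx : 0 < x) : ‖(x : ℂ)‖ = x := by
  rw [Complex.norm_real, Real.norm_of_nonneg hx.le]

lemma hasDerivAt_ofReal_pow (n : ℕ) {x : ℝ} (hx : x ≠ 0) :
    HasDerivAt (fun y : ℝ => (y : ℂ) ^ n) (n * (x : ℂ) ^ n / x) x := by
  refine ((hasDerivAt_ofReal x).pow n).congr_deriv ?_
  have h1 : (x : ℂ) ≠ 0 := by exact_mod_cast hx
  cases n with
  | zero => simp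
  | succ n => rw [Nat.add_sub_cancel, pow_succ]; field_simp

/-- The test functions `x ^ n (x + δ) ^ (-s - n)` with `s = 1 - 4 i M ω`. -/
def testFn (δ M ω : ℝ) (n : ℕ) (x : ℝ) : ℂ :=
  logPhase (4 * M * ω) (x + δ) * ((x : ℂ) ^ n / ((x + δ : ℝ) : ℂ) ^ (n + 1))

lemma norm_testFn {δ : ℝ} (hδ : 0 < δ) (M ω : ℝ) (n : ℕ) {x : ℝ} (hx : 0 < x) :
    ‖testFn δ M ω n x‖ = (x / (x + δ)) ^ n / (x + δ) := by
  have hp : 0 < x + δ := by positivity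
  rw [testFn, norm_mul, norm_logPhase, one_mul, norm_div, norm_pow, norm_pow,
    norm_ofReal_of_pos hx, norm_ofReal_of_pos hp, div_pow, pow_succ]
  field_simp

lemma div_add_le_one {δ : ℝ} (hδ : 0 < δ) {x : ℝ} (hx : 0 < x) : x / (x + δ) ≤ 1 := by
  rw [div_le_one (by positivity)]; linarith

lemma norm_testFn_le {δ : ℝ} (hδ : 0 < δ) (M ω : ℝ) (n : ℕ) {x : ℝ} (hx : 0 < x) :
    ‖testFn δ M ω n x‖ ≤ 1 / (x + δ) := by
  rw [norm_testFn hδ M ω n hx]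
  have hp : 0 < x + δ := by positivity
  gcongr
  exact pow_le_one₀ (by positivity) (div_add_le_one hδ hx)

lemma hasDerivAt_testFn {δ : ℝ} (hδ : 0 < δ) (M ω : ℝ) (n : ℕ) {x : ℝ} (hx : 0 < x) :
    HasDerivAt (testFn δ M ω n) (testFn δ M ω n x *
      (n / (x : ℂ) - (1 - 4 * Complex.I * M * ω + n) / ((x + δ : ℝ) : ℂ))) x := by
  have hp : x + δ ≠ 0 := by positivity
  have h1 : (x : ℂ) ≠ 0 := by exact_mod_cast hx.ne'
  have h2 : (x : ℂ) + δ ≠ 0 := by exact_mod_cast hp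
  have hd := (hasDerivAt_logPhase_add (4 * M * ω) δ hp).mul
    ((hasDerivAt_ofReal_pow n hx.ne').div ((hasDerivAt_ofReal_add x δ).pow (n + 1))
      (by push_cast; exact pow_ne_zero _ h2))
  refine hd.congr_deriv ?_
  simp only [testFn, Nat.add_sub_cancel, Pi.div_apply, Pi.pow_apply]
  push_cast
  field_simp
  ring

lemma continuousOn_testFn {δ : ℝ} (hδ : 0 < δ) (M ω : ℝ) (n : ℕ) :
    ContinuousOn (testFn δ M ω n) (Ioi 0) := fun _ hx =>
  (hasDerivAt_testFn hδ M ω n hx).continuousAt.continuousWithinAt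

lemma succ_mul_testFn {δ : ℝ} (hδ : 0 < δ) (M ω : ℝ) (n : ℕ) {x : ℝ} (hx : 0 < x) :
    testFn δ M ω (n + 1) x = testFn δ M ω n x * (x / ((x + δ : ℝ) : ℂ)) := by
  have h2 : (x : ℂ) + δ ≠ 0 := by exact_mod_cast (by positivity : x + δ ≠ 0)
  simp only [testFn]
  push_cast
  field_simp
  ring

/-- The factor n on both sides makes the truncated subtraction harmless: at n = 0 both vanish. -/
lemma pred_mul_testFn {δ : ℝ} (hδ : 0 < δ) (M ω : ℝ) (n : ℕ) {x : ℝ} (hx : 0 < x) :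
    (n : ℂ) * testFn δ M ω (n - 1) x = n * (testFn δ M ω n x * (((x + δ : ℝ) : ℂ) / x)) := by
  have h1 : (x : ℂ) ≠ 0 := by exact_mod_cast hx.ne'
  have h2 : (x : ℂ) + δ ≠ 0 := by exact_mod_cast (by positivity : x + δ ≠ 0)
  cases n with
  | zero => simp
  | succ n =>
    simp only [Nat.add_sub_cancel, succ_mul_testFn hδ M ω n hx]
    push_cast
    field_simp

/-- The middle coefficient of the three-term recurrence satisfied by the moments. -/
def momentCoeff (δ M : ℝ) (n : ℕ) (ω c b : ℝ) : ℂ :=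
  b + Complex.I * ω * (δ - 2 * M) - 2 * n * (1 - 4 * Complex.I * M * ω + n)
    - (1 - Complex.I * c) * (1 - 4 * Complex.I * M * ω + n)
    + (1 - 4 * Complex.I * M * ω + Complex.I * c) * n + 2 * Complex.I * ω * n * δ

/-- Moments of a profile. -/
def moment (δ M ω c : ℝ) (f : ℝ → ℂ) (n : ℕ) : ℂ :=
  ∫ x in Ioi 0, profileWeight δ M ω c x * f x * testFn δ M ω n x

lemma ModeProfile.integrableOn_testFn {δ M ω c b : ℝ} {f f' : ℝ → ℂ} {B W : ℝ} (hδ : 0 < δ)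
    (h : ModeProfile δ M ω c b f f' B W) (n : ℕ) :
    IntegrableOn (fun x => profileWeight δ M ω c x * f x * testFn δ M ω n x) (Ioi 0) := by
  refine integrableOn_of_le_inv_sq hδ (C := B)
    (((continuousOn_profileWeight hδ M ω c).mul h.continuousOn).mul
      (continuousOn_testFn hδ M ω n)) (fun x hx => ?_)
  have hp : 0 < x + δ := by positivity
  have hB := h.bound_nonneg hδ
  rw [norm_mul, norm_mul, norm_profileWeight, one_mul]
  calc ‖f x‖ * ‖testFn δ M ω n x‖ ≤ B / (x + δ) * (1 / (x + δ)) :=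
        mul_le_mul (h.bound x hx) (norm_testFn_le hδ M ω n hx) (norm_nonneg _) (by positivity)
    _ = _ := by field_simp

/-- The approximate three-term recurrence for the moments. -/
lemma ModeProfile.moment_recurrence {δ M ω c b : ℝ} {f f' : ℝ → ℂ} {B W : ℝ} (hδ : 0 < δ)
    (h : ModeProfile δ M ω c b f f' B W) (n : ℕ) :
    ‖((n : ℂ) - Complex.I * c) * n * moment δ M ω c f (n - 1)
      + momentCoeff δ M n ω c b * moment δ M ω c f n
      + (1 - 4 * Complex.I * M * ω + n) * (1 - Complex.I * c + n) * moment δ M ω c f (n + 1)‖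
      ≤ W := by
  set s : ℂ := 1 - 4 * Complex.I * M * ω with hs
  let K := testFn δ M ω n
  let K' : ℝ → ℂ := fun x => K x * (n / (x : ℂ) - (s + n) / ((x + δ : ℝ) : ℂ))
  let LK : ℝ → ℂ := fun x => ((n : ℂ) - Complex.I * c) * (n * testFn δ M ω (n - 1) x)
      + momentCoeff δ M n ω c b * K x
      + (s + n) * (1 - Complex.I * c + n) * testFn δ M ω (n + 1) x
  -- `K''` is obtained by solving for it, so the formula for `LK` is immediate and the computation
  -- lies in showing that `K''` is the derivative of x(x+δ)K'.
  let K'' : ℝ → ℂ := fun x => LK x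
    - 2 * Complex.I * (ω * x * (x + δ) - 2 * M * ω * x - c * δ / 2) * K' x
      - (2 * Complex.I * ω * x + 8 * M * ω ^ 2 * x + b + Complex.I * ω * (δ - 2 * M)) * K x
  have hg := h.green hδ (K := K) (K' := K') (K'' := K'') (LK := LK) (C := n + ‖s‖)
    (C' := ‖(n : ℂ) - Complex.I * c‖ * n + ‖momentCoeff δ M n ω c b‖
      + ‖(s + n) * (1 - Complex.I * c + n)‖)
    (fun x hx => hasDerivAt_testFn hδ M ω n hx) ?_ (fun x hx => by simp only [K'']; ring)
    (fun x hx => norm_testFn_le hδ M ω n hx) ?_ ?_ ?_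
  · refine le_of_eq_of_le ?_ hg
    congr 1
    have i1 := (h.integrableOn_testFn hδ (n - 1)).const_mul (((n : ℂ) - Complex.I * c) * n)
    have i2 := (h.integrableOn_testFn hδ n).const_mul (momentCoeff δ M n ω c b)
    have i3 := (h.integrableOn_testFn hδ (n + 1)).const_mul ((s + n) * (1 - Complex.I * c + n))
    simp only [moment]
    rw [← integral_const_mul, ← integral_const_mul, ← integral_const_mul, ← integral_add i1 i2]
    refine (integral_add (i1.add i2) i3).symm.trans
      (integral_congr_ae (Eventually.of_forall fun x => ?_))
    simp only [LK, K, Pi.add_apply]; ring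
  · intro x hx
    have hp : x + δ ≠ 0 := by positivity
    have h1 : (x : ℂ) ≠ 0 := by exact_mod_cast hx.ne'
    have h2 : (x : ℂ) + δ ≠ 0 := by exact_mod_cast hp
    have hA := ((hasDerivAt_testFn hδ M ω n hx).mul
      (((hasDerivAt_ofReal_add x δ).const_mul (n : ℂ)).sub
        ((hasDerivAt_ofReal x).const_mul (s + n))))
    have hcongr : (fun y : ℝ => (y : ℂ) * ((y + δ : ℝ) : ℂ) * K' y) =ᶠ[𝓝 x]
        (fun y => testFn δ M ω n y * ((n : ℂ) * ((y + δ : ℝ) : ℂ) - (s + n) * y)) := by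
      filter_upwards [lt_mem_nhds hx] with y hy
      have h1 : (y : ℂ) ≠ 0 := by exact_mod_cast hy.ne'
      have h2 : (y : ℂ) + δ ≠ 0 := by exact_mod_cast (by positivity : y + δ ≠ 0)
      simp only [K', K]
      push_cast
      field_simp
    refine (hA.congr_of_eventuallyEq hcongr).congr_deriv ?_
    simp only [K'', LK, K', K]
    rw [pred_mul_testFn hδ M ω n hx, succ_mul_testFn hδ M ω n hx]
    simp only [momentCoeff, Pi.sub_apply]
    push_cast
    rw [← hs]
    have hT : 2 * Complex.I * (ω * x * (x + δ) - 2 * M * ω * x - c * δ / 2)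
        = 2 * Complex.I * ω * x * (x + δ) + (s - 1) * x - Complex.I * c * δ := by rw [hs]; ring
    -- This identity is what fixes the exponent s: the terms of order x·K have total coefficient
    -- 2iω(1 + (s-1) - s) = 0, so `LK` is again a combination of test functions.
    have hC : (8 : ℂ) * M * ω ^ 2 = 2 * ω * Complex.I * (s - 1) := by
      rw [hs]; linear_combination (8 * (M : ℂ) * ω ^ 2) * Complex.I_sq
    rw [hT, hC]
    clear_value s
    field_simp
    ring
  · intro x hx
    have hp : 0 < x + δ := by positivity
    have h1 : (x : ℂ) ≠ 0 := by exact_mod_cast hx.ne'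
    have h2 : (x : ℂ) + δ ≠ 0 := by exact_mod_cast hp.ne'
    -- Rewritten with the test function of index n - 1, the derivative has no 1/x left and its bound
    -- is uniform down to x = 0.
    have e : K' x = δ / ((x + δ : ℝ) : ℂ) / ((x + δ : ℝ) : ℂ) * (n * testFn δ M ω (n - 1) x)
        - s / ((x + δ : ℝ) : ℂ) * K x := by
      rw [pred_mul_testFn hδ M ω n hx]
      simp only [K', K]
      push_cast
      field_simp
      ring
    rw [e]
    refine (norm_sub_le _ _).trans ?_
    simp only [norm_mul, norm_div, norm_ofReal_of_pos hp, norm_ofReal_of_pos hδ, Complex.norm_natCast]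
    calc δ / (x + δ) / (x + δ) * (n * ‖testFn δ M ω (n - 1) x‖) + ‖s‖ / (x + δ) * ‖K x‖
        ≤ 1 / (x + δ) * (n * (1 / (x + δ))) + ‖s‖ / (x + δ) * (1 / (x + δ)) := by
          gcongr
          · rw [div_le_one hp]; linarith
          · exact norm_testFn_le hδ M ω _ hx
          · exact norm_testFn_le hδ M ω _ hx
      _ = _ := by field_simp
  · exact (((((continuousOn_testFn hδ M ω (n - 1)).const_mul _).const_mul _).add
      ((continuousOn_testFn hδ M ω n).const_mul _)).add
      ((continuousOn_testFn hδ M ω (n + 1)).const_mul _))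
  · intro x hx
    have hp : 0 < x + δ := by positivity
    refine (norm_add₃_le).trans ?_
    rw [norm_mul, norm_mul, norm_mul (momentCoeff δ M n ω c b),
      norm_mul _ (testFn δ M ω (n + 1) x), Complex.norm_natCast]
    calc _ ≤ ‖(n : ℂ) - Complex.I * c‖ * (n * (1 / (x + δ)))
          + ‖momentCoeff δ M n ω c b‖ * (1 / (x + δ))
          + ‖(s + n) * (1 - Complex.I * c + n)‖ * (1 / (x + δ)) := by
          gcongr
          · exact norm_testFn_le hδ M ω _ hx
          · exact norm_testFn_le hδ M ω _ hx
          · exact norm_testFn_le hδ M ω _ hx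
      _ = _ := by field_simp

/-- Compactness of the parameter box is what makes the recurrence constants independent of the
frequencies. -/
lemma exists_norm_le_on_box {g : ℝ → ℝ → ℝ → ℂ}
    (hg : Continuous fun p : ℝ × ℝ × ℝ => g p.1 p.2.1 p.2.2) (K : ℝ) :
    ∃ D, 0 ≤ D ∧ ∀ ω c b, |ω| ≤ K → |c| ≤ K → |b| ≤ K → ‖g ω c b‖ ≤ D := by
  obtain ⟨D, hD⟩ := ((isCompact_Icc (a := -K) (b := K)).prod
    ((isCompact_Icc (a := -K) (b := K)).prod (isCompact_Icc (a := -K) (b := K)))).exists_bound_of_continuousOn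
    hg.continuousOn
  refine ⟨max D 0, le_max_right _ _, fun ω c b h1 h2 h3 => ?_⟩
  exact (hD (ω, c, b) ⟨abs_le.1 h1, abs_le.1 h2, abs_le.1 h3⟩).trans (le_max_left _ _)

/-- All moments are controlled by the zeroth one and the size of the incoming part. -/
lemma exists_moment_bound {δ : ℝ} (hδ : 0 < δ) (M K : ℝ) (n : ℕ) :
    ∃ D, 0 ≤ D ∧ ∀ ω c b B W (f f' : ℝ → ℂ), |ω| ≤ K → |c| ≤ K → |b| ≤ K →
      ModeProfile δ M ω c b f f' B W →
      ‖moment δ M ω c f n‖ ≤ D * (‖moment δ M ω c f 0‖ + W) ∧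
      ‖moment δ M ω c f (n + 1)‖ ≤ D * (‖moment δ M ω c f 0‖ + W) := by
  have step : ∀ n : ℕ, ∃ D, 0 ≤ D ∧ ∀ ω c b B W (f f' : ℝ → ℂ), |ω| ≤ K → |c| ≤ K → |b| ≤ K →
      ModeProfile δ M ω c b f f' B W →
      ‖moment δ M ω c f (n + 1)‖ ≤
        W + D * ‖moment δ M ω c f n‖ + n * (D * ‖moment δ M ω c f (n - 1)‖) := by
    intro n
    obtain ⟨D₁, hD₁, h₁⟩ := exists_norm_le_on_box (g := momentCoeff δ M n)
      (by unfold momentCoeff; fun_prop) K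
    obtain ⟨D₂, hD₂, h₂⟩ := exists_norm_le_on_box (g := fun _ c _ => (n : ℂ) - Complex.I * c)
      (by fun_prop) K
    refine ⟨max D₁ D₂, hD₁.trans (le_max_left _ _), fun ω c b B W f f' hω hc hb h => ?_⟩
    have hr := h.moment_recurrence hδ n
    set m₀ := moment δ M ω c f (n - 1)
    set m₁ := moment δ M ω c f n
    set m₂ := moment δ M ω c f (n + 1)
    -- Both factors of the leading coefficient have real part n + 1, so the recurrence can be solved
    -- for the highest moment without loss.
    have hs : 1 ≤ ‖(1 : ℂ) - 4 * Complex.I * M * ω + n‖ := by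
      refine le_trans ?_ (Complex.re_le_norm _)
      simp
    have hγ : 1 ≤ ‖(1 : ℂ) - Complex.I * c + n‖ := by
      refine le_trans ?_ (Complex.re_le_norm _)
      simp
    have e1 : ‖m₂‖ ≤ ‖(1 - 4 * Complex.I * M * ω + n) * (1 - Complex.I * c + n) * m₂‖ := by
      rw [norm_mul, norm_mul]
      nlinarith [norm_nonneg m₂, mul_le_mul hs hγ zero_le_one (by positivity)]
    have e2 : ‖((n : ℂ) - Complex.I * c) * n * m₀‖ ≤ n * (max D₁ D₂ * ‖m₀‖) := by
      rw [norm_mul, norm_mul, Complex.norm_natCast, mul_comm _ (n : ℝ), mul_assoc]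
      gcongr
      exact (h₂ ω c b hω hc hb).trans (le_max_right _ _)
    have e3 : ‖momentCoeff δ M n ω c b * m₁‖ ≤ max D₁ D₂ * ‖m₁‖ := by
      rw [norm_mul]
      gcongr
      exact (h₁ ω c b hω hc hb).trans (le_max_left _ _)
    have e4 : (1 - 4 * Complex.I * M * ω + n) * (1 - Complex.I * c + n) * m₂
        = (((n : ℂ) - Complex.I * c) * n * m₀ + momentCoeff δ M n ω c b * m₁
          + (1 - 4 * Complex.I * M * ω + n) * (1 - Complex.I * c + n) * m₂)
          - momentCoeff δ M n ω c b * m₁ - ((n : ℂ) - Complex.I * c) * n * m₀ := by ring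
    rw [e4] at e1
    have := norm_sub_le ((((n : ℂ) - Complex.I * c) * n * m₀ + momentCoeff δ M n ω c b * m₁
          + (1 - 4 * Complex.I * M * ω + n) * (1 - Complex.I * c + n) * m₂)
          - momentCoeff δ M n ω c b * m₁) (((n : ℂ) - Complex.I * c) * n * m₀)
    have := norm_sub_le (((n : ℂ) - Complex.I * c) * n * m₀ + momentCoeff δ M n ω c b * m₁
          + (1 - 4 * Complex.I * M * ω + n) * (1 - Complex.I * c + n) * m₂)
          (momentCoeff δ M n ω c b * m₁)
    linarith
  have hW : ∀ {ω c b B W} {f f' : ℝ → ℂ}, ModeProfile δ M ω c b f f' B W → 0 ≤ W := by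
    intro ω c b B W f f' h
    exact (norm_nonneg _).trans (h.moment_recurrence hδ 0)
  induction n with
  | zero =>
    obtain ⟨D, hD, h⟩ := step 0
    refine ⟨1 + D, by positivity, fun ω c b B W f f' hω hc hb hm => ⟨?_, ?_⟩⟩
    · nlinarith [hW hm, norm_nonneg (moment δ M ω c f 0),
        mul_nonneg hD (add_nonneg (norm_nonneg (moment δ M ω c f 0)) (hW hm))]
    · have := h ω c b B W f f' hω hc hb hm
      -- The coefficient of the preceding moment vanishes at n = 0, so the zeroth moment alone
      -- starts the recurrence.
      simp only [Nat.cast_zero, zero_mul, add_zero] at this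
      nlinarith [hW hm, norm_nonneg (moment δ M ω c f 0), mul_nonneg hD (hW hm)]
  | succ n ih =>
    obtain ⟨D, hD, h⟩ := step (n + 1)
    obtain ⟨D', hD', h'⟩ := ih
    refine ⟨D' + (1 + D * D' + (n + 1) * (D * D')), by positivity,
      fun ω c b B W f f' hω hc hb hm => ⟨?_, ?_⟩⟩
    · refine (h' ω c b B W f f' hω hc hb hm).2.trans ?_
      have h0 : 0 ≤ ‖moment δ M ω c f 0‖ + W := add_nonneg (norm_nonneg _) (hW hm)
      gcongr
      have : 0 ≤ 1 + D * D' + (n + 1) * (D * D') := by positivity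
      linarith
    · have h1 := h ω c b B W f f' hω hc hb hm
      obtain ⟨h2, h3⟩ := h' ω c b B W f f' hω hc hb hm
      have h0 : 0 ≤ ‖moment δ M ω c f 0‖ + W := add_nonneg (norm_nonneg _) (hW hm)
      have hWb : W ≤ ‖moment δ M ω c f 0‖ + W := le_add_of_nonneg_left (norm_nonneg _)
      set X := ‖moment δ M ω c f 0‖ + W
      rw [Nat.add_sub_cancel] at h1
      push_cast at h1
      calc _ ≤ _ := h1
        _ ≤ X + D * (D' * X) + (n + 1) * (D * (D' * X)) := by gcongr
        _ = (1 + D * D' + (n + 1) * (D * D')) * X := by ring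
        _ ≤ _ := mul_le_mul_of_nonneg_right (by linarith) h0

/-! ### The integral transform and its equation -/

/-- The kernel `y ^ (-γ - j)` with `γ = 1 - i c`. -/
def powKernel (c : ℝ) (j : ℕ) (y : ℝ) : ℂ := logPhase c y / (y : ℂ) ^ (j + 1)

lemma norm_powKernel (c : ℝ) (j : ℕ) {y : ℝ} (hy : 0 < y) :
    ‖powKernel c j y‖ = 1 / y ^ (j + 1) := by
  rw [powKernel, norm_div, norm_logPhase, norm_pow, norm_ofReal_of_pos hy]

lemma hasDerivAt_powKernel (c : ℝ) (j : ℕ) {y : ℝ} (hy : 0 < y) :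
    HasDerivAt (powKernel c j) (-(1 - Complex.I * c + j) * powKernel c (j + 1) y) y := by
  have h1 : (y : ℂ) ≠ 0 := by exact_mod_cast hy.ne'
  have hd := (hasDerivAt_logPhase c hy.ne').div ((hasDerivAt_ofReal y).pow (j + 1))
    (pow_ne_zero _ h1)
  refine hd.congr_deriv ?_
  simp only [powKernel, Nat.add_sub_cancel, Pi.pow_apply]
  push_cast
  field_simp
  ring

lemma powKernel_succ (c : ℝ) (j : ℕ) {y : ℝ} (hy : 0 < y) :
    powKernel c (j + 1) y = powKernel c j y / y := by
  have h1 : (y : ℂ) ≠ 0 := by exact_mod_cast hy.ne'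
  simp only [powKernel]
  field_simp
  ring

lemma continuousOn_powKernel (c : ℝ) (j : ℕ) {δ z : ℝ} (hz : 0 < δ + z) :
    ContinuousOn (fun x => powKernel c j (x + (δ + z))) (Ioi 0) := fun x hx =>
  ((HasDerivAt.comp_add_const x (δ + z) (hasDerivAt_powKernel c j
    (add_pos hx hz))).continuousAt).continuousWithinAt

/-- The integral transform of a profile, with kernel `(x + δ + z) ^ (-γ - j)`. -/
def transform (δ ω c : ℝ) (f : ℝ → ℂ) (j : ℕ) (z : ℝ) : ℂ :=
  ∫ x in Ioi 0, linPhase (2 * ω) x * logPhase (-c) x * f x * powKernel c j (x + (δ + z))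

section

variable {δ M ω c b : ℝ} {f f' : ℝ → ℂ} {B W : ℝ}

lemma ModeProfile.continuousOn_density (h : ModeProfile δ M ω c b f f' B W) :
    ContinuousOn (fun x => linPhase (2 * ω) x * logPhase (-c) x * f x) (Ioi 0) := by
  refine ((continuous_linPhase _).continuousOn.mul ?_).mul h.continuousOn
  intro x hx
  exact (hasDerivAt_logPhase (-c) (ne_of_gt hx)).continuousAt.continuousWithinAt

lemma norm_density (x : ℝ) :
    ‖linPhase (2 * ω) x * logPhase (-c) x * f x‖ = ‖f x‖ := by
  rw [norm_mul, norm_mul, norm_linPhase, norm_logPhase, one_mul, one_mul]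

/-- With r a common lower bound of δ and δ + z the estimate is uniform in z ≥ r - δ, which serves
both integrability and differentiation under the integral. -/
lemma ModeProfile.norm_integrand_le (hδ : 0 < δ) (h : ModeProfile δ M ω c b f f' B W) (j : ℕ)
    {r z x : ℝ} (hr : 0 < r) (hrδ : r ≤ δ) (hz : r ≤ δ + z) (hx : 0 < x) :
    ‖linPhase (2 * ω) x * logPhase (-c) x * f x * powKernel c j (x + (δ + z))‖
      ≤ B / r ^ j / (x + r) ^ 2 := by
  have hB := h.bound_nonneg hδ
  rw [norm_mul, norm_density, norm_powKernel c j (by linarith)]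
  calc ‖f x‖ * (1 / (x + (δ + z)) ^ (j + 1))
      ≤ B / (x + r) * (1 / (r ^ j * (x + r))) := by
        refine mul_le_mul ((h.bound x hx).trans (by gcongr)) ?_ ?_ (by positivity)
        · refine one_div_le_one_div_of_le (by positivity) ?_
          have hle : x + r ≤ x + (δ + z) := by linarith
          have hle' : r ≤ x + (δ + z) := by linarith
          rw [pow_succ]
          exact mul_le_mul (pow_le_pow_left₀ hr.le hle' j) hle (by positivity)
            (pow_nonneg (hr.le.trans hle') j)
        · have : 0 < x + (δ + z) := by linarith
          positivity
    _ = _ := by field_simp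

lemma ModeProfile.integrableOn_transform (hδ : 0 < δ) (h : ModeProfile δ M ω c b f f' B W) (j : ℕ)
    {z : ℝ} (hz : 0 < δ + z) :
    IntegrableOn (fun x => linPhase (2 * ω) x * logPhase (-c) x * f x
      * powKernel c j (x + (δ + z))) (Ioi 0) := by
  have hr : 0 < min δ (δ + z) := lt_min hδ hz
  exact integrableOn_of_le_inv_sq hr
    (h.continuousOn_density.mul (continuousOn_powKernel c j hz))
    (fun x hx => h.norm_integrand_le hδ j hr (min_le_left _ _) (min_le_right _ _) hx)

/-- Differentiating the kernel raises j by one. The domination holds for parameters above -δ/2, so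
the derivative is two-sided even at z = 0. -/
lemma ModeProfile.hasDerivAt_transform (hδ : 0 < δ) (h : ModeProfile δ M ω c b f f' B W) (j : ℕ)
    {z : ℝ} (hz : 0 ≤ z) :
    HasDerivAt (transform δ ω c f j)
      (-(1 - Complex.I * c + j) * transform δ ω c f (j + 1) z) z := by
  have hr : 0 < δ / 2 := by positivity
  have hs : Ioi (-(δ / 2)) ∈ 𝓝 z := Ioi_mem_nhds (by linarith)
  have key := hasDerivAt_integral_of_dominated_loc_of_deriv_le
    (μ := volume.restrict (Ioi (0 : ℝ)))
    (F := fun z x => linPhase (2 * ω) x * logPhase (-c) x * f x * powKernel c j (x + (δ + z)))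
    (F' := fun z x => linPhase (2 * ω) x * logPhase (-c) x * f x *
      (-(1 - Complex.I * c + j) * powKernel c (j + 1) (x + (δ + z))))
    (bound := fun x => ‖-(1 - Complex.I * c + j)‖ * (B / (δ / 2) ^ (j + 1) / (x + δ / 2) ^ 2))
    hs ?_ (h.integrableOn_transform hδ j (by linarith)) ?_ ?_ ?_ ?_
  · refine key.2.congr_deriv ?_
    rw [transform, ← integral_const_mul]
    refine integral_congr_ae (Eventually.of_forall fun x => ?_)
    beta_reduce; ring
  · filter_upwards [hs] with y hy
    have hy' : 0 < δ + y := by rw [mem_Ioi] at hy; linarith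
    exact (h.integrableOn_transform hδ j hy').aestronglyMeasurable
  · exact ((h.continuousOn_density.mul ((continuousOn_powKernel c (j + 1)
      (by linarith : 0 < δ + z)).const_mul _))).aestronglyMeasurable measurableSet_Ioi
  · refine (ae_restrict_iff' measurableSet_Ioi).2 (Eventually.of_forall fun x hx y hy => ?_)
    rw [mem_Ioi] at hy
    have := h.norm_integrand_le hδ (j + 1) (r := δ / 2) (z := y) hr (by linarith) (by linarith) hx
    rw [mul_left_comm, norm_mul]
    gcongr
  · exact (integrableOn_inv_sq hr _).const_mul _
  · refine (ae_restrict_iff' measurableSet_Ioi).2 (Eventually.of_forall fun x hx y hy => ?_)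
    rw [mem_Ioi] at hy hx
    have h1 := hasDerivAt_powKernel c j (show 0 < x + (δ + y) by linarith)
    simp only [← add_assoc] at h1 ⊢
    exact (HasDerivAt.comp_const_add (x + δ) y h1).const_mul _

/-- The transform satisfies the transformed equation up to the incoming part of the profile. -/
lemma ModeProfile.norm_transform_ode (hδ : 0 < δ) (h : ModeProfile δ M ω c b f f' B W)
    {z : ℝ} (hz : 0 ≤ z) :
    ‖z * (z + δ) * ((1 - Complex.I * c) * (2 - Complex.I * c)) * transform δ ω c f 2 z
      - ((1 - 4 * Complex.I * M * ω) * (z + δ) + z + 2 * Complex.I * ω * z * (z + δ))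
        * (1 - Complex.I * c) * transform δ ω c f 1 z
      + (2 * Complex.I * ω * (1 - Complex.I * c) * z + b + Complex.I * ω * (δ - 2 * M))
        * transform δ ω c f 0 z‖ ≤ W := by
  set A₂ : ℂ := z * (z + δ) * ((1 - Complex.I * c) * (2 - Complex.I * c)) with hA₂
  set A₁ : ℂ := ((1 - 4 * Complex.I * M * ω) * (z + δ) + z + 2 * Complex.I * ω * z * (z + δ))
        * (1 - Complex.I * c) with hA₁
  set A₀ : ℂ := 2 * Complex.I * ω * (1 - Complex.I * c) * z + b + Complex.I * ω * (δ - 2 * M)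
    with hA₀
  -- The phase in x + δ cancels the last factor of `profileWeight`, leaving the kernel of the
  -- transform. The operator in x applied to K equals, up to that phase, an operator in z applied to
  -- the power kernel; this is `LK`.
  let K : ℝ → ℂ := fun x => logPhase (4 * M * ω - c) (x + δ) * powKernel c 0 (x + (δ + z))
  let k₁ : ℝ → ℂ := fun x => Complex.I * (4 * M * ω - c) / ((x + δ : ℝ) : ℂ)
    - (1 - Complex.I * c) / ((x + (δ + z) : ℝ) : ℂ)
  let K' : ℝ → ℂ := fun x => K x * k₁ x
  let LK : ℝ → ℂ := fun x => logPhase (4 * M * ω - c) (x + δ) *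
    (A₂ * powKernel c 2 (x + (δ + z)) - A₁ * powKernel c 1 (x + (δ + z))
      + A₀ * powKernel c 0 (x + (δ + z)))
  let K'' : ℝ → ℂ := fun x => LK x
    - 2 * Complex.I * (ω * x * (x + δ) - 2 * M * ω * x - c * δ / 2) * K' x
      - (2 * Complex.I * ω * x + 8 * M * ω ^ 2 * x + b + Complex.I * ω * (δ - 2 * M)) * K x
  have hKd : ∀ x, 0 < x → HasDerivAt K (K' x) x := by
    intro x hx
    have hp : 0 < x + δ := by positivity
    have hP : 0 < x + (δ + z) := by positivity
    have hd := (hasDerivAt_logPhase_add (4 * M * ω - c) δ hp.ne').mul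
      (HasDerivAt.comp_add_const x (δ + z) (hasDerivAt_powKernel c 0 hP))
    refine hd.congr_deriv ?_
    simp only [K', K, k₁]
    rw [powKernel_succ c 0 hP]
    push_cast
    ring
  have hKb : ∀ x, 0 < x → ‖K x‖ ≤ 1 / (x + δ) := by
    intro x hx
    have hP : 0 < x + (δ + z) := by positivity
    simp only [K]
    rw [norm_mul, norm_logPhase, one_mul, norm_powKernel c 0 hP, zero_add, pow_one]
    exact one_div_le_one_div_of_le (by positivity) (by linarith)
  have hg := h.green hδ (K := K) (K' := K') (K'' := K'') (LK := LK)
    (C := ‖Complex.I * (4 * M * ω - c)‖ + ‖1 - Complex.I * c‖)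
    (C' := ‖A₂‖ / δ ^ 2 + ‖A₁‖ / δ + ‖A₀‖)
    hKd ?_ (fun x hx => by simp only [K'']; ring) hKb ?_ ?_ ?_
  · refine le_of_eq_of_le ?_ hg
    congr 1
    have hz' : 0 < δ + z := by positivity
    have i1 := (h.integrableOn_transform hδ 2 hz').const_mul A₂
    have i2 := (h.integrableOn_transform hδ 1 hz').const_mul A₁
    have i3 := (h.integrableOn_transform hδ 0 hz').const_mul A₀
    simp only [transform]
    rw [← integral_const_mul, ← integral_const_mul, ← integral_const_mul, ← integral_sub i1 i2]
    refine (integral_add (i1.sub i2) i3).symm.trans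
      (integral_congr_ae (Eventually.of_forall fun x => ?_))
    have e : logPhase (c - 4 * M * ω) (x + δ) * logPhase (4 * M * ω - c) (x + δ) = 1 := by
      rw [logPhase_mul, ← logPhase_zero (x + δ)]; congr 1; ring
    simp only [LK, Pi.sub_apply, profileWeight]
    linear_combination (-(linPhase (2 * ω) x * logPhase (-c) x * f x) *
      (A₂ * powKernel c 2 (x + (δ + z)) - A₁ * powKernel c 1 (x + (δ + z))
      + A₀ * powKernel c 0 (x + (δ + z)))) * e
  · intro x hx
    have hp : 0 < x + δ := by positivity
    have hP : 0 < x + (δ + z) := by positivity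
    have h1 : (x : ℂ) ≠ 0 := by exact_mod_cast hx.ne'
    have h2 : (x : ℂ) + δ ≠ 0 := by exact_mod_cast hp.ne'
    have h3 : (x : ℂ) + (δ + z) ≠ 0 := by exact_mod_cast hP.ne'
    have hA := ((hasDerivAt_ofReal x).mul (hasDerivAt_ofReal_add x δ)).mul ((hKd x hx).mul
      ((((hasDerivAt_ofReal_add x δ).inv (by push_cast; exact h2)).const_mul
        (Complex.I * (4 * M * ω - c))).sub
        (((hasDerivAt_ofReal_add x (δ + z)).inv (by push_cast; exact h3)).const_mul
        (1 - Complex.I * c))))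
    refine hA.congr_deriv ?_
    simp only [K'', LK, K', K, k₁, Pi.sub_apply, Pi.mul_apply, Pi.inv_apply]
    rw [powKernel_succ c 1 hP, powKernel_succ c 0 hP, hA₂, hA₁, hA₀]
    have hC : (8 : ℂ) * M * ω ^ 2 = 2 * ω * Complex.I * (-4 * Complex.I * M * ω) := by
      linear_combination (8 * (M : ℂ) * ω ^ 2) * Complex.I_sq
    rw [hC]
    push_cast
    field_simp
    ring
  · intro x hx
    have hp : 0 < x + δ := by positivity
    have hP : 0 < x + (δ + z) := by positivity
    have hk : ‖k₁ x‖ ≤ (‖Complex.I * (4 * M * ω - c)‖ + ‖1 - Complex.I * c‖) / (x + δ) := by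
      refine (norm_sub_le _ _).trans ?_
      rw [norm_div, norm_div, norm_ofReal_of_pos hp, norm_ofReal_of_pos hP, add_div]
      gcongr
      linarith
    calc ‖K' x‖ = ‖K x‖ * ‖k₁ x‖ := norm_mul _ _
      _ ≤ 1 / (x + δ) * ((‖Complex.I * (4 * M * ω - c)‖ + ‖1 - Complex.I * c‖) / (x + δ)) :=
          mul_le_mul (hKb x hx) hk (norm_nonneg _) (by positivity)
      _ = _ := by field_simp
  · have hz' : 0 < δ + z := by positivity
    exact (continuousOn_logPhase_add _ _ (fun x hx => (add_pos hx hδ).ne')).mul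
      ((((continuousOn_powKernel c 2 hz').const_mul _).sub
        ((continuousOn_powKernel c 1 hz').const_mul _)).add
        ((continuousOn_powKernel c 0 hz').const_mul _))
  · intro x hx
    have hp : 0 < x + δ := by positivity
    have hP : 0 < x + (δ + z) := by positivity
    have hb : ∀ j : ℕ, ‖powKernel c j (x + (δ + z))‖ ≤ 1 / (δ ^ j * (x + δ)) := by
      intro j
      rw [norm_powKernel c j hP, pow_succ]
      gcongr <;> linarith
    simp only [LK]
    rw [norm_mul, norm_logPhase, one_mul]
    refine (norm_add_le _ _).trans ((add_le_add_left (norm_sub_le _ _) _).trans ?_)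
    rw [norm_mul A₂, norm_mul A₁, norm_mul A₀]
    calc _ ≤ ‖A₂‖ * (1 / (δ ^ 2 * (x + δ))) + ‖A₁‖ * (1 / (δ ^ 1 * (x + δ)))
          + ‖A₀‖ * (1 / (δ ^ 0 * (x + δ))) := by
          gcongr
          · exact hb 2
          · exact hb 1
          · exact hb 0
      _ = _ := by field_simp

end

/-! ### The energy current and smallness of the zeroth moment -/

section

variable {δ M ω c b : ℝ} {f f' : ℝ → ℂ} {B W : ℝ}

lemma ModeProfile.incoming_nonneg (hδ : 0 < δ) (h : ModeProfile δ M ω c b f f' B W) : 0 ≤ W :=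
  (norm_nonneg _).trans (h.norm_transform_ode hδ le_rfl)

/-- The link between the two families of test functions: at z = 0 the weighted kernel is the
weighted test function with n = 0. -/
lemma transform_zero_eq_moment (δ M ω c : ℝ) (f : ℝ → ℂ) :
    transform δ ω c f 0 0 = moment δ M ω c f 0 := by
  refine integral_congr_ae (Eventually.of_forall fun x => ?_)
  have e : logPhase (c - 4 * M * ω) (x + δ) * logPhase (4 * M * ω) (x + δ)
      = logPhase c (x + δ) := by
    rw [logPhase_mul]; congr 1; ring
  simp only [powKernel, profileWeight, testFn, add_zero, zero_add, pow_zero, pow_one]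
  rw [← e]
  ring

/-- The constant in the decay estimate for the transform. -/
def decayConst (δ : ℝ) : ℝ := ∫ x in Ioi 0, (x + δ) ^ (-(5 / 4) : ℝ)

lemma decayConst_nonneg (hδ : 0 < δ) : 0 ≤ decayConst δ :=
  setIntegral_nonneg measurableSet_Ioi fun x hx => by
    have : 0 < x + δ := add_pos hx hδ
    positivity

/-- Split (x+δ+z)⁻¹ into powers 1/4 and 3/4. The first, joined to the decay of f, makes the
x-integral converge; the second exceeds 1/2, so that z² F F' tends to 0. -/
lemma ModeProfile.norm_transform_le (hδ : 0 < δ) (h : ModeProfile δ M ω c b f f' B W) (j : ℕ)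
    {z : ℝ} (hz : 0 ≤ z) :
    ‖transform δ ω c f j z‖ ≤ B * decayConst δ * (z + δ) ^ (-(3 / 4) : ℝ) / (z + δ) ^ j := by
  have hB := h.bound_nonneg hδ
  have hi : IntegrableOn (fun x : ℝ => (B * (z + δ) ^ (-(3 / 4) : ℝ) / (z + δ) ^ j)
      * (x + δ) ^ (-(5 / 4) : ℝ)) (Ioi 0) :=
    (integrableOn_add_rpow_Ioi_of_lt (by norm_num) (by linarith)).const_mul _
  refine (norm_integral_le_of_norm_le hi
    ((ae_restrict_iff' measurableSet_Ioi).2 (Eventually.of_forall fun x hx => ?_))).trans_eq ?_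
  · have hx' : 0 < x := hx
    have hp : 0 < x + δ := by positivity
    have hq : 0 < z + δ := by positivity
    have hP : 0 < x + (δ + z) := by positivity
    rw [norm_mul, norm_density, norm_powKernel c j hP]
    have h1 : (x + (δ + z))⁻¹ ≤ (x + δ) ^ (-(1 / 4) : ℝ) * (z + δ) ^ (-(3 / 4) : ℝ) := by
      have e : (x + (δ + z))⁻¹ = (x + (δ + z)) ^ (-(1 / 4) : ℝ) * (x + (δ + z)) ^ (-(3 / 4) : ℝ) := by
        rw [← Real.rpow_add hP, ← Real.rpow_neg_one]; norm_num
      rw [e]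
      exact mul_le_mul (Real.rpow_le_rpow_of_nonpos hp (by linarith) (by norm_num))
        (Real.rpow_le_rpow_of_nonpos hq (by linarith) (by norm_num)) (by positivity) (by positivity)
    have h2 : (x + δ) ^ (-(5 / 4) : ℝ) = (x + δ)⁻¹ * (x + δ) ^ (-(1 / 4) : ℝ) := by
      rw [← Real.rpow_neg_one, ← Real.rpow_add hp]; norm_num
    calc ‖f x‖ * (1 / (x + (δ + z)) ^ (j + 1))
        = ‖f x‖ * (1 / (x + (δ + z)) ^ j * (x + (δ + z))⁻¹) := by
          rw [pow_succ]; field_simp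
      _ ≤ B / (x + δ) * (1 / (z + δ) ^ j *
          ((x + δ) ^ (-(1 / 4) : ℝ) * (z + δ) ^ (-(3 / 4) : ℝ))) := by
          have h4 : 1 / (x + (δ + z)) ^ j ≤ 1 / (z + δ) ^ j :=
            one_div_le_one_div_of_le (by positivity) (pow_le_pow_left₀ hq.le (by linarith) j)
          exact mul_le_mul (h.bound x hx') (mul_le_mul h4 h1 (by positivity) (by positivity))
            (by positivity) (by positivity)
      _ = _ := by rw [h2]; field_simp
  · rw [integral_const_mul, decayConst]; ring

/-- The energy current of the transform. -/
def current (δ M ω c : ℝ) (f : ℝ → ℂ) (z : ℝ) : ℝ :=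
  (((z + δ) * (Complex.I * ω * (z - 2 * M) * transform δ ω c f 0 z
    + z * (-(1 - Complex.I * c) * transform δ ω c f 1 z)))
    * star (transform δ ω c f 0 z) : ℂ).im

/-- Multiply the transformed equation by the conjugate of F and take imaginary parts. The
coefficient of F' is 2z + δ + 2iω(z+δ)(z-2M), so both of its parts combine into a total derivative.
In the coefficient of |F|² the real quantities b and 2ωcz drop out; neither λ nor the superradiant c
survives. -/
lemma ModeProfile.hasDerivAt_current (hδ : 0 < δ) (h : ModeProfile δ M ω c b f f' B W)
    {z : ℝ} (hz : 0 ≤ z) :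
    HasDerivAt (current δ M ω c f)
      ((z * (z + δ) * ((1 - Complex.I * c) * (2 - Complex.I * c)) * transform δ ω c f 2 z
      - ((1 - 4 * Complex.I * M * ω) * (z + δ) + z + 2 * Complex.I * ω * z * (z + δ))
        * (1 - Complex.I * c) * transform δ ω c f 1 z
      + (2 * Complex.I * ω * (1 - Complex.I * c) * z + b + Complex.I * ω * (δ - 2 * M))
        * transform δ ω c f 0 z) * star (transform δ ω c f 0 z)).im z := by
  have d0 := h.hasDerivAt_transform hδ 0 hz
  have d1 := (h.hasDerivAt_transform hδ 1 hz).const_mul (-(1 - Complex.I * c))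
  have dz := hasDerivAt_ofReal z
  have hY := ((dz.add_const (δ : ℂ)).mul
    ((((dz.sub_const (2 * M : ℂ)).const_mul (Complex.I * ω)).mul d0).add (dz.mul d1))).mul d0.star
  have hI := Complex.imCLM.hasFDerivAt.comp_hasDerivAt z hY
  refine hI.congr_deriv ?_
  simp only [Complex.imCLM_apply, Pi.mul_apply, Pi.add_apply]
  generalize transform δ ω c f 0 z = F₀
  generalize transform δ ω c f (0 + 1) z = F₁
  generalize transform δ ω c f (1 + 1) z = F₂
  simp
  ring

/-- The variation of the current over [0, Z] is at most Z · W · sup |F|. At 0 it is -2Mωδ|F(0)|²; at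
Z ≥ 2M it is a multiple of ω with nonnegative factor, plus a cross term of size Z^(-1/2). -/
lemma ModeProfile.norm_transform_zero_sq_le (hδ : 0 < δ) (hM : 0 < M)
    (h : ModeProfile δ M ω c b f f' B W) {Z : ℝ} (hZ : 2 * M ≤ Z) :
    2 * M * |ω| * δ * ‖transform δ ω c f 0 0‖ ^ 2 ≤
      ‖1 - Complex.I * c‖ * (B * decayConst δ) ^ 2 * (Z + δ) ^ (-(1 / 2) : ℝ)
        + W * (B * decayConst δ * δ ^ (-(3 / 4) : ℝ)) * Z := by
  have hB := h.bound_nonneg hδ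
  have hκ := decayConst_nonneg hδ
  have hZ0 : 0 ≤ Z := by linarith
  have hZp : 0 < Z + δ := by linarith
  have hdiff : |current δ M ω c f Z - current δ M ω c f 0|
      ≤ W * (B * decayConst δ * δ ^ (-(3 / 4) : ℝ)) * (Z - 0) := by
    refine norm_image_sub_le_of_norm_deriv_le_segment' (f := current δ M ω c f)
      (fun x hx => (h.hasDerivAt_current hδ hx.1).hasDerivWithinAt) (fun x hx => ?_) Z ⟨hZ0, le_rfl⟩
    refine (Complex.abs_im_le_norm _).trans ?_
    rw [norm_mul, norm_star]
    refine mul_le_mul (h.norm_transform_ode hδ hx.1) ?_ (norm_nonneg _) (h.incoming_nonneg hδ)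
    refine (h.norm_transform_le hδ 0 hx.1).trans ?_
    rw [pow_zero, div_one]
    have : (x + δ) ^ (-(3 / 4) : ℝ) ≤ δ ^ (-(3 / 4) : ℝ) :=
      Real.rpow_le_rpow_of_nonpos hδ (by linarith [hx.1]) (by norm_num)
    gcongr
  have h0 : current δ M ω c f 0 = -(2 * M * ω * δ * ‖transform δ ω c f 0 0‖ ^ 2) := by
    rw [← Complex.normSq_eq_norm_sq, Complex.normSq_apply, current]
    simp
    ring
  have hZc : current δ M ω c f Z = (Z + δ) * (ω * (Z - 2 * M)) * ‖transform δ ω c f 0 Z‖ ^ 2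
      + ((Z + δ) * (Z * (-(1 - Complex.I * c) * transform δ ω c f 1 Z))
        * star (transform δ ω c f 0 Z)).im := by
    rw [← Complex.normSq_eq_norm_sq, Complex.normSq_apply, current]
    simp
    ring
  set X := ((Z + δ) * (Z * (-(1 - Complex.I * c) * transform δ ω c f 1 Z))
        * star (transform δ ω c f 0 Z)).im with hX
  have hXb : |X| ≤ ‖1 - Complex.I * c‖ * (B * decayConst δ) ^ 2 * (Z + δ) ^ (-(1 / 2) : ℝ) := by
    refine (Complex.abs_im_le_norm _).trans ?_
    have e1 : ‖(Z : ℂ) + δ‖ = Z + δ := by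
      rw [← Complex.ofReal_add, norm_ofReal_of_pos hZp]
    have e2 : ‖(Z : ℂ)‖ ≤ Z + δ := by
      rw [Complex.norm_real, Real.norm_of_nonneg hZ0]; linarith
    rw [norm_mul, norm_mul, norm_mul, norm_mul, norm_neg, norm_star, e1]
    have a1 := h.norm_transform_le hδ 1 hZ0
    have a0 := h.norm_transform_le hδ 0 hZ0
    calc (Z + δ) * (‖(Z : ℂ)‖ * (‖1 - Complex.I * c‖ * ‖transform δ ω c f 1 Z‖))
          * ‖transform δ ω c f 0 Z‖
        ≤ (Z + δ) * ((Z + δ) * (‖1 - Complex.I * c‖ *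
          (B * decayConst δ * (Z + δ) ^ (-(3 / 4) : ℝ) / (Z + δ) ^ 1)))
          * (B * decayConst δ * (Z + δ) ^ (-(3 / 4) : ℝ) / (Z + δ) ^ 0) := by gcongr
      _ = ‖1 - Complex.I * c‖ * (B * decayConst δ) ^ 2 *
          ((Z + δ) * (Z + δ) ^ (-(3 / 4) : ℝ) * (Z + δ) ^ (-(3 / 4) : ℝ)) := by
          field_simp
      _ = _ := by
          congr 1
          nth_rewrite 1 [← Real.rpow_one (Z + δ)]
          rw [← Real.rpow_add hZp, ← Real.rpow_add hZp]
          norm_num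
  rw [hZc, h0, sub_neg_eq_add, sub_zero] at hdiff
  have hq : 0 ≤ (Z + δ) * (Z - 2 * M) * ‖transform δ ω c f 0 Z‖ ^ 2 :=
    mul_nonneg (mul_nonneg hZp.le (by linarith)) (by positivity)
  set P := (Z + δ) * (Z - 2 * M) * ‖transform δ ω c f 0 Z‖ ^ 2 with hP
  set N := ‖transform δ ω c f 0 0‖ ^ 2 with hN
  have e1 : (Z + δ) * (ω * (Z - 2 * M)) * ‖transform δ ω c f 0 Z‖ ^ 2 = ω * P := by
    rw [hP]; ring
  rw [e1] at hdiff
  have hd := abs_le.1 hdiff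
  have hx := abs_le.1 hXb
  -- In the difference of the currents the terms in P and N have the same sign, that of ω, so P can
  -- be discarded.
  rcases le_total 0 ω with hω | hω
  · rw [abs_of_nonneg hω]
    nlinarith [mul_nonneg hω hq]
  · rw [abs_of_nonpos hω]
    nlinarith [mul_nonneg (neg_nonneg.2 hω) hq]

end

/-- If the incoming part is small, then so is the zeroth moment, uniformly in the frequencies. -/
lemma exists_moment_zero_small {δ M K B e : ℝ} (hδ : 0 < δ) (hM : 0 < M) (hK : 0 < K) (he : 0 < e) :
    ∃ η, 0 < η ∧ ∀ ω c b W (f f' : ℝ → ℂ), |ω|⁻¹ ≤ K → ω ≠ 0 → |c| ≤ K →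
      ModeProfile δ M ω c b f f' B W → W ≤ η → ‖moment δ M ω c f 0‖ ≤ e := by
  set A := (1 + K) * (B * decayConst δ) ^ 2 with hA
  set A' := B * decayConst δ * δ ^ (-(3 / 4) : ℝ) with hA'
  set τ := 2 * M * δ * e ^ 2 / K with hτ
  have hτ0 : 0 < τ := by positivity
  have hlim : Tendsto (fun Z : ℝ => A * (Z + δ) ^ (-(1 / 2) : ℝ)) atTop (𝓝 (A * 0)) :=
    ((tendsto_rpow_neg_atTop (by norm_num : (0 : ℝ) < 1 / 2)).comp
      (tendsto_atTop_add_const_right _ δ tendsto_id)).const_mul A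
  rw [mul_zero] at hlim
  -- Z is fixed first, to make the cross term small; only then is W taken small relative to Z.
  obtain ⟨Z, hZ1, hZ2⟩ := ((hlim.eventually (gt_mem_nhds (half_pos hτ0))).and
    (eventually_ge_atTop (2 * M))).exists
  have hZ : 0 < Z := by linarith
  refine ⟨τ / (2 * (|A'| + 1) * Z), by positivity, fun ω c b W f f' hω hω0 hc h hW => ?_⟩
  have hmain := h.norm_transform_zero_sq_le hδ hM hZ2
  rw [transform_zero_eq_moment δ M] at hmain
  have hW0 := h.incoming_nonneg hδ
  have h1 : ‖1 - Complex.I * c‖ ≤ 1 + K := by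
    refine (norm_sub_le _ _).trans ?_
    rw [norm_mul, Complex.norm_I, norm_one, Complex.norm_real, one_mul]
    gcongr; exact hc
  have h2 : ‖1 - Complex.I * c‖ * (B * decayConst δ) ^ 2 * (Z + δ) ^ (-(1 / 2) : ℝ) ≤ τ / 2 := by
    refine le_trans ?_ hZ1.le
    rw [hA]
    have : 0 < Z + δ := by positivity
    gcongr
  have h3 : W * A' * Z ≤ τ / 2 := by
    calc W * A' * Z ≤ W * (|A'| + 1) * Z := by
          gcongr
          linarith [le_abs_self A']
      _ ≤ τ / (2 * (|A'| + 1) * Z) * (|A'| + 1) * Z := by gcongr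
      _ = τ / 2 := by field_simp
  have hωp : 0 < |ω| := abs_pos.2 hω0
  have h4 : K⁻¹ ≤ |ω| := inv_le_of_inv_le₀ hωp hω
  have h5 : 2 * M * K⁻¹ * δ * ‖moment δ M ω c f 0‖ ^ 2 ≤ τ := by
    calc _ ≤ 2 * M * |ω| * δ * ‖moment δ M ω c f 0‖ ^ 2 := by gcongr
      _ ≤ τ := by linarith
  have h6 : ‖moment δ M ω c f 0‖ ^ 2 ≤ e ^ 2 := by
    have e7 : 2 * M * K⁻¹ * δ * ‖moment δ M ω c f 0‖ ^ 2
        = (2 * M * δ / K) * ‖moment δ M ω c f 0‖ ^ 2 := by field_simp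
    have e8 : τ = (2 * M * δ / K) * e ^ 2 := by rw [hτ]; ring
    rw [e7, e8] at h5
    exact le_of_mul_le_mul_left h5 (by positivity)
  exact (pow_le_pow_iff_left₀ (norm_nonneg _) he.le two_ne_zero).1 h6

/-! ### From small moments to a lower bound: polynomial approximation near the horizon -/

/-- The phase of the moment density. -/
def densityPhase (δ ω c x : ℝ) : ℂ :=
  linPhase (2 * ω) x * logPhase (-c) x * logPhase c (x + δ)

lemma norm_densityPhase (δ ω c x : ℝ) : ‖densityPhase δ ω c x‖ = 1 := by
  simp [densityPhase, norm_linPhase, norm_logPhase]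

lemma hasDerivAt_densityPhase {δ : ℝ} (hδ : 0 < δ) (ω c : ℝ) {x : ℝ} (hx : 0 < x) :
    HasDerivAt (densityPhase δ ω c)
      (Complex.I * ((2 * ω - c / x + c / (x + δ) : ℝ) : ℂ) * densityPhase δ ω c x) x := by
  have hp : x + δ ≠ 0 := by positivity
  have hd := ((hasDerivAt_linPhase (2 * ω) x).mul (hasDerivAt_logPhase (-c) hx.ne')).mul
    (hasDerivAt_logPhase_add c δ hp)
  refine hd.congr_deriv ?_
  simp only [densityPhase, Pi.mul_apply]
  push_cast
  ring

lemma continuousOn_densityPhase {δ : ℝ} (hδ : 0 < δ) (ω c : ℝ) :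
    ContinuousOn (densityPhase δ ω c) (Ioi 0) := fun _ hx =>
  (hasDerivAt_densityPhase hδ ω c hx).continuousAt.continuousWithinAt

lemma norm_densityPhase_sub_le {δ ω c K y x : ℝ} (hδ : 0 < δ) (hω : |ω| ≤ K) (hc : |c| ≤ K)
    (hy : 0 < y) (hx : y ≤ x) :
    ‖densityPhase δ ω c x - densityPhase δ ω c y‖ ≤ (2 * K + 2 * K / y) * (x - y) := by
  have hK : 0 ≤ K := (abs_nonneg _).trans hω
  refine norm_image_sub_le_of_norm_deriv_le_segment' (f := densityPhase δ ω c) (b := x)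
    (fun t ht => (hasDerivAt_densityPhase hδ ω c (hy.trans_le ht.1)).hasDerivWithinAt)
    (fun t ht => ?_) x ⟨hx, le_rfl⟩
  have ht0 : 0 < t := hy.trans_le ht.1
  rw [norm_mul, norm_mul, Complex.norm_I, norm_densityPhase, one_mul, mul_one, Complex.norm_real]
  refine (norm_add_le _ _).trans ((add_le_add_left (norm_sub_le _ _) _).trans ?_)
  rw [Real.norm_eq_abs, Real.norm_eq_abs, Real.norm_eq_abs, abs_mul, abs_div, abs_div, abs_two,
    abs_of_pos ht0, abs_of_pos (by positivity : 0 < t + δ)]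
  have h1 : |c| / t ≤ K / y := by
    have := ht.1
    gcongr
  have h2 : |c| / (t + δ) ≤ K / y := by
    have : y ≤ t + δ := by linarith [ht.1]
    gcongr
  have : 2 * K / y = K / y + K / y := by ring
  linarith

/-- All weighted test functions share one phase independent of n; what remains are the real powers
of x/(x+δ), to which Weierstrass approximation applies. -/
lemma profileWeight_mul_testFn {δ : ℝ} (hδ : 0 < δ) (M ω c : ℝ) (n : ℕ) {x : ℝ} (hx : 0 < x) :
    profileWeight δ M ω c x * testFn δ M ω n x
      = densityPhase δ ω c x * (((x / (x + δ)) ^ n / (x + δ) : ℝ) : ℂ) := by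
  have h2 : (x : ℂ) + δ ≠ 0 := by exact_mod_cast (by positivity : x + δ ≠ 0)
  have e : logPhase (c - 4 * M * ω) (x + δ) * logPhase (4 * M * ω) (x + δ)
      = logPhase c (x + δ) := by
    rw [logPhase_mul]; congr 1; ring
  simp only [profileWeight, testFn, densityPhase]
  rw [← e, div_pow, pow_succ]
  push_cast
  field_simp

/-- Pairing a profile with a polynomial gives a combination of its moments. -/
lemma ModeProfile.integral_polynomial {δ M ω c b : ℝ} {f f' : ℝ → ℂ} {B W : ℝ} (hδ : 0 < δ)
    (h : ModeProfile δ M ω c b f f' B W) (P : Polynomial ℝ) :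
    ∫ x in Ioi 0, densityPhase δ ω c x * f x * ((P.eval (x / (x + δ)) / (x + δ) : ℝ) : ℂ)
      = ∑ n ∈ Finset.range (P.natDegree + 1), (P.coeff n : ℂ) * moment δ M ω c f n := by
  simp only [moment]
  simp_rw [← integral_const_mul]
  rw [← integral_finsetSum _ (fun n _ => (h.integrableOn_testFn hδ n).const_mul _)]
  refine setIntegral_congr_fun measurableSet_Ioi fun x hx => ?_
  rw [Polynomial.eval_eq_sum_range, Finset.sum_div, Complex.ofReal_sum, Finset.mul_sum]
  refine Finset.sum_congr rfl fun n _ => ?_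
  have e := profileWeight_mul_testFn hδ M ω c n hx
  rw [mul_right_comm (profileWeight δ M ω c x), e]
  push_cast
  ring

/-- A bump function on `(u, v)`. -/
def bump (u v t : ℝ) : ℝ := max 0 ((t - u) * (v - t))

lemma continuous_bump (u v : ℝ) : Continuous (bump u v) := by unfold bump; fun_prop

lemma bump_nonneg (u v t : ℝ) : 0 ≤ bump u v t := le_max_left _ _

lemma bump_eq_zero {u v t : ℝ} (huv : u ≤ v) (h : t ≤ u ∨ v ≤ t) : bump u v t = 0 := by
  refine max_eq_left ?_
  rcases h with h | h <;> nlinarith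

lemma bump_pos {u v t : ℝ} (h1 : u < t) (h2 : t < v) : 0 < bump u v t :=
  lt_max_of_lt_right (mul_pos (sub_pos.2 h1) (sub_pos.2 h2))

lemma bump_le_one {u v t : ℝ} (hu : 0 ≤ u) (hv : v ≤ 1) (huv : u ≤ v) : bump u v t ≤ 1 := by
  refine max_le zero_le_one ?_
  rcases le_total t u with h | h
  · nlinarith
  rcases le_total v t with h' | h'
  · nlinarith
  · nlinarith [mul_le_mul (show t - u ≤ 1 by linarith) (show v - t ≤ 1 by linarith)
      (by linarith) zero_le_one]

lemma div_add_lt_div_add {δ x y : ℝ} (hδ : 0 < δ) (hx : 0 < x) (hxy : x < y) :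
    x / (x + δ) < y / (y + δ) := by
  have hy : 0 < y := hx.trans hxy
  rw [div_lt_div_iff₀ (by positivity) (by positivity)]
  nlinarith

/-- Quantitative nonvanishing of the incoming part of a nontrivial regular profile. -/
theorem exists_incoming_lower_bound {δ M K B c₀ x₀ : ℝ} (hδ : 0 < δ) (hM : 0 < M) (hK : 0 < K)
    (hc₀ : 0 < c₀) (hx₀ : 0 < x₀) :
    ∃ η, 0 < η ∧ ∀ ω c b W (f f' : ℝ → ℂ) (f₀ : ℂ), ω ≠ 0 → |ω| ≤ K → |ω|⁻¹ ≤ K → |c| ≤ K → |b| ≤ K →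
      ModeProfile δ M ω c b f f' B W → ‖f₀‖ = c₀ → (∀ x, 0 < x → x ≤ x₀ → ‖f x - f₀‖ ≤ c₀ / 8) →
      η < W := by
  set x₁ := x₀ / 2 with hx₁
  have hx₁0 : 0 < x₁ := by positivity
  set T := 2 * K + 2 * K / x₁ with hT
  have hT0 : 0 < T := by positivity
  -- T bounds the derivative of the phase beyond x₁, so on (x₁, x₂) the phase moves by at most 1/2.
  set x₂ := min x₀ (x₁ + 1 / (2 * T)) with hx₂
  have hx₁₂ : x₁ < x₂ := lt_min (by linarith) (lt_add_of_pos_right _ (by positivity))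
  set v₁ := x₁ / (x₁ + δ) with hv₁
  set v₂ := x₂ / (x₂ + δ) with hv₂
  have hx₂0 : 0 < x₂ := hx₁0.trans hx₁₂
  have hv : v₁ < v₂ := div_add_lt_div_add hδ hx₁0 hx₁₂
  have hv₁0 : 0 ≤ v₁ := by positivity
  have hv₂1 : v₂ ≤ 1 := div_add_le_one hδ hx₂0
  let g : ℝ → ℝ := fun x => bump v₁ v₂ (x / (x + δ)) / (x + δ)
  have hg0 : ∀ x, 0 < x → 0 ≤ g x := fun x hx => div_nonneg (bump_nonneg _ _ _) (by positivity)
  have hgsupp : ∀ x, 0 < x → (x ≤ x₁ ∨ x₂ ≤ x) → g x = 0 := by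
    intro x hx hc
    have : bump v₁ v₂ (x / (x + δ)) = 0 := by
      refine bump_eq_zero hv.le ?_
      rcases hc with hc | hc
      · rcases hc.eq_or_lt with rfl | hc
        · exact Or.inl le_rfl
        · exact Or.inl (div_add_lt_div_add hδ hx hc).le
      · rcases hc.eq_or_lt with rfl | hc
        · exact Or.inr le_rfl
        · exact Or.inr (div_add_lt_div_add hδ hx₂0 hc).le
    simp only [g, this, zero_div]
  have hvc : ContinuousOn (fun x : ℝ => x / (x + δ)) (Ioi 0) :=
    continuousOn_id.div (continuousOn_id.add continuousOn_const) fun x hx => (add_pos hx hδ).ne'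
  have hgc : ContinuousOn g (Ioi 0) :=
    ((continuous_bump v₁ v₂).comp_continuousOn hvc).div
      (continuousOn_id.add continuousOn_const) fun x hx => (add_pos hx hδ).ne'
  have hgi' : IntegrableOn (fun x => ((g x : ℝ) : ℂ)) (Ioi 0) := by
    refine integrableOn_of_le_inv_sq hδ (C := x₂ + δ)
      (Complex.continuous_ofReal.comp_continuousOn hgc) fun x hx => ?_
    rw [Complex.norm_real, Real.norm_of_nonneg (hg0 x hx)]
    rcases le_total x₂ x with hc | hc
    · rw [hgsupp x hx (Or.inr hc)]; positivity
    · calc g x ≤ 1 / (x + δ) := by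
            have := bump_le_one (t := x / (x + δ)) hv₁0 hv₂1 hv.le
            simp only [g]; gcongr
        _ = (x + δ) / (x + δ) ^ 2 := by field_simp
        _ ≤ _ := by gcongr
  have hgi : IntegrableOn g (Ioi 0) := by simpa [IntegrableOn] using hgi'.re
  set H := ∫ x in Ioi 0, g x with hH
  have hHpos : 0 < H := by
    rw [hH, setIntegral_pos_iff_support_of_nonneg_ae
      ((ae_restrict_iff' measurableSet_Ioi).2 (Eventually.of_forall hg0)) hgi]
    refine lt_of_lt_of_le ?_ (measure_mono (show Ioo x₁ x₂ ⊆ _ from fun x hx => ⟨?_, hx₁0.trans hx.1⟩))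
    · rw [Real.volume_Ioo]; simpa using hx₁₂
    · have hx0 := hx₁0.trans hx.1
      exact (div_pos (bump_pos (div_add_lt_div_add hδ hx₁0 hx.1) (div_add_lt_div_add hδ hx0 hx.2))
        (by positivity)).ne'
  set I₂ := ∫ x in Ioi 0, |B| / (x + δ) ^ 2 with hI₂
  have hI₂0 : 0 ≤ I₂ := setIntegral_nonneg measurableSet_Ioi fun x hx => by positivity
  -- Error budget relative to c₀H: 1/8 for the polynomial approximation, 1/8 for the moments, 5/8
  -- for freezing phase and profile. The total 7/8 is less than 1.
  set ε := c₀ * H / (8 * (I₂ + 1)) with hε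
  have hε0 : 0 < ε := by positivity
  obtain ⟨P, hP⟩ := exists_polynomial_near_of_continuousOn 0 1 (bump v₁ v₂)
    (continuous_bump v₁ v₂).continuousOn ε hε0
  choose D hD hDm using exists_moment_bound hδ M K
  set S := ∑ n ∈ Finset.range (P.natDegree + 1), |P.coeff n| * D n with hS
  have hS0 : 0 ≤ S := Finset.sum_nonneg fun n _ => mul_nonneg (abs_nonneg _) (hD n)
  -- Both the zeroth moment and W will be at most e, so the combination of moments is at most 2eS,
  -- below c₀H/8.
  set e := c₀ * H / (16 * (S + 1)) with he
  have he0 : 0 < e := by positivity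
  obtain ⟨η, hη, hηm⟩ := exists_moment_zero_small (B := B) hδ hM hK he0
  refine ⟨min η e, lt_min hη he0, fun ω c b W f f' f₀ hω0 hω hω' hc hb h hf₀ hf => ?_⟩
  by_contra! hW
  have hm0 := hηm ω c b W f f' hω' hω0 hc h (hW.trans (min_le_left _ _))
  have hWe : W ≤ e := hW.trans (min_le_right _ _)
  have hW0 := h.incoming_nonneg hδ
  have hsum : ‖∑ n ∈ Finset.range (P.natDegree + 1), (P.coeff n : ℂ) * moment δ M ω c f n‖
      ≤ c₀ * H / 8 := by
    calc _ ≤ ∑ n ∈ Finset.range (P.natDegree + 1), |P.coeff n| * D n * (2 * e) := by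
          refine norm_sum_le_of_le _ fun n _ => ?_
          rw [norm_mul, Complex.norm_real, Real.norm_eq_abs, mul_assoc]
          gcongr
          refine (hDm n ω c b B W f f' hω hc hb h).1.trans ?_
          have := hD n
          gcongr
          linarith
      _ = S * (2 * e) := by rw [hS, Finset.sum_mul]
      _ = c₀ * H / 8 * (S / (S + 1)) := by rw [he]; field_simp; ring
      _ ≤ c₀ * H / 8 * 1 := by
          gcongr
          rw [div_le_one (by positivity)]; linarith
      _ = _ := mul_one _
  rw [← h.integral_polynomial hδ P] at hsum
  have hdc := (continuousOn_densityPhase hδ ω c).mul h.continuousOn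
  have hPc : ContinuousOn (fun x : ℝ => ((P.eval (x / (x + δ)) / (x + δ) : ℝ) : ℂ)) (Ioi 0) :=
    Complex.continuous_ofReal.comp_continuousOn (((P.continuous).comp_continuousOn hvc).div
      (continuousOn_id.add continuousOn_const) fun x hx => (add_pos hx hδ).ne')
  have hgi₂ : IntegrableOn (fun x => densityPhase δ ω c x * f x * ((g x : ℝ) : ℂ)) (Ioi 0) := by
    refine integrableOn_of_le_inv_sq hδ (C := B)
      (hdc.mul (Complex.continuous_ofReal.comp_continuousOn hgc)) fun x hx => ?_
    rw [norm_mul, norm_mul, norm_densityPhase, one_mul, Complex.norm_real,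
      Real.norm_of_nonneg (hg0 x hx)]
    have hB := h.bound_nonneg hδ
    calc ‖f x‖ * g x ≤ B / (x + δ) * (1 / (x + δ)) := by
          refine mul_le_mul (h.bound x hx) ?_ (hg0 x hx) (by positivity)
          have := bump_le_one (t := x / (x + δ)) hv₁0 hv₂1 hv.le
          simp only [g]; gcongr
      _ = _ := by field_simp
  have hdiffb : ∀ x, 0 < x → ‖densityPhase δ ω c x * f x *
      ((P.eval (x / (x + δ)) / (x + δ) : ℝ) : ℂ) - densityPhase δ ω c x * f x * ((g x : ℝ) : ℂ)‖
      ≤ ε * (|B| / (x + δ) ^ 2) := by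
    intro x hx
    have hp : 0 < x + δ := by positivity
    rw [← mul_sub, ← Complex.ofReal_sub, norm_mul, norm_mul, norm_densityPhase, one_mul,
      Complex.norm_real]
    simp only [g]
    rw [← sub_div, norm_div, Real.norm_eq_abs, Real.norm_of_nonneg hp.le]
    calc _ ≤ |B| / (x + δ) * (ε / (x + δ)) := by
          refine mul_le_mul ((h.bound x hx).trans ?_) ?_ (by positivity) (by positivity)
          · gcongr; exact le_abs_self B
          · have := (hP (x / (x + δ)) ⟨by positivity, div_add_le_one hδ hx⟩).le
            gcongr
      _ = _ := by field_simp
  have hPi : IntegrableOn (fun x => densityPhase δ ω c x * f x *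
      ((P.eval (x / (x + δ)) / (x + δ) : ℝ) : ℂ)) (Ioi 0) := by
    have hd := integrableOn_of_le_inv_sq hδ (C := ε * |B|) ((hdc.mul hPc).sub (hdc.mul
      (Complex.continuous_ofReal.comp_continuousOn hgc)))
      (fun x hx => (hdiffb x hx).trans_eq (by rw [mul_div_assoc]))
    refine (Integrable.add hd hgi₂).congr (Eventually.of_forall fun x => ?_)
    simp
  have hd1 : ‖(∫ x in Ioi 0, densityPhase δ ω c x * f x *
      ((P.eval (x / (x + δ)) / (x + δ) : ℝ) : ℂ))
      - ∫ x in Ioi 0, densityPhase δ ω c x * f x * ((g x : ℝ) : ℂ)‖ ≤ c₀ * H / 8 := by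
    rw [← integral_sub hPi hgi₂]
    refine (norm_integral_le_of_norm_le ((integrableOn_inv_sq hδ |B|).const_mul ε)
      ((ae_restrict_iff' measurableSet_Ioi).2 (Eventually.of_forall hdiffb))).trans ?_
    rw [integral_const_mul, ← hI₂]
    calc ε * I₂ = c₀ * H / 8 * (I₂ / (I₂ + 1)) := by rw [hε]; field_simp
      _ ≤ c₀ * H / 8 * 1 := by
          gcongr
          rw [div_le_one (by positivity)]; linarith
      _ = _ := mul_one _
  have hd2 : ‖(∫ x in Ioi 0, densityPhase δ ω c x * f x * ((g x : ℝ) : ℂ))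
      - densityPhase δ ω c x₁ * f₀ * (H : ℂ)‖ ≤ 5 / 8 * c₀ * H := by
    have e1 : densityPhase δ ω c x₁ * f₀ * (H : ℂ)
        = ∫ x in Ioi 0, densityPhase δ ω c x₁ * f₀ * ((g x : ℝ) : ℂ) := by
      rw [integral_const_mul, hH, integral_complex_ofReal]
    rw [e1, ← integral_sub hgi₂ (hgi'.const_mul _)]
    refine (norm_integral_le_of_norm_le (hgi.const_mul (5 / 8 * c₀))
      ((ae_restrict_iff' measurableSet_Ioi).2 (Eventually.of_forall fun x hx => ?_))).trans_eq
      (integral_const_mul _ _)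
    have hx0 : 0 < x := hx
    rcases le_or_gt x x₁ with hc1 | hc1
    · simp [hgsupp x hx0 (Or.inl hc1)]
    rcases le_or_gt x₂ x with hc2 | hc2
    · simp [hgsupp x hx0 (Or.inr hc2)]
    rw [← sub_mul, norm_mul, Complex.norm_real, Real.norm_of_nonneg (hg0 x hx0)]
    refine mul_le_mul_of_nonneg_right ?_ (hg0 x hx0)
    -- The profile contributes 1/8 and the phase 1/2, whence 5/8.
    have e2 : densityPhase δ ω c x * f x - densityPhase δ ω c x₁ * f₀
        = densityPhase δ ω c x * (f x - f₀)
          + (densityPhase δ ω c x - densityPhase δ ω c x₁) * f₀ := by ring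
    rw [e2]
    refine (norm_add_le _ _).trans ?_
    rw [norm_mul, norm_mul, norm_densityPhase, one_mul, hf₀]
    have a1 := hf x hx0 (hc2.le.trans (min_le_left _ _))
    have a2 : ‖densityPhase δ ω c x - densityPhase δ ω c x₁‖ ≤ 1 / 2 := by
      refine (norm_densityPhase_sub_le hδ hω hc hx₁0 hc1.le).trans ?_
      have : x - x₁ ≤ 1 / (2 * T) := by linarith [hc2.le.trans (min_le_right _ _)]
      calc T * (x - x₁) ≤ T * (1 / (2 * T)) := by gcongr
        _ = 1 / 2 := by field_simp
    nlinarith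
  have hfinal : ‖densityPhase δ ω c x₁ * f₀ * (H : ℂ)‖ = c₀ * H := by
    rw [norm_mul, norm_mul, norm_densityPhase, one_mul, hf₀, norm_ofReal_of_pos hHpos]
  set X₁ := ∫ x in Ioi 0, densityPhase δ ω c x * f x *
      ((P.eval (x / (x + δ)) / (x + δ) : ℝ) : ℂ)
  set X₂ := ∫ x in Ioi 0, densityPhase δ ω c x * f x * ((g x : ℝ) : ℂ)
  set X₃ := densityPhase δ ω c x₁ * f₀ * (H : ℂ)
  have t1 := norm_sub_norm_le X₃ X₂
  have t2 := norm_sub_norm_le X₂ X₁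
  rw [norm_sub_rev] at t1 t2
  nlinarith [mul_pos hc₀ hHpos]

/-! ### From the Carter equation to the profile equation -/

/-- The distance `r₊ - r₋` between the horizons. -/
def gap (a Q M : ℝ) : ℝ := rPlus a Q M - rMinus a Q M

lemma gap_pos {a Q M : ℝ} (h : Subextremal a Q M) : 0 < gap a Q M := by
  have : 0 < √(M ^ 2 - a ^ 2 - Q ^ 2) := Real.sqrt_pos.2 (by linarith [h.2])
  simp only [gap, rPlus, rMinus]; linarith

lemma gap_eq (a Q M : ℝ) : gap a Q M = 2 * (rPlus a Q M - M) := by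
  simp only [gap, rPlus, rMinus]; ring

lemma mass_le_rPlus (a Q M : ℝ) : M ≤ rPlus a Q M := by
  simp only [rPlus]; linarith [Real.sqrt_nonneg (M ^ 2 - a ^ 2 - Q ^ 2)]

lemma rPlus_pos {a Q M : ℝ} (h : Subextremal a Q M) : 0 < rPlus a Q M :=
  h.1.trans_le (mass_le_rPlus a Q M)

lemma gap_le_rPlus {a Q M : ℝ} (h : Subextremal a Q M) : gap a Q M ≤ rPlus a Q M := by
  have : √(M ^ 2 - a ^ 2 - Q ^ 2) ≤ M := by
    rw [Real.sqrt_le_left h.1.le]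
    nlinarith [sq_nonneg a, sq_nonneg Q]
  simp only [gap, rPlus, rMinus]; linarith

lemma Delta_rPlus {a Q M : ℝ} (h : Subextremal a Q M) : Delta a Q M (rPlus a Q M) = 0 := by
  have := Real.sq_sqrt (show 0 ≤ M ^ 2 - a ^ 2 - Q ^ 2 by linarith [h.2])
  simp only [Delta, rPlus]; linear_combination this

lemma Delta_rPlus_add {a Q M : ℝ} (h : Subextremal a Q M) (x : ℝ) :
    Delta a Q M (rPlus a Q M + x) = x * (x + gap a Q M) := by
  have h1 := Delta_rPlus h
  rw [gap_eq]
  simp only [Delta] at h1 ⊢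
  linear_combination h1

/-- The value at the horizon of `(r² + a²) ω - a m`. -/
def horizonFreq (a Q M ω : ℝ) (m : ℤ) : ℝ := ω * (rPlus a Q M ^ 2 + a ^ 2) - a * m

/-- Twice the modulus of the horizon exponent, with sign. -/
def horizonExponent (a Q M ω : ℝ) (m : ℤ) : ℝ := 2 * horizonFreq a Q M ω m / gap a Q M

/-- The accessory parameter of the profile equation. -/
def accessory (a Q M ω : ℝ) (m : ℤ) (lam : ℝ) : ℝ :=
  4 * ω * horizonFreq a Q M ω m - lam - a ^ 2 * ω ^ 2 + 2 * a * m * ω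

/-- Since Δ(r₊) = 0, 2Mr₊ - Q² equals r₊² + a². -/
lemma xi_eq {a Q M : ℝ} (h : Subextremal a Q M) (ω : ℝ) (m : ℤ) :
    xi a Q M ω m = Complex.I * ((-(horizonExponent a Q M ω m / 2) : ℝ) : ℂ) := by
  have h1 := Delta_rPlus h
  change Complex.I * (((a * m - (2 * M * rPlus a Q M - Q ^ 2) * ω) / gap a Q M : ℝ) : ℂ) = _
  congr 2
  simp only [horizonExponent, horizonFreq]
  simp only [Delta] at h1
  have : gap a Q M ≠ 0 := (gap_pos h).ne'
  field_simp
  linear_combination ω * h1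

/-- The Carter expression contains the square of k = ω(r²+a²) - am. With T = ωx(x+δ) - 2Mωx - κ one
has k + T = 2ωΔ, so k² - T² = Δ(8Mω²x + 4ωκ): replacing k by T costs only a multiple of Δ. The phase
of the profile is built on T, which behaves like -k at the horizon and like +k at infinity. -/
lemma potential_eq {a Q M : ℝ} (h : Subextremal a Q M) (ω : ℝ) (m : ℤ) (lam : ℝ) {x : ℝ}
    (hx : 0 < x) :
    ((rPlus a Q M + x) ^ 2 + a ^ 2) ^ 2 * (ω ^ 2 - potential a Q M ω m lam (rPlus a Q M + x))
      = x * (x + gap a Q M) * (accessory a Q M ω m lam + 8 * M * ω ^ 2 * x)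
        + (ω * x * (x + gap a Q M) - 2 * M * ω * x - horizonFreq a Q M ω m) ^ 2
        - x * (x + gap a Q M) * (2 * (rPlus a Q M + x) ^ 2 + x * (x + gap a Q M)
            - 2 * M * (rPlus a Q M + x)) / ((rPlus a Q M + x) ^ 2 + a ^ 2)
        + 3 * (x * (x + gap a Q M)) ^ 2 * (rPlus a Q M + x) ^ 2
            / ((rPlus a Q M + x) ^ 2 + a ^ 2) ^ 2 := by
  have hr := rPlus_pos h
  have hn : (rPlus a Q M + x) ^ 2 + a ^ 2 ≠ 0 := by positivity
  have hg := gap_eq a Q M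
  simp only [potential, Delta_rPlus_add h, accessory, horizonFreq]
  rw [hg]
  set r := rPlus a Q M
  field_simp
  ring

/-- The Carter equation as a first-order system in the variable `x = r - r₊`. -/
structure CarterSystem (a Q M ω : ℝ) (m : ℤ) (lam : ℝ) (v y : ℝ → ℂ) : Prop where
  deriv_fst : ∀ x, 0 < x → HasDerivAt v
    ((((rPlus a Q M + x) ^ 2 + a ^ 2) / (x * (x + gap a Q M)) : ℝ) * y x) x
  deriv_snd : ∀ x, 0 < x → HasDerivAt y
    (-((((rPlus a Q M + x) ^ 2 + a ^ 2) / (x * (x + gap a Q M)) : ℝ)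
      * ((ω ^ 2 - potential a Q M ω m lam (rPlus a Q M + x) : ℝ) * v x))) x

lemma IsTortoise.hasDerivAt_shift {a Q M : ℝ} {rs : ℝ → ℝ} (hs : Subextremal a Q M)
    (hrs : IsTortoise a Q M rs) {x : ℝ} (hx : 0 < x) :
    HasDerivAt (fun x => rs (rPlus a Q M + x))
      (((rPlus a Q M + x) ^ 2 + a ^ 2) / (x * (x + gap a Q M))) x := by
  have := hrs (rPlus a Q M + x) (by linarith)
  rw [Delta_rPlus_add hs] at this
  exact HasDerivAt.comp_const_add (rPlus a Q M) x this

lemma IsCarterSolution.differentiable {a Q M ω : ℝ} {m : ℤ} {lam : ℝ} {rs : ℝ → ℝ} {u : ℝ → ℂ}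
    (hu : IsCarterSolution a Q M ω m lam rs u) : Differentiable ℝ u :=
  hu.1.differentiable (by norm_num)

lemma IsCarterSolution.differentiable_deriv {a Q M ω : ℝ} {m : ℤ} {lam : ℝ} {rs : ℝ → ℝ}
    {u : ℝ → ℂ} (hu : IsCarterSolution a Q M ω m lam rs u) : Differentiable ℝ (deriv u) :=
  (contDiff_succ_iff_deriv.1 (show ContDiff ℝ (1 + 1) u from hu.1)).2.2.differentiable (by norm_num)

lemma IsCarterSolution.system {a Q M ω : ℝ} {m : ℤ} {lam : ℝ} {rs : ℝ → ℝ} {u : ℝ → ℂ}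
    (hs : Subextremal a Q M) (hrs : IsTortoise a Q M rs)
    (hu : IsCarterSolution a Q M ω m lam rs u) :
    CarterSystem a Q M ω m lam (fun x => u (rs (rPlus a Q M + x)))
      (fun x => deriv u (rs (rPlus a Q M + x))) := by
  constructor
  · intro x hx
    have := (hu.differentiable (rs (rPlus a Q M + x))).hasDerivAt.scomp x
      (hrs.hasDerivAt_shift hs hx)
    exact HasDerivAt.congr_deriv this (Complex.real_smul ..)
  · intro x hx
    have := (hu.differentiable_deriv (rs (rPlus a Q M + x))).hasDerivAt.scomp x
      (hrs.hasDerivAt_shift hs hx)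
    have e := hu.2 (rPlus a Q M + x) (by linarith)
    rw [eq_neg_of_add_eq_zero_left e, smul_neg] at this
    exact HasDerivAt.congr_deriv this (congrArg Neg.neg (Complex.real_smul ..))

/-- The unimodular factor relating the radial function to its profile. -/
def radialPhase (δ M ω c x : ℝ) : ℂ :=
  linPhase (-ω) x * logPhase (c / 2) x * logPhase (2 * M * ω - c / 2) (x + δ)

lemma norm_radialPhase (δ M ω c x : ℝ) : ‖radialPhase δ M ω c x‖ = 1 := by
  simp [radialPhase, norm_linPhase, norm_logPhase]

lemma hasDerivAt_radialPhase {δ : ℝ} (hδ : 0 < δ) (M ω c : ℝ) {x : ℝ} (hx : 0 < x) :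
    HasDerivAt (radialPhase δ M ω c)
      (-(Complex.I * (ω * x * (x + δ) - 2 * M * ω * x - c * δ / 2) / (x * (x + δ))
        * radialPhase δ M ω c x)) x := by
  have hxp : x + δ ≠ 0 := by positivity
  have h := ((hasDerivAt_linPhase (-ω) x).mul (hasDerivAt_logPhase (c / 2) hx.ne')).mul
    (hasDerivAt_logPhase_add (2 * M * ω - c / 2) δ hxp)
  have h1 : (x : ℂ) ≠ 0 := by exact_mod_cast hx.ne'
  have h2 : (x : ℂ) + δ ≠ 0 := by exact_mod_cast hxp
  refine h.congr_deriv ?_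
  simp only [radialPhase, Pi.mul_apply]
  push_cast
  field_simp
  ring

/-- `√(r² + a²)` at `r = r₊ + x`. -/
def areaRadius (a Q M x : ℝ) : ℝ := √((rPlus a Q M + x) ^ 2 + a ^ 2)

lemma areaRadius_sq (a Q M x : ℝ) :
    areaRadius a Q M x ^ 2 = (rPlus a Q M + x) ^ 2 + a ^ 2 := Real.sq_sqrt (by positivity)

lemma areaRadius_pos {a Q M : ℝ} (h : Subextremal a Q M) {x : ℝ} (hx : 0 ≤ x) :
    0 < areaRadius a Q M x := by
  have := rPlus_pos h
  exact Real.sqrt_pos.2 (by positivity)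

lemma hasDerivAt_areaRadius {a Q M : ℝ} (h : Subextremal a Q M) {x : ℝ} (hx : 0 ≤ x) :
    HasDerivAt (areaRadius a Q M) ((rPlus a Q M + x) / areaRadius a Q M x) x := by
  have hr := rPlus_pos h
  have hd : HasDerivAt (fun y => (rPlus a Q M + y) ^ 2 + a ^ 2) (2 * (rPlus a Q M + x)) x := by
    simpa using (((hasDerivAt_id x).const_add (rPlus a Q M)).pow 2).add_const (a ^ 2)
  refine (hd.sqrt (by positivity)).congr_deriv ?_
  rw [areaRadius]
  field_simp

/-- The profile of a solution of the Carter system. -/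
def profile (a Q M ω : ℝ) (m : ℤ) (v : ℝ → ℂ) (x : ℝ) : ℂ :=
  radialPhase (gap a Q M) M ω (horizonExponent a Q M ω m) x * (v x / areaRadius a Q M x)

/-- `Δ` times the derivative of the profile. -/
def profileFlux (a Q M ω : ℝ) (m : ℤ) (v y : ℝ → ℂ) (x : ℝ) : ℂ :=
  radialPhase (gap a Q M) M ω (horizonExponent a Q M ω m) x *
    (areaRadius a Q M x * (y x - ((x * (x + gap a Q M) * (rPlus a Q M + x)
        / ((rPlus a Q M + x) ^ 2 + a ^ 2) ^ 2 : ℝ) : ℂ) * v x)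
      - Complex.I * ((ω * x * (x + gap a Q M) - 2 * M * ω * x - horizonFreq a Q M ω m : ℝ) : ℂ)
        * (v x / areaRadius a Q M x))

lemma CarterSystem.hasDerivAt_profile {a Q M ω : ℝ} {m : ℤ} {lam : ℝ} {v y : ℝ → ℂ}
    (hs : Subextremal a Q M) (h : CarterSystem a Q M ω m lam v y) {x : ℝ} (hx : 0 < x) :
    HasDerivAt (profile a Q M ω m v)
      (profileFlux a Q M ω m v y x / (x * ((x + gap a Q M : ℝ) : ℂ))) x := by
  have hδ := gap_pos hs
  have hN := areaRadius_pos hs hx.le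
  have h1 : (x : ℂ) ≠ 0 := by exact_mod_cast hx.ne'
  have h2 : (x : ℂ) + gap a Q M ≠ 0 := by exact_mod_cast (by positivity : x + gap a Q M ≠ 0)
  have h3 : (areaRadius a Q M x : ℂ) ≠ 0 := by exact_mod_cast hN.ne'
  have hd := (hasDerivAt_radialPhase hδ M ω (horizonExponent a Q M ω m) hx).mul
    ((h.deriv_fst x hx).div (hasDerivAt_areaRadius hs hx.le).ofReal_comp h3)
  refine hd.congr_deriv ?_
  have hc : (horizonExponent a Q M ω m : ℂ) * gap a Q M / 2 = horizonFreq a Q M ω m := by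
    have : (gap a Q M : ℂ) ≠ 0 := by exact_mod_cast hδ.ne'
    rw [horizonExponent]; push_cast; field_simp
  rw [hc]
  simp only [profileFlux, Pi.div_apply, ← areaRadius_sq]
  push_cast
  field_simp
  ring

/-- The phase has logarithmic derivative -iT/Δ and so removes the T² of `potential_eq`; the division
by √(r² + a²) removes the last two terms of V. The remaining zeroth-order coefficient is affine in
x. -/
lemma CarterSystem.hasDerivAt_profileFlux {a Q M ω : ℝ} {m : ℤ} {lam : ℝ} {v y : ℝ → ℂ}
    (hs : Subextremal a Q M) (h : CarterSystem a Q M ω m lam v y) {x : ℝ} (hx : 0 < x) :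
    HasDerivAt (profileFlux a Q M ω m v y)
      (-(2 * Complex.I * (ω * x * (x + gap a Q M) - 2 * M * ω * x
          - horizonExponent a Q M ω m * gap a Q M / 2)
          * (profileFlux a Q M ω m v y x / (x * ((x + gap a Q M : ℝ) : ℂ))))
      - (2 * Complex.I * ω * x + 8 * M * ω ^ 2 * x + accessory a Q M ω m lam
          + Complex.I * ω * (gap a Q M - 2 * M)) * profile a Q M ω m v x) x := by
  have hδ := gap_pos hs
  have hr := rPlus_pos hs
  have hN := areaRadius_pos hs hx.le
  have h1 : (x : ℂ) ≠ 0 := by exact_mod_cast hx.ne'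
  have h2 : (x : ℂ) + gap a Q M ≠ 0 := by exact_mod_cast (by positivity : x + gap a Q M ≠ 0)
  have h3 : (areaRadius a Q M x : ℂ) ≠ 0 := by exact_mod_cast hN.ne'
  have hn : (rPlus a Q M + x) ^ 2 + a ^ 2 ≠ 0 := by positivity
  have dN := (hasDerivAt_areaRadius hs hx.le).ofReal_comp
  have dv := h.deriv_fst x hx
  have dy := h.deriv_snd x hx
  have dx := hasDerivAt_id x
  have dr : HasDerivAt (fun y : ℝ => (rPlus a Q M + y)) 1 x := by
    simpa using dx.const_add (rPlus a Q M)
  have dn : HasDerivAt (fun y : ℝ => ((rPlus a Q M + y) ^ 2 + a ^ 2) ^ 2)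
      (4 * ((rPlus a Q M + x) ^ 2 + a ^ 2) * (rPlus a Q M + x)) x := by
    refine (((dr.pow 2).add_const (a ^ 2)).pow 2).congr_deriv ?_
    simp only [Pi.pow_apply]; push_cast; ring
  have dq := (((dx.mul (dx.add_const (gap a Q M))).mul dr).div dn (pow_ne_zero 2 hn)).ofReal_comp
  have dT : HasDerivAt (fun y : ℝ => ((ω * y * (y + gap a Q M) - 2 * M * ω * y
      - horizonFreq a Q M ω m : ℝ) : ℂ)) ((ω * (2 * x + gap a Q M) - 2 * M * ω : ℝ) : ℂ) x := by
    refine HasDerivAt.ofReal_comp ?_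
    refine ((((dx.const_mul ω).mul (dx.add_const (gap a Q M))).sub
      (dx.const_mul (2 * M * ω))).sub_const (horizonFreq a Q M ω m)).congr_deriv ?_
    simp only [id]; ring
  have hd := (hasDerivAt_radialPhase hδ M ω (horizonExponent a Q M ω m) hx).mul
    ((dN.mul (dy.sub (dq.mul dv))).sub ((dT.const_mul Complex.I).mul (dv.div dN h3)))
  refine hd.congr_deriv ?_
  have hc : (horizonExponent a Q M ω m : ℂ) * gap a Q M / 2 = horizonFreq a Q M ω m := by
    have : (gap a Q M : ℂ) ≠ 0 := by exact_mod_cast hδ.ne'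
    rw [horizonExponent]; push_cast; field_simp
  have hV : ((ω ^ 2 - potential a Q M ω m lam (rPlus a Q M + x) : ℝ) : ℂ)
      = (x * (x + gap a Q M) * (accessory a Q M ω m lam + 8 * M * ω ^ 2 * x)
        - (Complex.I * (ω * x * (x + gap a Q M) - 2 * M * ω * x - horizonFreq a Q M ω m)) ^ 2
        - x * (x + gap a Q M) * (2 * (rPlus a Q M + x) ^ 2 + x * (x + gap a Q M)
            - 2 * M * (rPlus a Q M + x)) / areaRadius a Q M x ^ 2
        + 3 * (x * (x + gap a Q M)) ^ 2 * (rPlus a Q M + x) ^ 2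
            / (areaRadius a Q M x ^ 2) ^ 2) / (areaRadius a Q M x ^ 2) ^ 2 := by
    rw [mul_pow, Complex.I_sq, eq_div_iff (by positivity)]
    have := congrArg (fun t : ℝ => (t : ℂ)) (potential_eq hs ω m lam hx)
    simp only [← areaRadius_sq] at this
    push_cast at this ⊢
    linear_combination this
  rw [hV, hc]
  have hM : M = rPlus a Q M - gap a Q M / 2 := by rw [gap_eq]; ring
  simp only [profileFlux, profile, Pi.mul_apply, Pi.sub_apply, Pi.div_apply, id, ← areaRadius_sq]
  generalize radialPhase (gap a Q M) M ω (horizonExponent a Q M ω m) x = φ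
  generalize areaRadius a Q M x = N at h3 ⊢
  generalize accessory a Q M ω m lam = b
  generalize horizonFreq a Q M ω m = κ
  generalize v x = v₀
  generalize y x = y₀
  generalize gap a Q M = δ at hM h2 ⊢
  generalize rPlus a Q M = r at hM ⊢
  subst hM
  push_cast
  field_simp
  ring

/-! ### Uniform control near the horizon -/

/-- Mean value inequality on `(0, x]` for functions with a limit at `0`. -/
lemma norm_sub_limit_le {g g' : ℝ → ℂ} {g₀ : ℂ} {C x : ℝ} (hx : 0 < x)
    (hg : ∀ t, 0 < t → t ≤ x → HasDerivAt g (g' t) t) (hC : ∀ t, 0 < t → t ≤ x → ‖g' t‖ ≤ C)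
    (hlim : Tendsto g (𝓝[>] 0) (𝓝 g₀)) : ‖g x - g₀‖ ≤ C * x := by
  have hC0 : 0 ≤ C := (norm_nonneg _).trans (hC x hx le_rfl)
  refine le_of_tendsto ((tendsto_const_nhds.sub hlim).norm) ?_
  filter_upwards [Ioc_mem_nhdsGT hx] with e he
  have := norm_image_sub_le_of_norm_deriv_le_segment' (f := g) (a := e) (b := x)
    (fun t ht => (hg t (he.1.trans_le ht.1) ht.2).hasDerivWithinAt)
    (fun t ht => hC t (he.1.trans_le ht.1) ht.2.le) x ⟨he.2, le_rfl⟩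
  refine this.trans ?_
  gcongr
  linarith [he.1]

/-- A regular profile is nearly constant close to the horizon, uniformly in the frequencies. -/
lemma near_horizon {δ M ω c b κ x₀ : ℝ} {f f' : ℝ → ℂ} {f₀ : ℂ} (hδ : 0 < δ) (hx₀ : 0 < x₀)
    (hd : ∀ x, 0 < x → HasDerivAt f (f' x) x)
    (ho : ∀ x, 0 < x → HasDerivAt (fun y : ℝ => (y : ℂ) * ((y + δ : ℝ) : ℂ) * f' y)
      (-(2 * Complex.I * (ω * x * (x + δ) - 2 * M * ω * x - c * δ / 2) * f' x)
        - (2 * Complex.I * ω * x + 8 * M * ω ^ 2 * x + b + Complex.I * ω * (δ - 2 * M)) * f x) x)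
    (h0 : Tendsto (fun x : ℝ => (x : ℂ) * f' x) (𝓝[>] 0) (𝓝 0))
    (hlim : Tendsto f (𝓝[>] 0) (𝓝 f₀))
    (hκ : ∀ x, 0 < x → x ≤ x₀ →
      ‖(2 * Complex.I * ω * x + 8 * M * ω ^ 2 * x + b + Complex.I * ω * (δ - 2 * M) : ℂ)‖ ≤ κ)
    (hκx : κ * x₀ ≤ δ / 16) {x : ℝ} (hx : 0 < x) (hxx : x ≤ x₀) :
    ‖f x - f₀‖ ≤ ‖f₀‖ / 8 ∧ ‖f' x‖ ≤ 2 * κ / δ * ‖f₀‖ := by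
  have hκ0 : 0 ≤ κ := (norm_nonneg _).trans (hκ x₀ hx₀ le_rfl)
  -- Extended by its limit at 0, f attains its maximum modulus S on [0, x₀]; S is bounded a
  -- posteriori by absorption.
  have hcont : ContinuousOn (Function.update f 0 f₀) (Icc 0 x₀) := by
    intro t ht
    rcases ht.1.eq_or_lt with rfl | ht0
    · rw [continuousWithinAt_update_same]
      exact hlim.mono_left (nhdsWithin_mono _ fun t ht => lt_of_le_of_ne ht.1.1 (Ne.symm ht.2))
    · rw [continuousWithinAt_update_of_ne ht0.ne']
      exact (hd t ht0).continuousAt.continuousWithinAt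
  obtain ⟨t, ht, hmax⟩ := isCompact_Icc.exists_isMaxOn ⟨0, left_mem_Icc.2 hx₀.le⟩ hcont.norm
  set S := ‖Function.update f 0 f₀ t‖ with hS
  have hfS : ∀ x, 0 < x → x ≤ x₀ → ‖f x‖ ≤ S := by
    intro x hx hxx
    have : ‖Function.update f 0 f₀ x‖ ≤ S := hmax ⟨hx.le, hxx⟩
    rwa [Function.update_of_ne hx.ne'] at this
  have hS0 : 0 ≤ S := norm_nonneg _
  have hY : ∀ x, 0 < x → x ≤ x₀ → ‖f' x‖ ≤ κ * S / δ := by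
    intro x hx hxx
    have hp : 0 < x + δ := by positivity
    -- The unimodular weight removes the first-order term, so Y' is bounded by κS and Y vanishes at
    -- 0; dividing by x loses nothing.
    let Y : ℝ → ℂ := fun x => profileWeight δ M ω c x * ((x : ℂ) * ((x + δ : ℝ) : ℂ) * f' x)
    have hYd : ∀ t, 0 < t → t ≤ x → HasDerivAt Y (-(profileWeight δ M ω c t *
        ((2 * Complex.I * ω * t + 8 * M * ω ^ 2 * t + b + Complex.I * ω * (δ - 2 * M)) * f t))) t := by
      intro t ht _
      have h1 : (t : ℂ) ≠ 0 := by exact_mod_cast ht.ne'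
      have h2 : (t : ℂ) + δ ≠ 0 := by exact_mod_cast (by positivity : t + δ ≠ 0)
      refine ((hasDerivAt_profileWeight hδ M ω c ht).mul (ho t ht)).congr_deriv ?_
      push_cast
      field_simp
      ring
    have hYl : Tendsto Y (𝓝[>] 0) (𝓝 0) := by
      have hz : Tendsto (fun x : ℝ => ‖(x : ℂ) * f' x‖ * (x + δ)) (𝓝[>] 0) (𝓝 (‖(0 : ℂ)‖ * (0 + δ))) :=
        h0.norm.mul ((tendsto_nhdsWithin_of_tendsto_nhds tendsto_id).add_const δ)
      rw [norm_zero, zero_mul] at hz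
      refine squeeze_zero_norm' ?_ hz
      filter_upwards [self_mem_nhdsWithin] with t ht
      have ht' : 0 < t := ht
      simp only [Y]
      rw [norm_mul, norm_profileWeight, one_mul, mul_right_comm, norm_mul _ ((t + δ : ℝ) : ℂ),
        norm_ofReal_of_pos (by positivity)]
    have hb := norm_sub_limit_le hx hYd (C := κ * S) (fun t ht htx => by
      rw [norm_neg, norm_mul, norm_profileWeight, one_mul, norm_mul]
      exact mul_le_mul (hκ t ht (htx.trans hxx)) (hfS t ht (htx.trans hxx)) (norm_nonneg _) hκ0) hYl
    rw [sub_zero] at hb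
    simp only [Y] at hb
    rw [norm_mul, norm_profileWeight, one_mul, norm_mul, norm_mul, norm_ofReal_of_pos hx,
      norm_ofReal_of_pos hp] at hb
    rw [le_div_iff₀ hδ]
    have : x * (‖f' x‖ * (x + δ)) ≤ x * (κ * S) := by linarith
    have := le_of_mul_le_mul_left this hx
    nlinarith [norm_nonneg (f' x)]
  have hf : ∀ x, 0 < x → x ≤ x₀ → ‖f x - f₀‖ ≤ S / 16 := by
    intro x hx hxx
    refine (norm_sub_limit_le hx (fun t ht _ => hd t ht)
      (fun t ht htx => hY t ht (htx.trans hxx)) hlim).trans ?_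
    calc κ * S / δ * x ≤ κ * S / δ * x₀ := by gcongr
      _ = (κ * x₀) * (S / δ) := by ring
      _ ≤ δ / 16 * (S / δ) := by gcongr
      _ = S / 16 := by field_simp
  -- The smallness κx₀ ≤ δ/16 lets S/16 be absorbed, giving S ≤ 2|f₀|.
  have hS1 : S ≤ ‖f₀‖ + S / 16 := by
    rcases ht.1.eq_or_lt with h | ht0
    · have : S = ‖f₀‖ := by rw [hS, ← h, Function.update_self]
      linarith
    · have h1 : S = ‖f t‖ := by rw [hS, Function.update_of_ne ht0.ne']
      have h2 := hf t ht0 ht.2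
      have h3 := norm_sub_norm_le (f t) f₀
      linarith
  refine ⟨by linarith [hf x hx hxx], (hY x hx hxx).trans ?_⟩
  calc κ * S / δ ≤ κ * (2 * ‖f₀‖) / δ := by
        gcongr; linarith
    _ = _ := by ring

/-! ### The potential and the energy estimate away from the horizon -/

/-- Uniform bound for the potential. -/
def potentialBound (a Q M K : ℝ) : ℝ :=
  2 * |a| * K * K + a ^ 2 * K ^ 2 / rPlus a Q M ^ 2 + K + a ^ 2 * K ^ 2 + 6

-- V is O(r⁻²). With n = r² + a², the ratios Δ/n, (n-Δ)/n and r²/n lie in [0,1] and (2r²+Δ-2Mr)/n in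
-- [0,3]; only a²m²/n needs the lower bound n ≥ r₊².
set_option maxHeartbeats 800000 in
lemma abs_potential_mul_le {a Q M ω : ℝ} {m : ℤ} {lam K : ℝ} (hs : Subextremal a Q M)
    (hω : |ω| ≤ K) (hm : |(m : ℝ)| ≤ K) (hl : |lam| ≤ K) {x : ℝ} (hx : 0 < x) :
    |potential a Q M ω m lam (rPlus a Q M + x)| * ((rPlus a Q M + x) ^ 2 + a ^ 2)
      ≤ potentialBound a Q M K := by
  have hr := rPlus_pos hs
  have hδ := gap_pos hs
  have hM := mass_le_rPlus a Q M
  have hM0 := hs.1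
  have hK : 0 ≤ K := (abs_nonneg _).trans hω
  have hD := Delta_rPlus_add hs x
  have hD0 : 0 < Delta a Q M (rPlus a Q M + x) := by rw [hD]; positivity
  have hrx : 0 < rPlus a Q M + x := by positivity
  have hrr : rPlus a Q M ^ 2 ≤ (rPlus a Q M + x) ^ 2 + a ^ 2 := by nlinarith [sq_nonneg a]
  have hDn : Delta a Q M (rPlus a Q M + x) ≤ (rPlus a Q M + x) ^ 2 + a ^ 2 := by
    have h1 := Delta_rPlus hs
    simp only [Delta] at h1 ⊢
    nlinarith [sq_nonneg a, mul_pos hM0 hx]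
  have hMr : M ≤ rPlus a Q M + x := by linarith
  rw [potential]
  set r := rPlus a Q M + x with hrdef
  set D := Delta a Q M r with hDdef
  set n := r ^ 2 + a ^ 2 with hn
  have hn0 : 0 < n := by positivity
  have hrn : r ^ 2 ≤ n := by rw [hn]; nlinarith [sq_nonneg a]
  have e : ((2 * a * m * ω * (n - D) - a ^ 2 * (m : ℝ) ^ 2 + D * (lam + a ^ 2 * ω ^ 2)) / n ^ 2
      + D * (2 * r ^ 2 + D - 2 * M * r) / n ^ 3 - 3 * D ^ 2 * r ^ 2 / n ^ 4) * n
      = 2 * a * m * ω * ((n - D) / n) - a ^ 2 * (m : ℝ) ^ 2 / n + (D / n) * (lam + a ^ 2 * ω ^ 2)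
        + (D / n) * ((2 * r ^ 2 + D - 2 * M * r) / n) - 3 * (D / n) ^ 2 * (r ^ 2 / n) := by
    field_simp
  rw [← abs_of_pos hn0, ← abs_mul, abs_of_pos hn0, e]
  have t0 : 0 ≤ D / n := by positivity
  have t1 : D / n ≤ 1 := (div_le_one hn0).2 hDn
  have t2 : 0 ≤ (n - D) / n := div_nonneg (by linarith) hn0.le
  have t3 : (n - D) / n ≤ 1 := (div_le_one hn0).2 (by linarith)
  have t4 : 0 ≤ r ^ 2 / n := by positivity
  have t5 : r ^ 2 / n ≤ 1 := (div_le_one hn0).2 hrn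
  have t6 : 0 ≤ (2 * r ^ 2 + D - 2 * M * r) / n :=
    div_nonneg (by nlinarith) hn0.le
  have t7 : (2 * r ^ 2 + D - 2 * M * r) / n ≤ 3 := by
    rw [div_le_iff₀ hn0]; nlinarith [mul_pos hM0 hrx]
  have b1 : |2 * a * m * ω * ((n - D) / n)| ≤ 2 * |a| * K * K := by
    rw [abs_mul, abs_mul, abs_mul, abs_mul, abs_two, abs_of_nonneg t2]
    calc 2 * |a| * |(m : ℝ)| * |ω| * ((n - D) / n) ≤ 2 * |a| * K * K * 1 := by gcongr
      _ = _ := mul_one _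
  have b2 : |a ^ 2 * (m : ℝ) ^ 2 / n| ≤ a ^ 2 * K ^ 2 / rPlus a Q M ^ 2 := by
    rw [abs_of_nonneg (by positivity), ← sq_abs (m : ℝ)]
    gcongr
  have b3 : |(D / n) * (lam + a ^ 2 * ω ^ 2)| ≤ K + a ^ 2 * K ^ 2 := by
    rw [abs_mul, abs_of_nonneg t0]
    calc D / n * |lam + a ^ 2 * ω ^ 2| ≤ 1 * (|lam| + |a ^ 2 * ω ^ 2|) := by
          gcongr; exact abs_add_le _ _
      _ ≤ 1 * (K + a ^ 2 * K ^ 2) := by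
          rw [abs_of_nonneg (by positivity : 0 ≤ a ^ 2 * ω ^ 2), ← sq_abs ω]
          gcongr
      _ = _ := one_mul _
  have b4 : |(D / n) * ((2 * r ^ 2 + D - 2 * M * r) / n)| ≤ 3 := by
    rw [abs_of_nonneg (mul_nonneg t0 t6)]
    exact (mul_le_mul t1 t7 t6 zero_le_one).trans_eq (one_mul _)
  have b5 : |3 * (D / n) ^ 2 * (r ^ 2 / n)| ≤ 3 := by
    have h1 : (D / n) ^ 2 ≤ 1 := pow_le_one₀ t0 t1
    have h2 := mul_le_mul h1 t5 t4 zero_le_one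
    rw [abs_of_nonneg (by positivity), mul_assoc]
    linarith
  rw [potentialBound]
  have := abs_sub (2 * a * m * ω * ((n - D) / n) - a ^ 2 * (m : ℝ) ^ 2 / n + (D / n) * (lam + a ^ 2 * ω ^ 2)
        + (D / n) * ((2 * r ^ 2 + D - 2 * M * r) / n)) (3 * (D / n) ^ 2 * (r ^ 2 / n))
  have := abs_add_le (2 * a * m * ω * ((n - D) / n) - a ^ 2 * (m : ℝ) ^ 2 / n + (D / n) * (lam + a ^ 2 * ω ^ 2))
        ((D / n) * ((2 * r ^ 2 + D - 2 * M * r) / n))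
  have := abs_add_le (2 * a * m * ω * ((n - D) / n) - a ^ 2 * (m : ℝ) ^ 2 / n) ((D / n) * (lam + a ^ 2 * ω ^ 2))
  have := abs_sub (2 * a * m * ω * ((n - D) / n)) (a ^ 2 * (m : ℝ) ^ 2 / n)
  linarith

/-- In the variable x the potential is weighted by dr*/dr, which blows up at the horizon. From x₀
on, replacing x by x + δ costs the factor (x₀+δ)/x₀ and leaves an integrable bound. -/
lemma abs_potential_weight_le {a Q M ω : ℝ} {m : ℤ} {lam K : ℝ} (hs : Subextremal a Q M)
    (hω : |ω| ≤ K) (hm : |(m : ℝ)| ≤ K) (hl : |lam| ≤ K) {x₀ x : ℝ} (hx₀ : 0 < x₀) (hx : x₀ ≤ x) :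
    |((rPlus a Q M + x) ^ 2 + a ^ 2) / (x * (x + gap a Q M))
      * potential a Q M ω m lam (rPlus a Q M + x)|
      ≤ potentialBound a Q M K * ((x₀ + gap a Q M) / x₀) / (x + gap a Q M) ^ 2 := by
  have hδ := gap_pos hs
  have hx0 : 0 < x := hx₀.trans_le hx
  have hb := abs_potential_mul_le hs hω hm hl hx0
  have hn : 0 ≤ (rPlus a Q M + x) ^ 2 + a ^ 2 := by positivity
  rw [abs_mul, abs_of_nonneg (by positivity)]
  calc _ = |potential a Q M ω m lam (rPlus a Q M + x)| * ((rPlus a Q M + x) ^ 2 + a ^ 2)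
        * (1 / (x * (x + gap a Q M))) := by ring
    _ ≤ potentialBound a Q M K * ((x₀ + gap a Q M) / x₀ / (x + gap a Q M) ^ 2) := by
        refine mul_le_mul hb ?_ (by positivity) ((mul_nonneg (abs_nonneg _) hn).trans hb)
        rw [div_div, div_le_div_iff₀ (by positivity) (by positivity)]
        have : x₀ * (x + gap a Q M) ≤ (x₀ + gap a Q M) * x := by nlinarith
        nlinarith [mul_le_mul_of_nonneg_right this (by positivity : 0 ≤ x + gap a Q M)]
    _ = _ := by ring

/-- Energy estimate away from the horizon. -/
lemma CarterSystem.energy_le {a Q M ω : ℝ} {m : ℤ} {lam K : ℝ} {v y : ℝ → ℂ}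
    (hs : Subextremal a Q M) (h : CarterSystem a Q M ω m lam v y) (hω0 : ω ≠ 0)
    (hω : |ω| ≤ K) (hm : |(m : ℝ)| ≤ K) (hl : |lam| ≤ K) {x₀ x : ℝ} (hx₀ : 0 < x₀) (hx : x₀ ≤ x) :
    ‖y x‖ ^ 2 + ω ^ 2 * ‖v x‖ ^ 2 ≤ (‖y x₀‖ ^ 2 + ω ^ 2 * ‖v x₀‖ ^ 2)
      * Real.exp (potentialBound a Q M K * ((x₀ + gap a Q M) / x₀) * |ω|⁻¹ / (x₀ + gap a Q M)) := by
  have hδ := gap_pos hs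
  have hωp : 0 < |ω| := abs_pos.2 hω0
  set A := potentialBound a Q M K * ((x₀ + gap a Q M) / x₀) with hA
  have hA0 : 0 ≤ A := by
    have h1 := (abs_nonneg _).trans (abs_potential_weight_le hs hω hm hl hx₀ le_rfl)
    rw [← hA] at h1
    by_contra! hneg
    exact absurd h1 (not_le.2 (div_neg_of_neg_of_pos hneg (by positivity)))
  -- E is conserved when V = 0, so only the integrable weighted potential drives it.
  let E : ℝ → ℝ := fun x => ‖y x‖ ^ 2 + ω ^ 2 * ‖v x‖ ^ 2
  have hE : ∀ x, 0 < x → HasDerivAt E (2 * (((rPlus a Q M + x) ^ 2 + a ^ 2) / (x * (x + gap a Q M))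
      * potential a Q M ω m lam (rPlus a Q M + x)) * inner ℝ (y x) (v x)) x := by
    intro x hx
    have h1 := (h.deriv_snd x hx).norm_sq
    have h2 := (h.deriv_fst x hx).norm_sq.const_mul (ω ^ 2)
    refine (h1.add h2).congr_deriv ?_
    rw [← Complex.real_smul, ← Complex.real_smul, ← Complex.real_smul, inner_neg_right,
      inner_smul_right, inner_smul_right, inner_smul_right, real_inner_comm (y x) (v x)]
    ring
  have hE' : ∀ x, x₀ ≤ x → |2 * (((rPlus a Q M + x) ^ 2 + a ^ 2) / (x * (x + gap a Q M))
      * potential a Q M ω m lam (rPlus a Q M + x)) * inner ℝ (y x) (v x)|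
      ≤ A * |ω|⁻¹ / (x + gap a Q M) ^ 2 * E x := by
    intro x hx
    have hx0 : 0 < x := hx₀.trans_le hx
    have h1 := abs_potential_weight_le hs hω hm hl hx₀ hx
    rw [abs_mul, abs_mul, abs_two]
    have h2 : 2 * |inner ℝ (y x) (v x)| ≤ |ω|⁻¹ * E x := by
      have h3 := abs_real_inner_le_norm (y x) (v x)
      have h4 : 2 * (‖y x‖ * ‖v x‖) * |ω| ≤ E x := by
        simp only [E]
        rw [← sq_abs ω]
        nlinarith [sq_nonneg (‖y x‖ - |ω| * ‖v x‖)]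
      rw [inv_mul_eq_div, le_div_iff₀ hωp]
      nlinarith
    calc _ = |((rPlus a Q M + x) ^ 2 + a ^ 2) / (x * (x + gap a Q M))
          * potential a Q M ω m lam (rPlus a Q M + x)| * (2 * |inner ℝ (y x) (v x)|) := by ring
      _ ≤ A / (x + gap a Q M) ^ 2 * (|ω|⁻¹ * E x) :=
          mul_le_mul h1 h2 (by positivity) (by positivity)
      _ = _ := by ring
  -- Explicit Grönwall factor: the exponent is the integral of the growth rate from x to infinity,
  -- so EX is nonincreasing and X ≥ 1.
  let X : ℝ → ℝ := fun x => Real.exp (A * |ω|⁻¹ / (x + gap a Q M))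
  have hX : ∀ x, 0 < x → HasDerivAt X (X x * (-(A * |ω|⁻¹ / (x + gap a Q M) ^ 2))) x := by
    intro x hx
    have hp : x + gap a Q M ≠ 0 := by positivity
    have := ((hasDerivAt_const x (A * |ω|⁻¹)).div ((hasDerivAt_id x).add_const (gap a Q M)) hp).exp
    refine this.congr_deriv ?_
    simp only [X, Pi.div_apply, id]
    ring
  have hEX : ∀ x, 0 < x → HasDerivAt (fun x => E x * X x) _ x := fun x hx => (hE x hx).mul (hX x hx)
  have hanti : AntitoneOn (fun x => E x * X x) (Ici x₀) := by
    refine antitoneOn_of_deriv_nonpos (convex_Ici x₀)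
      (fun x hx => (hEX x (hx₀.trans_le hx)).continuousAt.continuousWithinAt)
      (fun x hx => ?_) (fun x hx => ?_)
    · rw [interior_Ici] at hx
      exact (hEX x (hx₀.trans hx)).differentiableAt.differentiableWithinAt
    · rw [interior_Ici] at hx
      rw [(hEX x (hx₀.trans hx)).deriv]
      have h1 := (le_abs_self _).trans (hE' x (le_of_lt hx))
      have hXp : 0 < X x := Real.exp_pos _
      nlinarith
  have h1 : E x * X x ≤ E x₀ * X x₀ := hanti (mem_Ici.2 le_rfl) hx hx
  have h2 : 1 ≤ X x := Real.one_le_exp (by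
    have : 0 < x := hx₀.trans_le hx
    positivity)
  have h3 : 0 ≤ E x := by positivity
  calc E x ≤ E x * X x := le_mul_of_one_le_right h3 h2
    _ ≤ _ := h1

/-! ### The tortoise coordinate and constancy of the Wronskian -/

lemma one_le_weight {a Q M : ℝ} (hs : Subextremal a Q M) {x : ℝ} (hx : 0 < x) :
    1 ≤ ((rPlus a Q M + x) ^ 2 + a ^ 2) / (x * (x + gap a Q M)) := by
  have hδ := gap_pos hs
  have hr := rPlus_pos hs
  have hg := gap_le_rPlus hs
  rw [le_div_iff₀ (by positivity)]
  nlinarith [sq_nonneg a, mul_pos hr hx]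

/-- The range of the tortoise coordinate is all of `ℝ`. -/
lemma IsTortoise.exists_eq {a Q M : ℝ} {rs : ℝ → ℝ} (hs : Subextremal a Q M)
    (hrs : IsTortoise a Q M rs) (t : ℝ) : ∃ x, 0 < x ∧ rs (rPlus a Q M + x) = t := by
  have hδ := gap_pos hs
  have hr := rPlus_pos hs
  set ρ : ℝ → ℝ := fun x => rs (rPlus a Q M + x) with hρ
  have hd : ∀ x, 0 < x → HasDerivAt ρ _ x := fun x hx => hrs.hasDerivAt_shift hs hx
  have hup : ∀ x, 1 ≤ x → ρ 1 - 1 ≤ ρ x - x := by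
    intro x hx
    have hmono : MonotoneOn (fun x => ρ x - x) (Ici 1) := by
      have hd' : ∀ x, 0 < x → HasDerivAt (fun x => ρ x - x) _ x :=
        fun x hx => (hd x hx).sub (hasDerivAt_id x)
      refine monotoneOn_of_deriv_nonneg (convex_Ici 1)
        (fun x hx => (hd' x (zero_lt_one.trans_le hx)).continuousAt.continuousWithinAt)
        (fun x hx => ?_) (fun x hx => ?_)
      · rw [interior_Ici] at hx
        exact (hd' x (zero_lt_one.trans hx)).differentiableAt.differentiableWithinAt
      · rw [interior_Ici] at hx
        rw [(hd' x (zero_lt_one.trans hx)).deriv]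
        linarith [one_le_weight hs (zero_lt_one.trans hx)]
    exact hmono (mem_Ici.2 le_rfl) hx hx
  -- For x ≤ 1 one has dr*/dr ≥ k/x, so r* falls at least like k log x at the horizon.
  set k := rPlus a Q M ^ 2 / (1 + gap a Q M) with hk
  have hk0 : 0 < k := by positivity
  have hlow : ∀ x, 0 < x → x ≤ 1 → ρ x - k * Real.log x ≤ ρ 1 - k * Real.log 1 := by
    intro x hx hx1
    have hd' : ∀ x, 0 < x → HasDerivAt (fun x => ρ x - k * Real.log x) _ x :=
      fun x hx => (hd x hx).sub ((Real.hasDerivAt_log hx.ne').const_mul k)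
    have hmono : MonotoneOn (fun x => ρ x - k * Real.log x) (Icc x 1) := by
      refine monotoneOn_of_deriv_nonneg (convex_Icc x 1)
        (fun y hy => (hd' y (hx.trans_le hy.1)).continuousAt.continuousWithinAt)
        (fun y hy => ?_) (fun y hy => ?_)
      · rw [interior_Icc] at hy
        exact (hd' y (hx.trans hy.1)).differentiableAt.differentiableWithinAt
      · rw [interior_Icc] at hy
        have hy0 : 0 < y := hx.trans hy.1
        rw [(hd' y hy0).deriv, sub_nonneg, hk, div_mul_eq_mul_div, ← div_eq_mul_inv, div_div,
          mul_comm y]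
        have hle : (y + gap a Q M) ≤ 1 + gap a Q M := by linarith [hy.2]
        rw [mul_comm y (y + gap a Q M)] 
        gcongr ?_ / (?_ * _)
        nlinarith [sq_nonneg a, mul_pos hr hy0]
    exact hmono ⟨le_rfl, hx1⟩ ⟨hx1, le_rfl⟩ hx1
  obtain ⟨x₁, hx₁0, hx₁⟩ : ∃ x, 0 < x ∧ ρ x ≤ t := by
    refine ⟨Real.exp (min 0 ((t - ρ 1) / k)), Real.exp_pos _, ?_⟩
    have h1 := hlow (Real.exp (min 0 ((t - ρ 1) / k))) (Real.exp_pos _)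
      (Real.exp_le_one_iff.2 (min_le_left _ _))
    rw [Real.log_exp, Real.log_one, mul_zero, sub_zero] at h1
    have h2 : k * min 0 ((t - ρ 1) / k) ≤ k * ((t - ρ 1) / k) := by
      gcongr; exact min_le_right _ _
    rw [mul_div_cancel₀ _ hk0.ne'] at h2
    linarith
  obtain ⟨x₂, hx₂0, hx₂⟩ : ∃ x, 0 < x ∧ t ≤ ρ x := by
    refine ⟨max 1 (t - ρ 1 + 1), zero_lt_one.trans_le (le_max_left _ _), ?_⟩
    linarith [hup _ (le_max_left 1 (t - ρ 1 + 1)), le_max_right 1 (t - ρ 1 + 1)]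
  have hc : ContinuousOn ρ (Ioi 0) := fun x hx => (hd x hx).continuousAt.continuousWithinAt
  obtain ⟨x, hx, hxt⟩ := isPreconnected_Ioi.intermediate_value (mem_Ioi.2 hx₁0) (mem_Ioi.2 hx₂0) hc
    ⟨hx₁, hx₂⟩
  exact ⟨x, hx, hxt⟩

/-- The equation is given only at points `rs r`; surjectivity of the tortoise coordinate makes the
derivative vanish at every real t. -/
lemma wronskian_eq {a Q M ω : ℝ} {m : ℤ} {lam : ℝ} {rs : ℝ → ℝ} {u₁ u₂ : ℝ → ℂ}
    (hs : Subextremal a Q M) (hrs : IsTortoise a Q M rs)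
    (h₁ : IsCarterSolution a Q M ω m lam rs u₁) (h₂ : IsCarterSolution a Q M ω m lam rs u₂)
    (x y : ℝ) : wronskian u₁ u₂ x = wronskian u₁ u₂ y := by
  have hd : ∀ t, HasDerivAt (wronskian u₁ u₂) 0 t := by
    intro t
    obtain ⟨x, hx, rfl⟩ := hrs.exists_eq hs t
    have e1 := eq_neg_of_add_eq_zero_left (h₁.2 (rPlus a Q M + x) (by linarith))
    have e2 := eq_neg_of_add_eq_zero_left (h₂.2 (rPlus a Q M + x) (by linarith))
    have hd := ((h₁.differentiable (rs (rPlus a Q M + x))).hasDerivAt.mul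
      (h₂.differentiable_deriv (rs (rPlus a Q M + x))).hasDerivAt).sub
      ((h₁.differentiable_deriv (rs (rPlus a Q M + x))).hasDerivAt.mul
      (h₂.differentiable (rs (rPlus a Q M + x))).hasDerivAt)
    refine hd.congr_deriv ?_
    rw [e1, e2]
    ring
  exact is_const_of_deriv_eq_zero (fun t => (hd t).differentiableAt) (fun t => (hd t).deriv) x y

/-! ### The radiation condition for the outgoing solution -/

/-- If a function and its derivative both converge at infinity, the derivative tends to zero. -/
lemma deriv_limit_eq_zero {g g' : ℝ → ℂ} {c d : ℂ} (hg : ∀ x, 0 < x → HasDerivAt g (g' x) x)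
    (hc : Tendsto g atTop (𝓝 c)) (hd : Tendsto g' atTop (𝓝 d)) : d = 0 := by
  rw [← norm_le_zero_iff]
  refine le_of_forall_pos_le_add fun e he => ?_
  rw [zero_add]
  -- Unit increments of g tend to 0, yet are eventually within e of d.
  have h1 : Tendsto (fun x => ‖g (x + 1) - g x - d‖) atTop (𝓝 ‖c - c - d‖) :=
    (((hc.comp (tendsto_atTop_add_const_right _ 1 tendsto_id)).sub hc).sub tendsto_const_nhds).norm
  rw [sub_self, zero_sub, norm_neg] at h1
  refine le_of_tendsto h1 ?_
  obtain ⟨X, hX⟩ := eventually_atTop.1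
    ((hd.sub_const d).norm.eventually (ge_mem_nhds (show ‖d - d‖ < e by simpa using he)))
  filter_upwards [eventually_ge_atTop X, eventually_gt_atTop 0] with x hx hx0
  have hder : ∀ t ∈ Icc x (x + 1), HasDerivWithinAt (fun t => g t - t * d) (g' t - d) (Icc x (x + 1)) t := by
    intro t ht
    have := (hg t (hx0.trans_le ht.1)).sub ((hasDerivAt_ofReal t).mul_const d)
    rw [one_mul] at this
    exact this.hasDerivWithinAt
  have := norm_image_sub_le_of_norm_deriv_le_segment' hder
    (fun t ht => hX t (hx.trans ht.1)) (x + 1) ⟨by linarith, le_rfl⟩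
  simp only [add_sub_cancel_left, mul_one] at this
  refine le_trans (le_of_eq ?_) this
  congr 1
  push_cast
  ring

lemma tendsto_weight {a Q M : ℝ} (hs : Subextremal a Q M) :
    Tendsto (fun x : ℝ => ((rPlus a Q M + x) ^ 2 + a ^ 2) / (x * (x + gap a Q M))) atTop (𝓝 1) := by
  have hδ := gap_pos hs
  have e : ∀ᶠ x : ℝ in atTop, (1 + rPlus a Q M * x⁻¹) ^ 2 / (1 + gap a Q M * x⁻¹)
      + a ^ 2 * x⁻¹ * x⁻¹ / (1 + gap a Q M * x⁻¹)
      = ((rPlus a Q M + x) ^ 2 + a ^ 2) / (x * (x + gap a Q M)) := by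
    filter_upwards [eventually_gt_atTop 0] with x hx
    have : x + gap a Q M ≠ 0 := by positivity
    field_simp
    ring
  refine Tendsto.congr' e ?_
  have hi : Tendsto (fun x : ℝ => x⁻¹) atTop (𝓝 0) := tendsto_inv_atTop_zero
  have h1 := ((hi.const_mul (rPlus a Q M)).const_add 1).pow 2
  have h2 := (hi.const_mul (gap a Q M)).const_add 1
  have h3 := ((hi.const_mul (a ^ 2)).mul hi)
  have := (h1.div h2 (by norm_num)).add (h3.div h2 (by norm_num))
  simpa using this

/-- An outgoing solution satisfies the radiation condition. -/
lemma IsOut.radiation {a Q M ω : ℝ} {m : ℤ} {lam : ℝ} {rs : ℝ → ℝ} {u : ℝ → ℂ}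
    (hs : Subextremal a Q M) (hrs : IsTortoise a Q M rs) (hu : IsOut a Q M ω m lam rs u) :
    Tendsto (fun x => ‖u (rs (rPlus a Q M + x))‖) atTop (𝓝 1) ∧
    Tendsto (fun x => ‖deriv u (rs (rPlus a Q M + x)) - Complex.I * ω * u (rs (rPlus a Q M + x))‖)
      atTop (𝓝 0) := by
  have hδ := gap_pos hs
  have hshift : Tendsto (fun x : ℝ => rPlus a Q M + x) atTop atTop :=
    tendsto_atTop_add_const_left _ _ tendsto_id
  set ρ : ℝ → ℝ := fun x => rs (rPlus a Q M + x) with hρ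
  set v : ℝ → ℂ := fun x => u (ρ x) with hv
  set y : ℝ → ℂ := fun x => deriv u (ρ x) with hy
  have hsys : CarterSystem a Q M ω m lam v y := hu.solution.system hs hrs
  set e : ℝ → ℂ := fun x => Complex.exp (Complex.I * ((-(ω * ρ x) : ℝ) : ℂ)) with he
  have hen : ∀ x, ‖e x‖ = 1 := fun x => Complex.norm_exp_I_mul_ofReal _
  have hee : ∀ x, e x = Complex.exp (-(Complex.I * ω * ρ x)) := fun x => by
    simp only [he]; congr 1; push_cast; ring
  have hed : ∀ x, 0 < x → HasDerivAt e
      (-(Complex.I * ω * ((((rPlus a Q M + x) ^ 2 + a ^ 2) / (x * (x + gap a Q M)) : ℝ) : ℂ) * e x)) x := by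
    intro x hx
    have := ((((hrs.hasDerivAt_shift hs hx).const_mul ω).neg).ofReal_comp.const_mul Complex.I).cexp
    refine this.congr_deriv ?_
    simp only [he, hρ, Pi.neg_apply]
    push_cast
    ring
  obtain ⟨C, hC⟩ := hu.asymp
  have hG : Tendsto (fun x => v x * e x) atTop (𝓝 (C 0)) := by
    have h0 := hC 0
    simp only [zero_add, Finset.range_one, Finset.sum_singleton, pow_zero, inv_one, mul_one,
      pow_one] at h0
    have h1 : Tendsto (fun r : ℝ => u (rs r) - Complex.exp (Complex.I * ω * rs r) * C 0) atTop (𝓝 0) :=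
      h0.trans_tendsto tendsto_inv_atTop_zero
    have h2 := (h1.comp hshift).norm
    rw [norm_zero] at h2
    rw [tendsto_iff_norm_sub_tendsto_zero]
    refine h2.congr fun x => ?_
    have hprod : Complex.exp (Complex.I * ω * ρ x) * e x = 1 := by
      rw [hee, ← Complex.exp_add, add_neg_cancel, Complex.exp_zero]
    calc ‖u (ρ x) - Complex.exp (Complex.I * ω * ρ x) * C 0‖
        = ‖(u (ρ x) - Complex.exp (Complex.I * ω * ρ x) * C 0) * e x‖ := by
          rw [norm_mul, hen, mul_one]
      _ = ‖v x * e x - C 0‖ := by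
          congr 1
          linear_combination (-C 0) * hprod
  have hnv : ∀ x, ‖v x * e x‖ = ‖v x‖ := fun x => by rw [norm_mul, hen, mul_one]
  have hn1 : Tendsto (fun x => ‖v x‖) atTop (𝓝 1) := by
    have h1 := (hu.normalized.comp hshift).sqrt
    rw [Real.sqrt_one] at h1
    refine h1.congr fun x => ?_
    simp only [Function.comp_apply]
    rw [Real.sqrt_sq (norm_nonneg _)]
    rw [← hnv x, hee x]
  refine ⟨hn1, ?_⟩
  -- In this combination the free terms cancel: its derivative contains only the weighted potential
  -- times a bounded function, so S converges.
  set S : ℝ → ℂ := fun x => (y x + Complex.I * ω * v x) * e x with hS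
  let S' : ℝ → ℂ := fun x => ((((rPlus a Q M + x) ^ 2 + a ^ 2) / (x * (x + gap a Q M))
      * potential a Q M ω m lam (rPlus a Q M + x) : ℝ) : ℂ) * (v x * e x)
  have hSd : ∀ x, 0 < x → HasDerivAt S (S' x) x := by
    intro x hx
    refine (((hsys.deriv_snd x hx).add ((hsys.deriv_fst x hx).const_mul (Complex.I * ω))).mul
      (hed x hx)).congr_deriv ?_
    simp only [S', Pi.add_apply]
    push_cast
    linear_combination (-((((rPlus a Q M : ℂ) + x) ^ 2 + a ^ 2) / (x * (x + gap a Q M))) * ω ^ 2 * v x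
      * e x) * Complex.I_sq
  obtain ⟨X, hX⟩ := eventually_atTop.1 ((hn1.eventually (ge_mem_nhds (show (1 : ℝ) < 2 by norm_num))).and
    (eventually_gt_atTop 0))
  have hX0 : 0 < X := (hX X le_rfl).2
  set K := |ω| + |(m : ℝ)| + |lam| with hK
  have hSint : IntegrableOn S' (Ioi X) := by
    refine Integrable.mono' ((integrableOn_inv_sq hδ (potentialBound a Q M K * ((X + gap a Q M) / X)
      * 2)).mono_set (Ioi_subset_Ioi hX0.le)) ?_ ?_
    · refine (aestronglyMeasurable_deriv S _).congr ?_
      exact (ae_restrict_iff' measurableSet_Ioi).2 (Eventually.of_forall fun x hx =>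
        (hSd x (hX0.trans hx)).deriv)
    · refine (ae_restrict_iff' measurableSet_Ioi).2 (Eventually.of_forall fun x hx => ?_)
      have hxX : X ≤ x := le_of_lt hx
      have h1 := abs_potential_weight_le (ω := ω) (m := m) (lam := lam) (K := K) hs
        (by rw [hK]; linarith [abs_nonneg (m : ℝ), abs_nonneg lam])
        (by rw [hK]; linarith [abs_nonneg ω, abs_nonneg lam])
        (by rw [hK]; linarith [abs_nonneg (m : ℝ), abs_nonneg ω]) hX0 hxX
      simp only [S']
      rw [norm_mul, hnv, Complex.norm_real, Real.norm_eq_abs]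
      calc _ ≤ _ := mul_le_mul h1 (hX x hxX).1 (norm_nonneg _) ((abs_nonneg _).trans h1)
        _ = _ := by ring
  have hSlim := tendsto_limUnder_of_hasDerivAt_of_integrableOn_Ioi
    (fun x hx => hSd x (hX0.trans hx)) hSint
  set L := limUnder atTop S
  have hdiff : Tendsto (fun x => (y x - Complex.I * ω * v x) * e x) atTop
      (𝓝 (L - 2 * Complex.I * ω * C 0)) := by
    refine (hSlim.sub (hG.const_mul (2 * Complex.I * ω))).congr fun x => ?_
    simp only [hS]; ring
  have hG' : ∀ x, 0 < x → HasDerivAt (fun x => v x * e x)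
      (((((rPlus a Q M + x) ^ 2 + a ^ 2) / (x * (x + gap a Q M)) : ℝ) : ℂ)
        * ((y x - Complex.I * ω * v x) * e x)) x := by
    intro x hx
    refine ((hsys.deriv_fst x hx).mul (hed x hx)).congr_deriv ?_
    ring
  have hw : Tendsto (fun x : ℝ => ((((rPlus a Q M + x) ^ 2 + a ^ 2) / (x * (x + gap a Q M)) : ℝ) : ℂ))
      atTop (𝓝 ((1 : ℝ) : ℂ)) := (Complex.continuous_ofReal.tendsto _).comp (tendsto_weight hs)
  -- Now (v' - iωv)e^(-iωr*), prime in r*, converges too. Up to a weight tending to 1 it is the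
  -- x-derivative of v e^(-iωr*), which converges, so its limit is 0.
  have hzero := deriv_limit_eq_zero hG' hG (hw.mul hdiff)
  rw [Complex.ofReal_one, one_mul] at hzero
  rw [hzero] at hdiff
  have := hdiff.norm
  rw [norm_zero] at this
  refine this.congr fun x => ?_
  rw [norm_mul, hen, mul_one]

/-! ### Regularity of the profile at the horizon -/

lemma cpow_neg_xi {a Q M : ℝ} (hs : Subextremal a Q M) (ω : ℝ) (m : ℤ) {x : ℝ} (hx : 0 < x) :
    (x : ℂ) ^ (-xi a Q M ω m) = logPhase (horizonExponent a Q M ω m / 2) x := by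
  have h1 : (x : ℂ) ≠ 0 := by exact_mod_cast hx.ne'
  rw [Complex.cpow_def_of_ne_zero h1, logPhase, xi_eq hs, ← Complex.ofReal_log hx.le]
  congr 1
  push_cast
  ring

/-- The profile of an ingoing solution is regular at the horizon. -/
lemma IsHor.profile_regular {a Q M ω : ℝ} {m : ℤ} {lam : ℝ} {rs : ℝ → ℝ} {u : ℝ → ℂ}
    (hs : Subextremal a Q M) (hrs : IsTortoise a Q M rs) (hu : IsHor a Q M ω m lam rs u) :
    ∃ f₀ : ℂ, ‖f₀‖ = 1 / areaRadius a Q M 0 ∧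
      Tendsto (profile a Q M ω m (fun x => u (rs (rPlus a Q M + x)))) (𝓝[>] 0) (𝓝 f₀) ∧
      Tendsto (fun x : ℝ => (x : ℂ) * (profileFlux a Q M ω m (fun x => u (rs (rPlus a Q M + x)))
        (fun x => deriv u (rs (rPlus a Q M + x))) x / (x * ((x + gap a Q M : ℝ) : ℂ))))
        (𝓝[>] 0) (𝓝 0) := by
  have hδ := gap_pos hs
  obtain ⟨h, hh, hhu⟩ := hu.asymp
  set c := horizonExponent a Q M ω m with hc
  set v : ℝ → ℂ := fun x => u (rs (rPlus a Q M + x)) with hv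
  -- The factor x^(ic/2) of `radialPhase` is exactly (r-r₊)^(-ξ); what is left, g, is differentiable
  -- across x = 0, and the profile is g times the regular function h.
  let g : ℝ → ℂ := fun x => linPhase (-ω) x * logPhase (2 * M * ω - c / 2) (x + gap a Q M)
    / areaRadius a Q M x
  let k : ℝ → ℂ := fun x => -(Complex.I * ω)
    + Complex.I * ((2 * M * ω - c / 2 : ℝ) : ℂ) / ((x + gap a Q M : ℝ) : ℂ)
    - (((rPlus a Q M + x) / areaRadius a Q M x : ℝ) : ℂ) / areaRadius a Q M x
  have hgd : ∀ x, 0 ≤ x → HasDerivAt g (k x * g x) x := by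
    intro x hx
    have hp : x + gap a Q M ≠ 0 := by positivity
    have h3 : (areaRadius a Q M x : ℂ) ≠ 0 := by exact_mod_cast (areaRadius_pos hs hx).ne'
    refine (((hasDerivAt_linPhase (-ω) x).mul (hasDerivAt_logPhase_add (2 * M * ω - c / 2)
      (gap a Q M) hp)).div (hasDerivAt_areaRadius hs hx).ofReal_comp h3).congr_deriv ?_
    simp only [k, g, Pi.mul_apply]
    have h2 : (x : ℂ) + gap a Q M ≠ 0 := by exact_mod_cast hp
    push_cast
    field_simp
  have hgn : ∀ x, 0 ≤ x → ‖g x‖ = 1 / areaRadius a Q M x := by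
    intro x hx
    simp only [g]
    rw [norm_div, norm_mul, norm_linPhase, norm_logPhase, one_mul,
      norm_ofReal_of_pos (areaRadius_pos hs hx)]
  have hprof : ∀ x, 0 < x → profile a Q M ω m v x = g x * h (rPlus a Q M + x) := by
    intro x hx
    rw [hhu _ (by linarith), add_sub_cancel_left, cpow_neg_xi hs ω m hx]
    simp only [profile, radialPhase, g, hv]
    ring
  have hshift : Tendsto (fun x : ℝ => rPlus a Q M + x) (𝓝[>] 0) (𝓝[>] (rPlus a Q M)) := by
    refine tendsto_nhdsWithin_iff.2 ⟨?_, ?_⟩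
    · have : Tendsto (fun x : ℝ => rPlus a Q M + x) (𝓝 0) (𝓝 (rPlus a Q M + 0)) :=
        tendsto_id.const_add _
      rw [add_zero] at this
      exact tendsto_nhdsWithin_of_tendsto_nhds this
    · filter_upwards [self_mem_nhdsWithin] with x hx
      have : 0 < x := hx
      exact mem_Ioi.2 (by linarith)
  have hmem : rPlus a Q M ∈ Ici (rPlus a Q M) := mem_Ici.2 le_rfl
  have hhlim : Tendsto (fun x => h (rPlus a Q M + x)) (𝓝[>] 0) (𝓝 (h (rPlus a Q M))) :=
    (((hh.continuousOn _ hmem).mono Ioi_subset_Ici_self).tendsto).comp hshift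
  have hglim : Tendsto g (𝓝[>] 0) (𝓝 (g 0)) :=
    tendsto_nhdsWithin_of_tendsto_nhds (hgd 0 le_rfl).continuousAt.tendsto
  have hh1 : ‖h (rPlus a Q M)‖ = 1 := by
    have h1 : Tendsto (fun x => ‖h (rPlus a Q M + x)‖ ^ 2) (𝓝[>] 0) (𝓝 1) := by
      refine (hu.normalized.comp hshift).congr' ?_
      filter_upwards [self_mem_nhdsWithin] with x hx
      have hx' : 0 < x := hx
      simp only [Function.comp_apply]
      rw [hhu _ (by linarith)]
    have h2 := tendsto_nhds_unique h1 (hhlim.norm.pow 2)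
    nlinarith [norm_nonneg (h (rPlus a Q M))]
  refine ⟨g 0 * h (rPlus a Q M), by rw [norm_mul, hgn 0 le_rfl, hh1, mul_one], ?_, ?_⟩
  · refine (hglim.mul hhlim).congr' ?_
    filter_upwards [self_mem_nhdsWithin] with x hx using (hprof x hx).symm
  -- Since h is C¹ up to the horizon, f' has a finite limit there and x f' tends to 0.
  · set h' : ℝ → ℂ := derivWithin h (Ici (rPlus a Q M)) with hh'
    have hh'c : ContinuousOn h' (Ici (rPlus a Q M)) :=
      hh.continuousOn_derivWithin (uniqueDiffOn_Ici _) (by exact_mod_cast le_top)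
    have hh'lim : Tendsto (fun x => h' (rPlus a Q M + x)) (𝓝[>] 0) (𝓝 (h' (rPlus a Q M))) :=
      (((hh'c _ hmem).mono Ioi_subset_Ici_self).tendsto).comp hshift
    have hklim : Tendsto k (𝓝[>] 0) (𝓝 (k 0)) := by
      refine tendsto_nhdsWithin_of_tendsto_nhds (ContinuousAt.tendsto ?_)
      have hN : (areaRadius a Q M 0 : ℂ) ≠ 0 := by exact_mod_cast (areaRadius_pos hs le_rfl).ne'
      have hNc := (hasDerivAt_areaRadius hs le_rfl).continuousAt
      have hNc' : ContinuousAt (fun x => (areaRadius a Q M x : ℂ)) 0 :=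
        Complex.continuous_ofReal.continuousAt.comp hNc
      have hδ' : (((0 + gap a Q M : ℝ)) : ℂ) ≠ 0 := by
        rw [zero_add]; exact_mod_cast hδ.ne'
      refine ContinuousAt.sub (ContinuousAt.add continuousAt_const
        (continuousAt_const.div (by fun_prop) hδ')) (ContinuousAt.div ?_ hNc' hN)
      exact Complex.continuous_ofReal.continuousAt.comp
        (ContinuousAt.div (by fun_prop) hNc (areaRadius_pos hs le_rfl).ne')
    have hx0 : Tendsto (fun x : ℝ => (x : ℂ)) (𝓝[>] 0) (𝓝 ((0 : ℝ) : ℂ)) :=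
      tendsto_nhdsWithin_of_tendsto_nhds (Complex.continuous_ofReal.tendsto 0)
    have hlim := hx0.mul (((hklim.mul hglim).mul hhlim).add (hglim.mul hh'lim))
    rw [Complex.ofReal_zero, zero_mul] at hlim
    refine hlim.congr' ?_
    filter_upwards [self_mem_nhdsWithin] with x hx
    have hx' : 0 < x := hx
    congr 1
    have hdh : HasDerivAt h (h' (rPlus a Q M + x)) (rPlus a Q M + x) := by
      have hd := (hh.differentiableOn (by simp)) (rPlus a Q M + x) (mem_Ici.2 (by linarith))
      exact hd.hasDerivWithinAt.hasDerivAt (Ici_mem_nhds (by linarith))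
    have hd1 := (hgd x hx'.le).mul (HasDerivAt.comp_const_add (rPlus a Q M) x hdh)
    have hd2 := (hu.solution.system hs hrs).hasDerivAt_profile hs hx'
    refine hd1.unique (hd2.congr_of_eventuallyEq ?_)
    filter_upwards [lt_mem_nhds hx'] with t ht using (hprof t ht).symm

/-! ### The incoming part measured by the Wronskian -/

lemma le_areaRadius (a Q M x : ℝ) : rPlus a Q M + x ≤ areaRadius a Q M x :=
  Real.le_sqrt_of_sq_le (by nlinarith [sq_nonneg a])

lemma areaRadius_le {a Q M : ℝ} (hs : Subextremal a Q M) {x : ℝ} (hx : 0 ≤ x) :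
    areaRadius a Q M x ≤ rPlus a Q M + x + |a| := by
  have hr := rPlus_pos hs
  refine Real.sqrt_le_iff.2 ⟨by positivity, ?_⟩
  have : 0 ≤ (rPlus a Q M + x) * |a| := by positivity
  nlinarith [sq_abs a]

lemma norm_profile {a Q M : ℝ} (hs : Subextremal a Q M) (ω : ℝ) (m : ℤ) (v : ℝ → ℂ) {x : ℝ}
    (hx : 0 ≤ x) : ‖profile a Q M ω m v x‖ = ‖v x‖ / areaRadius a Q M x := by
  rw [profile, norm_mul, norm_radialPhase, one_mul, norm_div,
    norm_ofReal_of_pos (areaRadius_pos hs hx)]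

lemma weight_inv_le_one {a Q M : ℝ} (hs : Subextremal a Q M) {x : ℝ} (hx : 0 < x) :
    x * (x + gap a Q M) / ((rPlus a Q M + x) ^ 2 + a ^ 2) ≤ 1 := by
  have hδ := gap_pos hs
  have hr := rPlus_pos hs
  have h := one_le_weight hs hx
  rw [le_div_iff₀ (by positivity), one_mul] at h
  exact (div_le_one (by positivity)).2 h

/-- The flux in terms of the radiation condition. -/
lemma norm_profileFlux_le {a Q M : ℝ} (hs : Subextremal a Q M) (ω : ℝ) (m : ℤ) (v y : ℝ → ℂ)
    {x : ℝ} (hx : 0 < x) :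
    ‖profileFlux a Q M ω m v y x‖ ≤ areaRadius a Q M x * ‖y x - Complex.I * ω * v x‖
      + ‖v x‖ / areaRadius a Q M x * (|ω * (rPlus a Q M ^ 2 + a ^ 2) + horizonFreq a Q M ω m|
        + 4 * M * |ω| * x + (rPlus a Q M + x)) := by
  have hδ := gap_pos hs
  have hr := rPlus_pos hs
  have hM := hs.1
  have hN := areaRadius_pos hs hx.le
  have h3 : (areaRadius a Q M x : ℂ) ≠ 0 := by exact_mod_cast hN.ne'
  -- The quadratic parts of ω(r²+a²) and T agree. Their difference grows only linearly, so it
  -- contributes O(1/x) to x|f'| for bounded v.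
  have hT : ω * ((rPlus a Q M + x) ^ 2 + a ^ 2) - (ω * x * (x + gap a Q M) - 2 * M * ω * x
      - horizonFreq a Q M ω m)
      = ω * (rPlus a Q M ^ 2 + a ^ 2) + horizonFreq a Q M ω m + 4 * M * ω * x := by
    rw [gap_eq]; ring
  have e : areaRadius a Q M x * (y x - ((x * (x + gap a Q M) * (rPlus a Q M + x)
        / ((rPlus a Q M + x) ^ 2 + a ^ 2) ^ 2 : ℝ) : ℂ) * v x)
      - Complex.I * ((ω * x * (x + gap a Q M) - 2 * M * ω * x - horizonFreq a Q M ω m : ℝ) : ℂ)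
        * (v x / areaRadius a Q M x)
      = areaRadius a Q M x * (y x - Complex.I * ω * v x) + v x / areaRadius a Q M x *
        (Complex.I * ((ω * (rPlus a Q M ^ 2 + a ^ 2) + horizonFreq a Q M ω m + 4 * M * ω * x : ℝ) : ℂ)
          - ((x * (x + gap a Q M) / ((rPlus a Q M + x) ^ 2 + a ^ 2) * (rPlus a Q M + x) : ℝ) : ℂ)) := by
    rw [← hT]
    simp only [← areaRadius_sq]
    push_cast
    field_simp
    ring
  rw [profileFlux, norm_mul, norm_radialPhase, one_mul, e]
  refine (norm_add_le _ _).trans ?_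
  rw [norm_mul, norm_mul, norm_div, norm_ofReal_of_pos hN]
  gcongr
  refine (norm_sub_le _ _).trans ?_
  rw [norm_mul, Complex.norm_I, one_mul, Complex.norm_real, Complex.norm_real]
  gcongr
  · refine (norm_add_le _ _).trans ?_
    rw [Real.norm_eq_abs, Real.norm_eq_abs, abs_mul _ x, abs_mul _ ω,
      abs_of_pos (by positivity : 0 < 4 * M), abs_of_pos hx]
  · rw [Real.norm_of_nonneg (by positivity)]
    exact mul_le_of_le_one_left (by positivity) (weight_inv_le_one hs hx)

lemma norm_snd_le {a Q M : ℝ} (hs : Subextremal a Q M) (ω : ℝ) (m : ℤ) (v y : ℝ → ℂ)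
    {x : ℝ} (hx : 0 < x) :
    areaRadius a Q M x * ‖y x‖ ≤ ‖profileFlux a Q M ω m v y x‖
      + (|ω * x * (x + gap a Q M) - 2 * M * ω * x - horizonFreq a Q M ω m| + (rPlus a Q M + x))
        * ‖profile a Q M ω m v x‖ := by
  have hδ := gap_pos hs
  have hr := rPlus_pos hs
  have hN := areaRadius_pos hs hx.le
  have h3 : (areaRadius a Q M x : ℂ) ≠ 0 := by exact_mod_cast hN.ne'
  set φ := radialPhase (gap a Q M) M ω (horizonExponent a Q M ω m) x with hφ
  have e : φ * (areaRadius a Q M x * y x) = profileFlux a Q M ω m v y x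
      + (((x * (x + gap a Q M) / ((rPlus a Q M + x) ^ 2 + a ^ 2) * (rPlus a Q M + x) : ℝ) : ℂ)
        + Complex.I * ((ω * x * (x + gap a Q M) - 2 * M * ω * x - horizonFreq a Q M ω m : ℝ) : ℂ))
        * profile a Q M ω m v x := by
    simp only [profileFlux, profile, ← hφ, ← areaRadius_sq]
    push_cast
    field_simp
    ring
  have h1 : areaRadius a Q M x * ‖y x‖ = ‖φ * (areaRadius a Q M x * y x)‖ := by
    rw [norm_mul, norm_mul, hφ, norm_radialPhase, one_mul, norm_ofReal_of_pos hN]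
  rw [h1, e]
  refine (norm_add_le _ _).trans ?_
  rw [norm_mul]
  gcongr
  refine (norm_add_le _ _).trans ?_
  rw [norm_mul, Complex.norm_I, one_mul, Complex.norm_real, Complex.norm_real, add_comm,
    Real.norm_eq_abs, Real.norm_of_nonneg (by positivity)]
  gcongr
  exact mul_le_of_le_one_left (by positivity) (weight_inv_le_one hs hx)

/-- The incoming part of the profile of an ingoing solution is measured by the Wronskian with an
outgoing one. -/
lemma profile_at_top {a Q M ω : ℝ} {m : ℤ} {lam : ℝ} {rs : ℝ → ℝ} {uH uO : ℝ → ℂ}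
    (hs : Subextremal a Q M) (hrs : IsTortoise a Q M rs) (hH : IsHor a Q M ω m lam rs uH)
    (hO : IsOut a Q M ω m lam rs uO) {V : ℝ}
    (hV : ∀ᶠ x in atTop, ‖uH (rs (rPlus a Q M + x))‖ ≤ V) (t : ℝ) {e : ℝ} (he : 0 < e) :
    ∀ᶠ x : ℝ in atTop, x * ‖profileFlux a Q M ω m (fun x => uH (rs (rPlus a Q M + x)))
      (fun x => deriv uH (rs (rPlus a Q M + x))) x / (x * ((x + gap a Q M : ℝ) : ℂ))‖
      ≤ ‖wronskian uH uO t‖ + e := by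
  have hδ := gap_pos hs
  have hr := rPlus_pos hs
  have hM := hs.1
  obtain ⟨hn, hrad⟩ := hO.radiation hs hrs
  set A := |ω * (rPlus a Q M ^ 2 + a ^ 2) + horizonFreq a Q M ω m| with hA
  have hA0 : 0 ≤ A := abs_nonneg _
  have hp : Tendsto (fun x : ℝ => x + gap a Q M) atTop atTop :=
    tendsto_atTop_add_const_right _ _ tendsto_id
  have l1 : Tendsto (fun x : ℝ => (rPlus a Q M + x + |a|) / (x + gap a Q M)) atTop (𝓝 (1 + 0)) := by
    have h1 : Tendsto (fun x : ℝ => 1 + (rPlus a Q M + |a| - gap a Q M) / (x + gap a Q M)) atTop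
        (𝓝 (1 + 0)) := (tendsto_const_nhds.div_atTop hp).const_add 1
    refine h1.congr' ?_
    filter_upwards [eventually_gt_atTop 0] with x hx
    have : x + gap a Q M ≠ 0 := by positivity
    field_simp
    ring
  have l2 : Tendsto (fun x : ℝ => (‖wronskian uH uO t‖ + V *
      ‖deriv uO (rs (rPlus a Q M + x)) - Complex.I * ω * uO (rs (rPlus a Q M + x))‖)
      / ‖uO (rs (rPlus a Q M + x))‖) atTop (𝓝 ((‖wronskian uH uO t‖ + V * 0) / 1)) :=
    ((hrad.const_mul V).const_add _).div hn one_ne_zero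
  have l3 : Tendsto (fun x : ℝ => V * ((A + rPlus a Q M) / gap a Q M + 4 * M * |ω| + 1) / x)
      atTop (𝓝 0) := tendsto_const_nhds.div_atTop tendsto_id
  have l := (l1.mul l2).add l3
  simp only [add_zero, one_mul, mul_zero, div_one] at l
  filter_upwards [l.eventually (gt_mem_nhds (lt_add_of_pos_right _ he)), hV, eventually_gt_atTop 0,
    hn.eventually (lt_mem_nhds (show (0 : ℝ) < 1 by norm_num))] with x hx hvx hx0 hn0
  refine le_trans ?_ hx.le
  have hpx : 0 < x + gap a Q M := by positivity
  have hN := areaRadius_pos hs hx0.le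
  set v := uH (rs (rPlus a Q M + x)) with hv
  set y := deriv uH (rs (rPlus a Q M + x)) with hy
  have hV0 : 0 ≤ V := (norm_nonneg _).trans hvx
  have hflux := norm_profileFlux_le hs ω m (fun x => uH (rs (rPlus a Q M + x)))
      (fun x => deriv uH (rs (rPlus a Q M + x))) hx0
  simp only [← hv, ← hy, ← hA] at hflux
  have hW : ‖y - Complex.I * ω * v‖ ≤ (‖wronskian uH uO t‖ + V *
      ‖deriv uO (rs (rPlus a Q M + x)) - Complex.I * ω * uO (rs (rPlus a Q M + x))‖)
      / ‖uO (rs (rPlus a Q M + x))‖ := by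
    rw [le_div_iff₀ hn0, ← norm_mul, wronskian_eq hs hrs hH.solution hO.solution t
      (rs (rPlus a Q M + x))]
    -- Eliminating u_out' from the Wronskian: by the radiation condition the first term tends to 0
    -- and |u_out| tends to 1, so |u_hor' - iωu_hor| is asymptotically at most |W|.
    have e : (y - Complex.I * ω * v) * uO (rs (rPlus a Q M + x))
        = v * (deriv uO (rs (rPlus a Q M + x)) - Complex.I * ω * uO (rs (rPlus a Q M + x)))
          - wronskian uH uO (rs (rPlus a Q M + x)) := by
      rw [wronskian]; ring
    rw [e]
    refine (norm_sub_le _ _).trans ?_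
    rw [norm_mul, add_comm]
    gcongr
  set Y := (‖wronskian uH uO t‖ + V *
      ‖deriv uO (rs (rPlus a Q M + x)) - Complex.I * ω * uO (rs (rPlus a Q M + x))‖)
      / ‖uO (rs (rPlus a Q M + x))‖ with hY
  rw [norm_div, norm_mul, norm_ofReal_of_pos hx0, norm_ofReal_of_pos hpx]
  have hY0 : 0 ≤ Y := (norm_nonneg _).trans hW
  have hlin : A + 4 * M * |ω| * x + (rPlus a Q M + x)
      ≤ ((A + rPlus a Q M) / gap a Q M + 4 * M * |ω| + 1) * (x + gap a Q M) := by
    have e1 : (A + rPlus a Q M) / gap a Q M * gap a Q M = A + rPlus a Q M := by field_simp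
    have e2 : 0 ≤ (A + rPlus a Q M) / gap a Q M * x := by positivity
    have e3 : 0 ≤ 4 * M * |ω| * gap a Q M := by positivity
    nlinarith
  calc _ = ‖profileFlux a Q M ω m (fun x => uH (rs (rPlus a Q M + x)))
        (fun x => deriv uH (rs (rPlus a Q M + x))) x‖ / (x + gap a Q M) := by field_simp
    _ ≤ ((rPlus a Q M + x + |a|) * Y + V / x *
        (((A + rPlus a Q M) / gap a Q M + 4 * M * |ω| + 1) * (x + gap a Q M))) / (x + gap a Q M) := by
        refine div_le_div_of_nonneg_right (hflux.trans ?_) hpx.le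
        refine add_le_add (mul_le_mul (areaRadius_le hs hx0.le) hW (norm_nonneg _) (by positivity)) ?_
        refine mul_le_mul ?_ hlin (by positivity) (by positivity)
        have : x ≤ areaRadius a Q M x := by linarith [le_areaRadius a Q M x]
        gcongr
    _ = _ := by field_simp

/-! ### Uniform constants and the final lower bound -/

set_option maxHeartbeats 1000000 in
/-- Uniform control of the profile of an ingoing solution. -/
theorem exists_modeProfile {a Q M K : ℝ} (hs : Subextremal a Q M) (hK : 0 < K) :
    ∃ K' B x₀, 0 < K' ∧ 0 < x₀ ∧ ∀ (ω : ℝ) (m : ℤ) (lam : ℝ) (rs : ℝ → ℝ) (uH uO : ℝ → ℂ) (t : ℝ),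
      ω ≠ 0 → |ω| ≤ K → |ω|⁻¹ ≤ K → |(m : ℝ)| ≤ K → |lam| ≤ K → IsTortoise a Q M rs →
      IsHor a Q M ω m lam rs uH → IsOut a Q M ω m lam rs uO →
      ∃ (c b : ℝ) (f f' : ℝ → ℂ) (f₀ : ℂ), |ω| ≤ K' ∧ |ω|⁻¹ ≤ K' ∧ |c| ≤ K' ∧ |b| ≤ K' ∧
        ModeProfile (gap a Q M) M ω c b f f' B ‖wronskian uH uO t‖ ∧
        ‖f₀‖ = 1 / areaRadius a Q M 0 ∧
        ∀ x, 0 < x → x ≤ x₀ → ‖f x - f₀‖ ≤ 1 / areaRadius a Q M 0 / 8 := by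
  have hδ := gap_pos hs
  have hr := rPlus_pos hs
  have hM := hs.1
  set δ := gap a Q M with hδd
  set κ₀ := K * (rPlus a Q M ^ 2 + a ^ 2) + |a| * K with hκ₀
  set c' := 2 * κ₀ / δ with hc'
  set b' := 4 * K * κ₀ + K + a ^ 2 * K ^ 2 + 2 * |a| * K * K with hb'
  set κ := 2 * K + 8 * M * K ^ 2 + b' + K * (δ + 2 * M) with hκ
  have hκ₀0 : 0 ≤ κ₀ := by positivity
  have hκ0 : 0 ≤ κ := by positivity
  -- Small enough for the absorption in `near_horizon`; x₀ ≤ 1 makes κ bound the zeroth-order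
  -- coefficient on (0, x₀].
  set x₀ := min 1 (δ / (16 * (κ + 1))) with hx₀d
  have hx₀ : 0 < x₀ := lt_min one_pos (by positivity)
  have hκx : κ * x₀ ≤ δ / 16 := by
    calc κ * x₀ ≤ (κ + 1) * (δ / (16 * (κ + 1))) :=
          mul_le_mul (by linarith) (min_le_right _ _) hx₀.le (by positivity)
      _ = δ / 16 := by field_simp
  set c₀ := 1 / areaRadius a Q M 0 with hc₀
  have hc₀0 : 0 < c₀ := one_div_pos.2 (areaRadius_pos hs le_rfl)
  set N₀ := areaRadius a Q M x₀ with hN₀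
  have hN₀0 : 0 < N₀ := areaRadius_pos hs hx₀.le
  -- Y₀ bounds √(r²+a²)|u'| at x₀ through `norm_snd_le`. Then E₀ bounds the energy there, X₀ its
  -- growth, and V the size of u_hor beyond x₀, using |ω|⁻¹ ≤ K.
  set Y₀ := x₀ * (x₀ + δ) * (2 * κ / δ * c₀)
    + (K * x₀ * (x₀ + δ) + 2 * M * K * x₀ + κ₀ + (rPlus a Q M + x₀)) * (2 * c₀) with hY₀
  set E₀ := (Y₀ / N₀) ^ 2 + K ^ 2 * (2 * c₀ * N₀) ^ 2 with hE₀
  set X₀ := Real.exp (potentialBound a Q M K * ((x₀ + δ) / x₀) * K / (x₀ + δ)) with hX₀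
  set V := K * √(E₀ * X₀) with hV
  have hV0 : 0 ≤ V := by positivity
  refine ⟨K + c' + b', V + 2 * c₀ * (x₀ + δ), x₀, by positivity, hx₀, ?_⟩
  intro ω m lam rs uH uO t hω0 hω hω' hm hl hrs hH hO
  set c := horizonExponent a Q M ω m with hc
  set b := accessory a Q M ω m lam with hb
  set v : ℝ → ℂ := fun x => uH (rs (rPlus a Q M + x)) with hv
  set y : ℝ → ℂ := fun x => deriv uH (rs (rPlus a Q M + x)) with hy
  have hsys : CarterSystem a Q M ω m lam v y := hH.solution.system hs hrs
  obtain ⟨f₀, hf₀, hlim, hzero⟩ := hH.profile_regular hs hrs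
  set f := profile a Q M ω m v with hf
  set f' : ℝ → ℂ := fun x => profileFlux a Q M ω m v y x / (x * ((x + δ : ℝ) : ℂ)) with hf'
  have hκb : |horizonFreq a Q M ω m| ≤ κ₀ := by
    rw [horizonFreq]
    refine (abs_sub _ _).trans ?_
    rw [abs_mul, abs_mul, abs_of_nonneg (by positivity : 0 ≤ rPlus a Q M ^ 2 + a ^ 2), hκ₀]
    gcongr
  have hcb : |c| ≤ c' := by
    rw [hc, horizonExponent, abs_div, abs_mul, abs_two, abs_of_pos hδ, hc']
    gcongr
  have hbb : |b| ≤ b' := by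
    have e1 : |4 * ω * horizonFreq a Q M ω m| ≤ 4 * K * κ₀ := by
      rw [abs_mul, abs_mul, abs_of_pos (by norm_num : (0 : ℝ) < 4)]
      gcongr
    have e2 : |a ^ 2 * ω ^ 2| ≤ a ^ 2 * K ^ 2 := by
      rw [abs_of_nonneg (by positivity), ← sq_abs ω]
      gcongr
    have e3 : |2 * a * m * ω| ≤ 2 * |a| * K * K := by
      rw [abs_mul, abs_mul, abs_mul, abs_two]
      gcongr
    have := abs_add_le (4 * ω * horizonFreq a Q M ω m - lam - a ^ 2 * ω ^ 2) (2 * a * m * ω)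
    have := abs_sub (4 * ω * horizonFreq a Q M ω m - lam) (a ^ 2 * ω ^ 2)
    have := abs_sub (4 * ω * horizonFreq a Q M ω m) lam
    rw [hb, accessory, hb']
    linarith
  have hd : ∀ x, 0 < x → HasDerivAt f (f' x) x := fun x hx => hsys.hasDerivAt_profile hs hx
  have ho : ∀ x, 0 < x → HasDerivAt (fun y : ℝ => (y : ℂ) * ((y + δ : ℝ) : ℂ) * f' y)
      (-(2 * Complex.I * (ω * x * (x + δ) - 2 * M * ω * x - c * δ / 2) * f' x)
        - (2 * Complex.I * ω * x + 8 * M * ω ^ 2 * x + b + Complex.I * ω * (δ - 2 * M)) * f x) x := by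
    intro x hx
    refine (hsys.hasDerivAt_profileFlux hs hx).congr_of_eventuallyEq ?_
    filter_upwards [lt_mem_nhds hx] with z hz
    have h1 : (z : ℂ) ≠ 0 := by exact_mod_cast hz.ne'
    have h2 : ((z + δ : ℝ) : ℂ) ≠ 0 := by exact_mod_cast (by positivity : z + δ ≠ 0)
    exact mul_div_cancel₀ _ (mul_ne_zero h1 h2)
  have hκn : ∀ x, 0 < x → x ≤ x₀ →
      ‖(2 * Complex.I * ω * x + 8 * M * ω ^ 2 * x + b + Complex.I * ω * (δ - 2 * M) : ℂ)‖ ≤ κ := by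
    intro x hx hxx
    have hx1 : x ≤ 1 := hxx.trans (min_le_left _ _)
    have e1 : ‖(2 * Complex.I * ω * x : ℂ)‖ ≤ 2 * K := by
      rw [norm_mul, norm_mul, norm_mul, Complex.norm_I, Complex.norm_ofNat, Complex.norm_real,
        norm_ofReal_of_pos hx, Real.norm_eq_abs, mul_one]
      calc 2 * |ω| * x ≤ 2 * K * 1 := by gcongr
        _ = 2 * K := mul_one _
    have e2 : ‖(8 * M * ω ^ 2 * x : ℂ)‖ ≤ 8 * M * K ^ 2 := by
      rw [norm_mul, norm_mul, norm_mul, norm_pow, Complex.norm_ofNat, Complex.norm_real ω,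
        norm_ofReal_of_pos hx, norm_ofReal_of_pos hM, Real.norm_eq_abs]
      calc 8 * M * |ω| ^ 2 * x ≤ 8 * M * K ^ 2 * 1 := by gcongr
        _ = _ := mul_one _
    have e3 : ‖(b : ℂ)‖ ≤ b' := by rw [Complex.norm_real]; exact hbb
    have e4 : ‖Complex.I * ω * (δ - 2 * M)‖ ≤ K * (δ + 2 * M) := by
      rw [norm_mul, norm_mul, Complex.norm_I, one_mul, Complex.norm_real]
      refine mul_le_mul hω ((norm_sub_le _ _).trans ?_) (norm_nonneg _) hK.le
      rw [norm_mul, Complex.norm_ofNat, norm_ofReal_of_pos hδ, norm_ofReal_of_pos hM]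
    have := norm_add_le (2 * Complex.I * ω * x + 8 * M * ω ^ 2 * x + b : ℂ)
      (Complex.I * ω * (δ - 2 * M))
    have := norm_add_le (2 * Complex.I * ω * x + 8 * M * ω ^ 2 * x : ℂ) (b : ℂ)
    have := norm_add_le (2 * Complex.I * ω * x : ℂ) (8 * M * ω ^ 2 * x)
    linarith
  have hnear : ∀ x, 0 < x → x ≤ x₀ → ‖f x - f₀‖ ≤ c₀ / 8 ∧ ‖f' x‖ ≤ 2 * κ / δ * c₀ := by
    intro x hx hxx
    rw [hc₀, ← hf₀]
    exact near_horizon hδ hx₀ hd ho hzero hlim hκn hκx hx hxx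
  have hfn : ∀ x, 0 < x → x ≤ x₀ → ‖f x‖ ≤ 2 * c₀ := by
    intro x hx hxx
    have h1 := (hnear x hx hxx).1
    have h2 := norm_sub_norm_le (f x) f₀
    rw [hf₀] at h2
    linarith
  have hv₀ : ‖v x₀‖ ≤ 2 * c₀ * N₀ := by
    have h1 := hfn x₀ hx₀ le_rfl
    rw [hf, norm_profile hs ω m v hx₀.le, div_le_iff₀ hN₀0] at h1
    exact h1
  have hy₀ : ‖y x₀‖ ≤ Y₀ / N₀ := by
    rw [le_div_iff₀ hN₀0, mul_comm]
    refine (norm_snd_le hs ω m v y hx₀).trans ?_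
    have hp : 0 < x₀ + δ := by positivity
    have h1 : ‖profileFlux a Q M ω m v y x₀‖ ≤ x₀ * (x₀ + δ) * (2 * κ / δ * c₀) := by
      have h2 := (hnear x₀ hx₀ le_rfl).2
      simp only [hf'] at h2
      rw [norm_div, norm_mul, norm_ofReal_of_pos hx₀, norm_ofReal_of_pos hp,
        div_le_iff₀ (by positivity), mul_comm] at h2
      exact h2
    have h3 : |ω * x₀ * (x₀ + gap a Q M) - 2 * M * ω * x₀ - horizonFreq a Q M ω m|
        ≤ K * x₀ * (x₀ + δ) + 2 * M * K * x₀ + κ₀ := by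
      have e1 : |ω * x₀ * (x₀ + δ)| ≤ K * x₀ * (x₀ + δ) := by
        rw [abs_mul, abs_mul, abs_of_pos hx₀, abs_of_pos hp]
        gcongr
      have e2 : |2 * M * ω * x₀| ≤ 2 * M * K * x₀ := by
        rw [abs_mul, abs_mul, abs_of_pos hx₀, abs_of_pos (by positivity : 0 < 2 * M)]
        gcongr
      have := abs_sub (ω * x₀ * (x₀ + δ) - 2 * M * ω * x₀) (horizonFreq a Q M ω m)
      have := abs_sub (ω * x₀ * (x₀ + δ)) (2 * M * ω * x₀)
      rw [← hδd]
      linarith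
    refine add_le_add h1 (mul_le_mul (by linarith) (hfn x₀ hx₀ le_rfl) (norm_nonneg _) (by positivity))
  have hE₀0 : 0 ≤ E₀ := by positivity
  have hEb : ‖y x₀‖ ^ 2 + ω ^ 2 * ‖v x₀‖ ^ 2 ≤ E₀ := by
    have e1 : ω ^ 2 ≤ K ^ 2 := by rw [← sq_abs ω]; exact pow_le_pow_left₀ (abs_nonneg _) hω 2
    exact add_le_add (pow_le_pow_left₀ (norm_nonneg _) hy₀ 2)
      (mul_le_mul e1 (pow_le_pow_left₀ (norm_nonneg _) hv₀ 2) (by positivity) (by positivity))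
  have hvV : ∀ x, x₀ ≤ x → ‖v x‖ ≤ V := by
    intro x hx
    have hωp : 0 < |ω| := abs_pos.2 hω0
    have h1 := hsys.energy_le hs hω0 hω hm hl hx₀ hx
    have hpot : 0 ≤ potentialBound a Q M K := by rw [potentialBound]; positivity
    have hXb : potentialBound a Q M K * ((x₀ + δ) / x₀) * |ω|⁻¹ / (x₀ + δ)
        ≤ potentialBound a Q M K * ((x₀ + δ) / x₀) * K / (x₀ + δ) := by gcongr
    have h2 : ω ^ 2 * ‖v x‖ ^ 2 ≤ E₀ * X₀ := by
      calc ω ^ 2 * ‖v x‖ ^ 2 ≤ ‖y x‖ ^ 2 + ω ^ 2 * ‖v x‖ ^ 2 := le_add_of_nonneg_left (by positivity)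
        _ ≤ _ := h1
        _ ≤ E₀ * X₀ := mul_le_mul hEb (Real.exp_le_exp.2 hXb) (Real.exp_pos _).le hE₀0
    have h3 : |ω| * ‖v x‖ ≤ √(E₀ * X₀) := by
      refine Real.le_sqrt_of_sq_le ?_
      rw [mul_pow, sq_abs]; exact h2
    calc ‖v x‖ = |ω|⁻¹ * (|ω| * ‖v x‖) := by field_simp
      _ ≤ K * √(E₀ * X₀) := mul_le_mul hω' h3 (by positivity) hK.le
  have hc'0 : 0 ≤ c' := by positivity
  have hb'0 : 0 ≤ b' := by positivity
  refine ⟨c, b, f, f', f₀, by linarith, by linarith, by linarith, by linarith, ?_, hf₀,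
    fun x hx hxx => (hnear x hx hxx).1⟩
  refine ⟨hd, ho, ?_, hzero, ?_⟩
  · intro x hx
    have hp : 0 < x + δ := by positivity
    rw [le_div_iff₀ hp]
    rcases le_total x x₀ with hxx | hxx
    · calc ‖f x‖ * (x + δ) ≤ 2 * c₀ * (x₀ + δ) := by
            have := hfn x hx hxx
            gcongr
        _ ≤ _ := le_add_of_nonneg_left hV0
    · rw [hf, norm_profile hs ω m v hx.le]
      have hN := areaRadius_pos hs hx.le
      have hle : x + δ ≤ areaRadius a Q M x := by
        linarith [le_areaRadius a Q M x, gap_le_rPlus hs]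
      calc ‖v x‖ / areaRadius a Q M x * (x + δ) ≤ ‖v x‖ / areaRadius a Q M x * areaRadius a Q M x := by
            gcongr
        _ = ‖v x‖ := by field_simp
        _ ≤ V := hvV x hxx
        _ ≤ _ := le_add_of_nonneg_right (by positivity)
  · intro e he
    exact profile_at_top hs hrs hH hO
      (by filter_upwards [eventually_ge_atTop x₀] with x hx using hvV x hx) t he

/-- Uniform lower bound for the Wronskian on bounded frequency ranges. -/
theorem exists_wronskian_lower_bound {a Q M : ℝ} (hs : Subextremal a Q M) (K : ℝ) :
    ∃ η, 0 < η ∧ ∀ (ω : ℝ) (m : ℤ) (lam : ℝ) (rs : ℝ → ℝ) (uH uO : ℝ → ℂ) (t : ℝ),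
      ω ≠ 0 → |ω| ≤ K → |ω|⁻¹ ≤ K → |(m : ℝ)| ≤ K → |lam| ≤ K → IsTortoise a Q M rs →
      IsHor a Q M ω m lam rs uH → IsOut a Q M ω m lam rs uO → η < ‖wronskian uH uO t‖ := by
  rcases le_or_gt K 0 with hK | hK
  · refine ⟨1, one_pos, fun ω m lam rs uH uO t hω0 hω => ?_⟩
    exact absurd (hω.trans hK) (not_le.2 (abs_pos.2 hω0))
  obtain ⟨K', B, x₀, hK', hx₀, h⟩ := exists_modeProfile hs hK
  obtain ⟨η, hη, hη'⟩ := exists_incoming_lower_bound (B := B) (gap_pos hs) hs.1 hK'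
    (one_div_pos.2 (areaRadius_pos hs le_rfl)) hx₀
  refine ⟨η, hη, fun ω m lam rs uH uO t hω0 hω hω' hm hl hrs hH hO => ?_⟩
  obtain ⟨c, b, f, f', f₀, h1, h2, h3, h4, h5, h6, h7⟩ :=
    h ω m lam rs uH uO t hω0 hω hω' hm hl hrs hH hO
  exact hη' ω c b _ f f' f₀ hω0 h1 h2 h3 h4 h5 h6 h7

end

end KerrNewman

/-! ### The theorem -/

theorem theorem3p1 :
    ∃ G : ℝ → ℝ → ℝ → ℝ → ℝ,
      ∀ a Q M : ℝ, KerrNewman.Subextremal a Q M →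
      ∀ F : Set (ℝ × ℤ × ℤ), F ⊆ KerrNewman.admissibleFreq →
        BddAbove (KerrNewman.freqSize a '' F) →
      ∀ rs : ℝ → ℝ, KerrNewman.IsTortoise a Q M rs →
      ∀ (ω : ℝ) (m ℓ : ℤ), (ω, m, ℓ) ∈ F →
      ∀ uHor uOut : ℝ → ℂ,
        KerrNewman.IsHor a Q M ω m (KerrNewman.angularEigenvalue a ω m ℓ) rs uHor →
        KerrNewman.IsOut a Q M ω m (KerrNewman.angularEigenvalue a ω m ℓ) rs uOut →
      ∀ x : ℝ,
        KerrNewman.wronskian uHor uOut x ≠ 0 ∧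
          ‖(KerrNewman.wronskian uHor uOut x)⁻¹‖ ≤ G (KerrNewman.freqBound a F) a Q M := by
  -- Subextremality is moved inside the existential, with the value 1 when it fails, so that choice
  -- yields η as a function of four real variables; G is its reciprocal.
  have key : ∀ K a Q M : ℝ, ∃ η, 0 < η ∧ (KerrNewman.Subextremal a Q M →
      ∀ (ω : ℝ) (m : ℤ) (lam : ℝ) (rs : ℝ → ℝ) (uH uO : ℝ → ℂ) (t : ℝ),
      ω ≠ 0 → |ω| ≤ K → |ω|⁻¹ ≤ K → |(m : ℝ)| ≤ K → |lam| ≤ K → KerrNewman.IsTortoise a Q M rs →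
      KerrNewman.IsHor a Q M ω m lam rs uH → KerrNewman.IsOut a Q M ω m lam rs uO →
      η < ‖KerrNewman.wronskian uH uO t‖) := by
    intro K a Q M
    by_cases hs : KerrNewman.Subextremal a Q M
    · obtain ⟨η, hη, h⟩ := KerrNewman.exists_wronskian_lower_bound hs K
      exact ⟨η, hη, fun _ => h⟩
    · exact ⟨1, one_pos, fun h => absurd h hs⟩
  choose η hη hη' using key
  refine ⟨fun K a Q M => (η K a Q M)⁻¹, ?_⟩
  intro a Q M hs F hF hbdd rs hrs ω m ℓ hmem uHor uOut hH hO x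
  have hω0 : ω ≠ 0 := (hF hmem).1
  have hle : KerrNewman.freqSize a (ω, m, ℓ) ≤ KerrNewman.freqBound a F :=
    le_csSup hbdd (Set.mem_image_of_mem _ hmem)
  simp only [KerrNewman.freqSize] at hle
  have h0 := abs_nonneg ω
  have h1 : 0 ≤ |ω|⁻¹ := by positivity
  have h2 := abs_nonneg (m : ℝ)
  have h3 := abs_nonneg (KerrNewman.angularEigenvalue a ω m ℓ)
  have hlt := hη' (KerrNewman.freqBound a F) a Q M hs ω m _ rs uHor uOut x hω0 (by linarith)
    (by linarith) (by linarith) (by linarith) hrs hH hO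
  have hpos := hη (KerrNewman.freqBound a F) a Q M
  refine ⟨norm_pos_iff.1 (hpos.trans hlt), ?_⟩
  rw [norm_inv]
  exact inv_anti₀ hpos hlt.le
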